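/- Let $d\in\{2,3\}$ and let $\mathcal D\subset\mathbb R^d$ be a bounded polyhedral domain, i.e. an open connected set with $\mathcal D=\operatorname{int}\overline{\mathcal D}$ whose closure is a finite union of the simplices of a triangulation. Let $X:\mathbb R^d\to\mathbb R^d$ be a smooth vector field with $\operatorname{div}X=0$ in $\mathcal D$ and $X\cdot n=0$ on (the flat part of) $\partial\mathcal D$, let $T>0$, $u_0\in L^2(\mathcal D)$ (deterministic) and $\kappa>0$. Write $(\cdot,\cdot)$ for the inner product of $L^2(\mathcal D)$ and $\bar u_0=|\mathcal D|^{-1}(u_0,1)$. For a finite conforming triangulation $\mathcal T_h$ of $\mathcal D$ put $$V_h=\{v\in H^1(\mathcal D): v|_K\text{ is affine for every }K\in\mathcal T_h\},\qquad \mathring V_h=\{v\in V_h:(v,1)=0\}.$$ For $\zeta\in\mathring V_h$ let $\Delta_h^{-1}\zeta\in\mathring V_h$ be defined by $(\nabla(-\Delta_h^{-1}\zeta),\nabla v)=(\zeta,v)$ for all $v\in V_h$, and let $\|\zeta\|_{-1,h}=\|\nabla\Delta_h^{-1}\zeta\|_{L^2(\mathcal D)}$. Then there are a constant $C_0>0$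 and a function $C(\cdot,\cdot)$, depending only on $d,\mathcal D,X,T,u_0,\kappa$, such that the following holds for all $\delta,\epsilon>0$, all triangulations $\mathcal T_h$ of $\mathcal D$ that are quasi-uniform with constant $\kappa$ (every element contains a ball of radius $\kappa h$, where $h$ is the largest diameter of an element), and all $N\ge1$ such that $\tau=T/N$ satisfies the mesh constraint $$\tau\le C_0\,(\epsilon^{-3}+\epsilon^{-1}\delta^4)^{-1}.$$ Let $W$ be a standard real-valued Wiener process on a filtered probability space $(\Omega,\mathcal F,\{\mathcal F_t\}_{t\ge0},\mathbb P)$, let $t_n=n\tau$, and let $(u_h^n,w_h^n)$, $0\le n\le N$, be a $V_h\times V_h$-valued process, adapted to $\mathcal F_{t_n}$, which satisfies $\mathbb P$-almost surely, for $n=0,\dots,N-1$ and all $\eta_h,v_h\in V_h$, $$(u_h^{n+1},\eta_h)=(u_h^n,\eta_h)-\tau(\nabla w_h^{n+1},\nabla\eta_h)-\tau\tfrac{\delta^2}{2}(\nabla u_h^{n+1}\cdot X,\nabla\eta_h\cdot X)+\delta\big(\nabla u_h^n\cdot X\,(W_{t_{n+1}}-W_{t_n}),\eta_h\big),$$ $$(w_h^{n+1},v_h)=\epsilon(\nabla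 u_h^{n+1},\nabla v_h)+\tfrac1\epsilon\big((u_h^{n+1})^3-u_h^{n+1},v_h\big),$$ with the initial values given by $(u_h^0,v_h)=(u_0,v_h)$ and $(w_h^0,v_h)=\epsilon(\nabla u_h^0,\nabla v_h)+\frac1\epsilon((u_h^0)^3-u_h^0,v_h)$ for all $v_h\in V_h$. Then, for every $0\le n\le N$, $u_h^n-\bar u_0\in\mathring V_h$ almost surely, the expectations below exist and are finite, and $$\sup_{0\le n\le N}\mathbb E\big[\|u_h^n-\bar u_0\|_{-1,h}^2\big]+\mathbb E\Big[\sum_{n=1}^N\tau\|\nabla u_h^n\|_{L^2(\mathcal D)}^2\Big]\le C(\delta,\epsilon^{-1}).$$ -/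

import Mathlib

open MeasureTheory ProbabilityTheory Filter Topology
open scoped NNReal

namespace SCH

noncomputable section

/-- The Euclidean space `ℝ^d`. -/
abbrev E (d : ℕ) : Type := EuclideanSpace ℝ (Fin d)

/-! ### The domain and the vector field -/

/-- `ν` is the outward unit normal of `D` at a flat boundary point `x`: near `x` the set `D` is the
open half-space through `x` that lies opposite to `ν`. For a polyhedral domain such a `ν` exists
exactly at the points in the relative interior of the boundary faces, where it is unique. -/
def IsOutwardNormal {d : ℕ} (D : Set (E d)) (x ν : E d) : Prop :=
  ‖ν‖ = 1 ∧ ∀ᶠ y in 𝓝 x, (y ∈ D ↔ inner ℝ ν (y - x) < 0)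

/-- `X · n = 0` on the boundary of `D`. -/
def IsTangential {d : ℕ} (D : Set (E d)) (X : E d → E d) : Prop :=
  ∀ x ν, IsOutwardNormal D x ν → inner ℝ (X x) ν = 0

/-- The divergence of a vector field. -/
def divergence {d : ℕ} (X : E d → E d) (x : E d) : ℝ :=
  ∑ i : Fin d, (fderiv ℝ X x (EuclideanSpace.single i 1)) i

/-! ### Function spaces -/

/-- `G` is the weak gradient of `v` in `D`, tested with `C_c^∞(D)`. -/
def HasWeakGradient {d : ℕ} (D : Set (E d)) (v : E d → ℝ) (G : E d → E d) : Prop :=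
  ∀ φ : E d → ℝ, ContDiff ℝ (⊤ : ℕ∞) φ → HasCompactSupport φ → tsupport φ ⊆ D →
    ∫ x in D, v x • gradient φ x = - ∫ x in D, φ x • G x

/-- `v ∈ H¹(D)`. -/
def MemH1 {d : ℕ} (D : Set (E d)) (v : E d → ℝ) : Prop :=
  MemLp v 2 (volume.restrict D) ∧
    ∃ G : E d → E d, MemLp G 2 (volume.restrict D) ∧ HasWeakGradient D v G

/-- The inner product of `L²(D)`. -/
def ip {d : ℕ} (D : Set (E d)) (f g : E d → ℝ) : ℝ := ∫ x in D, f x * g x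

/-- `(∇ f, ∇ g)`, the `L²(D)` inner product of gradients. It is only used for piecewise affine
functions in `H¹(D)`, whose weak gradient is almost everywhere the classical gradient. -/
def gradIp {d : ℕ} (D : Set (E d)) (f g : E d → ℝ) : ℝ :=
  ∫ x in D, inner ℝ (gradient f x) (gradient g x)

/-- The squared norm `‖∇ f‖²` in `L²(D)`. -/
def gradNormSq {d : ℕ} (D : Set (E d)) (f : E d → ℝ) : ℝ := ∫ x in D, ‖gradient f x‖ ^ 2

/-- The function `∇ f · X`. -/
def gradDot {d : ℕ} (X : E d → E d) (f : E d → ℝ) (x : E d) : ℝ := inner ℝ (gradient f x) (X x)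

/-- The mean value `|D|⁻¹ (f, 1)`. -/
def mean {d : ℕ} (D : Set (E d)) (f : E d → ℝ) : ℝ := (volume.real D)⁻¹ * ∫ x in D, f x

/-- `v - c` on the closure of `D`, with functions on the closure of `D` extended by zero. -/
def subConst {d : ℕ} (D : Set (E d)) (v : E d → ℝ) (c : ℝ) : E d → ℝ :=
  fun x => v x - (closure D).indicator (fun _ => c) x

/-! ### Triangulations and finite element spaces -/

/-- A finite conforming triangulation of `D` into closed `d`-simplices. Conformity, and the
non-degeneracy of the simplices, are part of the notion of a geometric simplicial complex. -/
structure IsTriangulation {d : ℕ} (D : Set (E d)) (S : Geometry.SimplicialComplex ℝ (E d)) :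
    Prop where
  finite : S.faces.Finite
  pure : ∀ s ∈ S.faces, ∃ t ∈ S.faces, s ⊆ t ∧ t.card = d + 1
  space_eq : S.space = closure D

/-- The elements `K` of the triangulation: the convex hulls of the `d`-dimensional faces. -/
def elements {d : ℕ} (S : Geometry.SimplicialComplex ℝ (E d)) : Set (Set (E d)) :=
  {K | ∃ s ∈ S.faces, s.card = d + 1 ∧ K = convexHull ℝ (s : Set (E d))}

/-- Quasi-uniformity with constant `κ`: every element contains a ball of radius `κ h`, where `h` is
the largest diameter of an element. -/
def IsQuasiUniform {d : ℕ} (κ : ℝ) (S : Geometry.SimplicialComplex ℝ (E d)) : Prop :=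
  ∀ K ∈ elements S, ∀ L ∈ elements S, ∃ c, Metric.ball c (κ * Metric.diam L) ⊆ K

/-- The space `V_h` of functions in `H¹(D)` that are affine on every element. Its members are
functions on the closure of `D`, extended by zero. -/
def Vh {d : ℕ} (D : Set (E d)) (S : Geometry.SimplicialComplex ℝ (E d)) : Set (E d → ℝ) :=
  {v | MemH1 D v ∧ (∀ x, x ∉ closure D → v x = 0) ∧
    ∀ K ∈ elements S, ∃ p : E d →ᵃ[ℝ] ℝ, Set.EqOn v p K}

/-- The functions of zero mean in `V_h`. -/
def Vh0 {d : ℕ} (D : Set (E d)) (S : Geometry.SimplicialComplex ℝ (E d)) : Set (E d → ℝ) :=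
  {v | v ∈ Vh D S ∧ ∫ x in D, v x = 0}

/-- `z = Δ_h⁻¹ ζ`. -/
def IsDiscInvLap {d : ℕ} (D : Set (E d)) (S : Geometry.SimplicialComplex ℝ (E d))
    (ζ z : E d → ℝ) : Prop :=
  z ∈ Vh0 D S ∧ ∀ v ∈ Vh D S, gradIp D (-z) v = ip D ζ v

open Classical in
/-- The inverse discrete Laplace operator `Δ_h⁻¹`, meant for arguments `ζ` of zero mean in `V_h`. -/
def discInvLap {d : ℕ} (D : Set (E d)) (S : Geometry.SimplicialComplex ℝ (E d))
    (ζ : E d → ℝ) : E d → ℝ :=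
  if h : ∃ z, IsDiscInvLap D S ζ z then h.choose else 0

/-- The discrete `H⁻¹` inner product `(ζ, Φ)_{-1,h}`. -/
def negIp {d : ℕ} (D : Set (E d)) (S : Geometry.SimplicialComplex ℝ (E d))
    (ζ Φ : E d → ℝ) : ℝ :=
  gradIp D (-discInvLap D S ζ) (-discInvLap D S Φ)

/-- The discrete `H⁻¹` norm `‖ζ‖_{-1,h}`. -/
def negNorm {d : ℕ} (D : Set (E d)) (S : Geometry.SimplicialComplex ℝ (E d))
    (ζ : E d → ℝ) : ℝ :=
  Real.sqrt (negIp D S ζ ζ)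

/-! ### Wiener process and scheme -/

/-- `W` is a standard real-valued Wiener process with respect to the filtration `ℱ`. -/
structure IsWiener {Ω : Type*} [m : MeasurableSpace Ω] (P : Measure Ω) (ℱ : Filtration ℝ≥0 m)
    (W : ℝ≥0 → Ω → ℝ) : Prop where
  brownian : IsBrownianReal W P
  adapted : Adapted ℱ W
  indep : ∀ s t : ℝ≥0, s ≤ t →
    Indep (MeasurableSpace.comap (fun ω => W t ω - W s ω) inferInstance) (ℱ s) P

/-- The nonlinearity `u³ - u`. -/
def fNl {d : ℕ} (u : E d → ℝ) (x : E d) : ℝ := u x ^ 3 - u x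

/-- `(u_h^n, w_h^n)`, `0 ≤ n ≤ N`, is a solution of the fully discrete mixed finite element scheme
with time step `τ` and initial datum `u0`: a `V_h × V_h`-valued process, adapted to
`ℱ_{t_n}` with `t_n = n τ`, that almost surely solves the equations of the scheme. -/
structure IsDiscreteSolution {d : ℕ} (D : Set (E d)) (X : E d → E d) (u0 : E d → ℝ) (δ ε : ℝ)
    (S : Geometry.SimplicialComplex ℝ (E d)) (N : ℕ) (τ : ℝ≥0)
    {Ω : Type*} [m : MeasurableSpace Ω] (P : Measure Ω) (ℱ : Filtration ℝ≥0 m)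
    (W : ℝ≥0 → Ω → ℝ) (u w : ℕ → Ω → E d → ℝ) : Prop where
  mem_u : ∀ n ≤ N, ∀ ω, u n ω ∈ Vh D S
  mem_w : ∀ n ≤ N, ∀ ω, w n ω ∈ Vh D S
  adapted_u : ∀ n ≤ N, ∀ x, Measurable[ℱ (n * τ)] (fun ω => u n ω x)
  adapted_w : ∀ n ≤ N, ∀ x, Measurable[ℱ (n * τ)] (fun ω => w n ω x)
  init_u : ∀ᵐ ω ∂P, ∀ v ∈ Vh D S, ip D (u 0 ω) v = ip D u0 v
  init_w : ∀ᵐ ω ∂P, ∀ v ∈ Vh D S,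
    ip D (w 0 ω) v = ε * gradIp D (u 0 ω) v + ε⁻¹ * ip D (fNl (u 0 ω)) v
  step_u : ∀ᵐ ω ∂P, ∀ n < N, ∀ η ∈ Vh D S,
    ip D (u (n + 1) ω) η = ip D (u n ω) η
      - τ * gradIp D (w (n + 1) ω) η
      - τ * (δ ^ 2 / 2) * ip D (gradDot X (u (n + 1) ω)) (gradDot X η)
      + δ * ip D (fun x => gradDot X (u n ω) x *
          (W ((n + 1 : ℕ) * τ) ω - W (n * τ) ω)) η
  step_w : ∀ᵐ ω ∂P, ∀ n < N, ∀ v ∈ Vh D S,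
    ip D (w (n + 1) ω) v = ε * gradIp D (u (n + 1) ω) v + ε⁻¹ * ip D (fNl (u (n + 1) ω)) v

end

end SCH

/-!
Testing the scheme for `ζ_n = u_h^n - ū_0` with `-Δ_h⁻¹ ζ_{n+1}` gives an energy balance for
`‖ζ_n‖²_{-1,h}`. Because `X` is divergence free and tangential to the boundary, `∇ · X` is
skew-symmetric on `V_h`; this moves the noise and the Stratonovich correction onto `Δ_h⁻¹ ζ`, where
they cost only `‖ζ‖² ≤ ‖ζ‖_{-1,h} ‖∇ζ‖`, a bound that also controls the non-monotone part `-ζ` of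
the cubic. Young's inequality absorbs `‖∇ζ‖²` into the dissipation, the mesh constraint makes the
implicit term small, the martingale increments vanish in expectation, and the discrete Gronwall
lemma concludes. The initial energy is bounded uniformly in the mesh by the Poincaré inequality of
`D`, applied to continuous, piecewise affine functions.

The domain need not be Lipschitz, so neither the Poincaré inequality nor the divergence theorem can
be quoted. The first follows by chaining the inequality on convex sets, the second by cutting off
near the boundary with the distance function: faces of codimension two are negligible, and near a
flat face `X` has a normal component of the order of the distance.
-/

namespace SCH

/-! ### Functions that are Lipschitz along segments -/

section SegmentLipschitz

variable {F : Type*} [NormedAddCommGroup F] [NormedSpace ℝ F] {A B : Set F} {f g : F → ℝ}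

/-- `f` is Lipschitz along the segments contained in `A`, with a common constant. On a non-convex
set this is weaker than being Lipschitz; it is the regularity shared by all piecewise affine
functions on a polyhedron. -/
def SegmentLipschitz (A : Set F) (f : F → ℝ) : Prop :=
  ∃ K : ℝ≥0, ∀ x y, segment ℝ x y ⊆ A → |f x - f y| ≤ K * ‖x - y‖

theorem SegmentLipschitz.mono (hf : SegmentLipschitz B f) (hAB : A ⊆ B) : SegmentLipschitz A f :=
  let ⟨K, hK⟩ := hf
  ⟨K, fun x y hxy => hK x y (hxy.trans hAB)⟩

theorem SegmentLipschitz.exists_lipschitzOnWith (hf : SegmentLipschitz B f) (hA : Convex ℝ A)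
    (hAB : A ⊆ B) : ∃ K, LipschitzOnWith K f A := by
  obtain ⟨K, hK⟩ := hf
  refine ⟨K, LipschitzOnWith.of_dist_le_mul fun x hx y hy => ?_⟩
  rw [Real.dist_eq, dist_eq_norm]
  exact hK x y ((hA.segment_subset hx hy).trans hAB)

theorem segmentLipschitz_of_lipschitzOnWith {K : ℝ≥0} (hf : LipschitzOnWith K f A) :
    SegmentLipschitz A f := by
  refine ⟨K, fun x y hxy => ?_⟩
  rw [← Real.dist_eq, ← dist_eq_norm]
  exact hf.dist_le_mul x (hxy (left_mem_segment ℝ x y)) y (hxy (right_mem_segment ℝ x y))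

theorem SegmentLipschitz.mul (hf : SegmentLipschitz A f) (hg : SegmentLipschitz A g) {M N : ℝ}
    (hM : ∀ x ∈ A, |f x| ≤ M) (hN : ∀ x ∈ A, |g x| ≤ N) :
    SegmentLipschitz A fun x => f x * g x := by
  obtain ⟨K, hK⟩ := hf
  obtain ⟨L, hL⟩ := hg
  refine ⟨(K * N + M * L).toNNReal, fun x y hxy => ?_⟩
  have hx := hxy (left_mem_segment ℝ x y)
  have hy := hxy (right_mem_segment ℝ x y)
  have hM0 : 0 ≤ M := (abs_nonneg _).trans (hM x hx)
  calc |f x * g x - f y * g y| = |(f x - f y) * g x + f y * (g x - g y)| := by ring_nf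
    _ ≤ |f x - f y| * |g x| + |f y| * |g x - g y| := by
        rw [← abs_mul, ← abs_mul]
        exact abs_add_le _ _
    _ ≤ K * ‖x - y‖ * N + M * (L * ‖x - y‖) := by
        gcongr
        exacts [hK x y hxy, hN x hx, hM y hy, hL x y hxy]
    _ = (K * N + M * L) * ‖x - y‖ := by ring
    _ ≤ (K * N + M * L).toNNReal * ‖x - y‖ := by
        gcongr
        exact Real.le_coe_toNNReal _

theorem SegmentLipschitz.norm_fderiv_le (hf : SegmentLipschitz A f) (hA : IsOpen A) :
    ∃ K : ℝ≥0, ∀ x ∈ A, ‖fderiv ℝ f x‖ ≤ K := by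
  obtain ⟨K, hK⟩ := hf
  refine ⟨K, fun x hx => norm_fderiv_le_of_lip' ℝ K.2 ?_⟩
  obtain ⟨r, hr, hball⟩ := Metric.isOpen_iff.1 hA x hx
  filter_upwards [Metric.ball_mem_nhds x hr] with y hy
  exact hK y x (((convex_ball x r).segment_subset hy (Metric.mem_ball_self hr)).trans hball)

/-- To the right of every `t`, points of one of the finitely many sets accumulate at `t`, and that
set is closed. -/
theorem sub_le_of_finite_closed_cover {ι : Type*} [Finite ι] {T : ι → Set ℝ} {φ : ℝ → ℝ} {L : ℝ}
    (hT : ∀ i, IsClosed (T i)) (hcover : Set.Icc 0 1 ⊆ ⋃ i, T i)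
    (hcont : ContinuousOn φ (Set.Icc 0 1))
    (hφ : ∀ i, ∀ s ∈ T i, ∀ t ∈ T i, s ≤ t → φ t - φ s ≤ L * (t - s)) :
    φ 1 - φ 0 ≤ L := by
  have hslope : ∀ t ∈ Set.Ico (0 : ℝ) 1, ∀ r, L < r → ∃ᶠ z in 𝓝[>] t, slope φ t z < r := by
    intro t ht r hr
    obtain ⟨i, hi⟩ : ∃ i, ∃ᶠ z in 𝓝[>] t, z ∈ T i := by
      by_contra! hnone
      have hev := eventually_all.2 hnone
      obtain ⟨z, hz, hzI⟩ := (hev.and (Ioo_mem_nhdsGT ht.2)).exists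
      obtain ⟨i, hzi⟩ := Set.mem_iUnion.1 (hcover ⟨ht.1.trans hzI.1.le, hzI.2.le⟩)
      exact hz i hzi
    have hti : t ∈ T i :=
      (hT i).closure_subset (mem_closure_iff_frequently.2 (hi.filter_mono nhdsWithin_le_nhds))
    refine (hi.and_eventually self_mem_nhdsWithin).mono fun z ⟨hzi, hz⟩ => lt_of_le_of_lt ?_ hr
    rw [slope_def_field, div_le_iff₀ (sub_pos.2 hz)]
    exact hφ i t hti z hzi hz.le
  have hB : ∀ t : ℝ, HasDerivAt (fun t => φ 0 + L * t) L t := fun t => by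
    simpa using ((hasDerivAt_id t).const_mul L).const_add (φ 0)
  have := image_le_of_liminf_slope_right_le_deriv_boundary hcont (by simp)
    (fun t _ => (hB t).continuousAt.continuousWithinAt) (fun t _ => (hB t).hasDerivWithinAt)
    hslope (Set.right_mem_Icc.2 zero_le_one)
  linarith

theorem segmentLipschitz_of_finite_closed_cover {ι : Type*} [Finite ι] {K : ι → Set F}
    (hK : ∀ i, IsClosed (K i)) (hA : A ⊆ ⋃ i, K i) (hf : ∀ i, ∃ C, LipschitzOnWith C f (K i)) :
    SegmentLipschitz A f := by
  choose C hC using hf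
  obtain ⟨M, hM⟩ := Set.finite_range C |>.bddAbove
  have hcont : ContinuousOn f A := ((locallyFinite_of_finite K).continuousOn_iUnion hK
    fun i => (hC i).continuousOn).mono hA
  have hle : ∀ x y, segment ℝ x y ⊆ A → f y - f x ≤ M * ‖x - y‖ := by
    intro x y hxy
    have hline : Continuous fun t : ℝ => (AffineMap.lineMap x y t : F) :=
      AffineMap.lineMap_continuous
    have hseg : Set.MapsTo (fun t : ℝ => (AffineMap.lineMap x y t : F)) (Set.Icc 0 1) A :=
      fun t ht => hxy (segment_eq_image_lineMap ℝ x y ▸ Set.mem_image_of_mem _ ht)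
    have := sub_le_of_finite_closed_cover (φ := fun t => f (AffineMap.lineMap x y t))
      (L := M * ‖x - y‖) (fun i => (hK i).preimage hline)
      (fun t ht => by simpa using hA (hseg ht)) (hcont.comp hline.continuousOn hseg) ?_
    · simpa using this
    intro i s hs t ht hst
    calc f (AffineMap.lineMap x y t) - f (AffineMap.lineMap x y s)
        ≤ C i * dist (AffineMap.lineMap x y t : F) (AffineMap.lineMap x y s) :=
          (le_abs_self _).trans ((hC i).dist_le_mul _ ht _ hs)
      _ = C i * ((t - s) * ‖x - y‖) := by
          rw [dist_lineMap_lineMap, Real.dist_eq, abs_of_nonneg (sub_nonneg.2 hst), dist_eq_norm]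
      _ ≤ M * ((t - s) * ‖x - y‖) := by
          have := sub_nonneg.2 hst
          gcongr
          exact hM ⟨i, rfl⟩
      _ = M * ‖x - y‖ * (t - s) := by ring
  refine ⟨M, fun x y hxy => abs_sub_le_iff.2 ⟨?_, hle x y hxy⟩⟩
  rw [norm_sub_rev]
  exact hle y x (segment_symm ℝ x y ▸ hxy)

end SegmentLipschitz

/-! ### The Poincaré inequality -/

section Poincare

variable {F : Type*} [NormedAddCommGroup F] [NormedSpace ℝ F] [FiniteDimensional ℝ F]
  [MeasurableSpace F] [BorelSpace F] {μ : Measure F} [μ.IsAddHaarMeasure]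
  {D A B : Set F} {f : F → ℝ}

theorem sq_lintegral_le_lintegral_sq {α : Type*} [MeasurableSpace α] {ν : Measure α}
    [IsProbabilityMeasure ν] {g : α → ENNReal} (hg : AEMeasurable g ν) :
    (∫⁻ a, g a ∂ν) ^ 2 ≤ ∫⁻ a, g a ^ 2 ∂ν := by
  have holder := ENNReal.lintegral_mul_le_Lp_mul_Lq ν Real.HolderConjugate.two_two hg
    (aemeasurable_const (b := (1 : ENNReal)))
  simp only [Pi.mul_apply, mul_one, lintegral_const, measure_univ, ENNReal.rpow_ofNat, one_pow,
    ENNReal.one_rpow] at holder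
  calc (∫⁻ a, g a ∂ν) ^ 2 ≤ ((∫⁻ a, g a ^ 2 ∂ν) ^ (1 / 2 : ℝ)) ^ 2 := by gcongr
    _ = ∫⁻ a, g a ^ 2 ∂ν := by
      rw [← ENNReal.rpow_natCast, ← ENNReal.rpow_mul]
      norm_num

theorem ae_enorm_add_sub_le {K : ℝ≥0} (hf : LipschitzWith K f) (h : F) :
    ∀ᵐ x ∂μ, ‖f (x + h) - f x‖ₑ ≤
      ‖h‖ₑ * ∫⁻ t in Set.Icc (0 : ℝ) 1, ‖fderiv ℝ f (x + t • h)‖ₑ := by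
  have hdiff : ∀ᵐ x ∂μ, ∀ᵐ t ∂volume.restrict (Set.Icc (0 : ℝ) 1),
      DifferentiableAt ℝ f (x + t • h) := by
    have hmeas : Measurable fun q : F × ℝ => q.1 + q.2 • h := by fun_prop
    rw [Measure.ae_ae_comm (p := fun x t => DifferentiableAt ℝ f (x + t • h))
      (hmeas (measurableSet_of_differentiableAt ℝ f))]
    exact ae_of_all _ fun t =>
      (measurePreserving_add_right μ (t • h)).quasiMeasurePreserving.ae hf.ae_differentiableAt
  filter_upwards [hdiff] with x hx
  have hline : ∀ t : ℝ, HasDerivAt (fun t : ℝ => x + t • h) h t := fun t => by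
    simpa using ((hasDerivAt_id t).smul_const h).const_add x
  have hlip : LipschitzWith (K * ‖h‖₊) fun t : ℝ => f (x + t • h) :=
    hf.comp (LipschitzWith.of_dist_le_mul fun s t => by
      rw [dist_add_left, dist_eq_norm, ← sub_smul, norm_smul, mul_comm, Real.dist_eq]
      rfl)
  have hftc := (hlip.lipschitzOnWith (s := Set.uIcc 0 1)).absolutelyContinuousOnInterval
    |>.integral_deriv_eq_sub
  simp only [one_smul, zero_smul, add_zero] at hftc
  rw [← hftc, intervalIntegral.integral_of_le zero_le_one, ← integral_Icc_eq_integral_Ioc,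
    ← lintegral_const_mul' _ _ enorm_ne_top]
  refine (enorm_integral_le_lintegral_enorm _).trans (lintegral_mono_ae ?_)
  filter_upwards [hx] with t ht
  have hderiv : deriv (fun t : ℝ => f (x + t • h)) t = fderiv ℝ f (x + t • h) h :=
    (ht.hasFDerivAt.comp_hasDerivAt t (hline t)).deriv
  rw [hderiv, mul_comm]
  exact ContinuousLinearMap.le_opENorm _ _

theorem setLIntegral_sq_add_sub_le {K : ℝ≥0} (hf : LipschitzWith K f) (hA : MeasurableSet A)
    (hconv : Convex ℝ A) (h : F) :
    ∫⁻ x in A ∩ (· + h) ⁻¹' A, ‖f (x + h) - f x‖ₑ ^ 2 ∂μ ≤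
      ‖h‖ₑ ^ 2 * ∫⁻ x in A, ‖fderiv ℝ f x‖ₑ ^ 2 ∂μ := by
  have hprob : IsProbabilityMeasure (volume.restrict (Set.Icc (0 : ℝ) 1)) := ⟨by simp⟩
  have hfderiv : Measurable fun x => ‖fderiv ℝ f x‖ₑ := (measurable_fderiv ℝ f).enorm
  let G : F → ENNReal := A.indicator fun x => ‖fderiv ℝ f x‖ₑ ^ 2
  have hG : Measurable G := (hfderiv.pow_const 2).indicator hA
  have hB : MeasurableSet (A ∩ (· + h) ⁻¹' A) := hA.inter (measurable_add_const h hA)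
  have hpoint : ∀ᵐ x ∂μ, x ∈ A ∩ (· + h) ⁻¹' A → ‖f (x + h) - f x‖ₑ ^ 2 ≤
      ‖h‖ₑ ^ 2 * ∫⁻ t in Set.Icc (0 : ℝ) 1, G (x + t • h) := by
    filter_upwards [ae_enorm_add_sub_le (μ := μ) hf h] with x hx ⟨hxA, hxhA⟩
    have hmem : ∀ t ∈ Set.Icc (0 : ℝ) 1, x + t • h ∈ A := fun t ht =>
      hconv.add_smul_mem hxA hxhA ht
    calc ‖f (x + h) - f x‖ₑ ^ 2
        ≤ (‖h‖ₑ * ∫⁻ t in Set.Icc (0 : ℝ) 1, ‖fderiv ℝ f (x + t • h)‖ₑ) ^ 2 := by gcongr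
      _ = ‖h‖ₑ ^ 2 * (∫⁻ t in Set.Icc (0 : ℝ) 1, ‖fderiv ℝ f (x + t • h)‖ₑ) ^ 2 := mul_pow _ _ 2
      _ ≤ ‖h‖ₑ ^ 2 * ∫⁻ t in Set.Icc (0 : ℝ) 1, ‖fderiv ℝ f (x + t • h)‖ₑ ^ 2 := by
          gcongr
          exact sq_lintegral_le_lintegral_sq (hfderiv.comp (by fun_prop)).aemeasurable
      _ = ‖h‖ₑ ^ 2 * ∫⁻ t in Set.Icc (0 : ℝ) 1, G (x + t • h) := by
          congr 1
          exact setLIntegral_congr_fun measurableSet_Icc fun t ht =>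
            (Set.indicator_of_mem (hmem t ht) fun x => ‖fderiv ℝ f x‖ₑ ^ 2).symm
  have hGmeas : Measurable fun q : F × ℝ => G (q.1 + q.2 • h) := hG.comp (by fun_prop)
  calc ∫⁻ x in A ∩ (· + h) ⁻¹' A, ‖f (x + h) - f x‖ₑ ^ 2 ∂μ
      ≤ ∫⁻ x in A ∩ (· + h) ⁻¹' A, ‖h‖ₑ ^ 2 * (∫⁻ t in Set.Icc (0 : ℝ) 1, G (x + t • h)) ∂μ :=
        setLIntegral_mono_ae' hB hpoint
    _ ≤ ∫⁻ x, ‖h‖ₑ ^ 2 * (∫⁻ t in Set.Icc (0 : ℝ) 1, G (x + t • h)) ∂μ :=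
        setLIntegral_le_lintegral _ _
    _ = ‖h‖ₑ ^ 2 * ∫⁻ t in Set.Icc (0 : ℝ) 1, (∫⁻ x, G (x + t • h) ∂μ) := by
        rw [lintegral_const_mul' _ _ (by finiteness), lintegral_lintegral_swap
          (f := fun x t => G (x + t • h)) hGmeas.aemeasurable]
    _ = ‖h‖ₑ ^ 2 * ∫⁻ x in A, ‖fderiv ℝ f x‖ₑ ^ 2 ∂μ := by
        simp [lintegral_add_right_eq_self, G, lintegral_indicator hA]

theorem setLIntegral_setLIntegral_eq_lintegral_translate (hA : MeasurableSet A)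
    {k : F → F → ENNReal} (hk : Measurable (Function.uncurry k)) :
    ∫⁻ x in A, ∫⁻ y in A, k x y ∂μ ∂μ =
      ∫⁻ h, ∫⁻ x in A ∩ (· + h) ⁻¹' A, k x (x + h) ∂μ ∂μ := by
  have hset : MeasurableSet {q : F × F | q.1 ∈ A ∩ (· + q.2) ⁻¹' A} :=
    (measurable_fst hA).inter (measurable_fst.add measurable_snd hA)
  have hmeas : Measurable fun q : F × F =>
      (A ∩ (· + q.2) ⁻¹' A).indicator (fun x => k x (x + q.2)) q.1 :=
    Measurable.ite hset
      (hk.comp (measurable_fst.prodMk (measurable_fst.add measurable_snd))) measurable_const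
  have hinner (x : F) : A.indicator (fun x => ∫⁻ y in A, k x y ∂μ) x =
      ∫⁻ h, (A ∩ (· + h) ⁻¹' A).indicator (fun x => k x (x + h)) x ∂μ := by
    by_cases hx : x ∈ A
    · rw [Set.indicator_of_mem hx, ← lintegral_indicator hA, ← lintegral_add_left_eq_self _ x]
      refine lintegral_congr fun h => ?_
      by_cases hxh : x + h ∈ A <;> simp [Set.indicator, hx, hxh]
    · simp [Set.indicator, hx]
  rw [← lintegral_indicator hA, lintegral_congr hinner, lintegral_lintegral_swap hmeas.aemeasurable]
  exact lintegral_congr fun h => lintegral_indicator (hA.inter (measurable_add_const h hA)) _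

theorem setLIntegral_setLIntegral_sq_sub_le {K : ℝ≥0} (hf : LipschitzWith K f)
    (hA : MeasurableSet A) (hconv : Convex ℝ A) (hb : Bornology.IsBounded A) :
    ∫⁻ x in A, ∫⁻ y in A, ‖f y - f x‖ₑ ^ 2 ∂μ ∂μ ≤
      Metric.ediam A ^ 2 * μ (Metric.closedBall 0 (Metric.diam A)) *
        ∫⁻ x in A, ‖fderiv ℝ f x‖ₑ ^ 2 ∂μ := by
  set R := Metric.diam A
  set E := ∫⁻ x in A, ‖fderiv ℝ f x‖ₑ ^ 2 ∂μ
  have hcont := hf.continuous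
  have hslice (h : F) : ∫⁻ x in A ∩ (· + h) ⁻¹' A, ‖f (x + h) - f x‖ₑ ^ 2 ∂μ ≤
      (Metric.closedBall (0 : F) R).indicator (fun _ => Metric.ediam A ^ 2 * E) h := by
    obtain hempty | ⟨x, hxA, hxhA⟩ := (A ∩ (· + h) ⁻¹' A).eq_empty_or_nonempty
    · simp [hempty]
    have hh : ‖h‖ₑ ≤ Metric.ediam A := by
      simpa [edist_eq_enorm_sub] using
        Metric.edist_le_ediam_of_mem (show x + h ∈ A from hxhA) hxA
    have hhR : h ∈ Metric.closedBall (0 : F) R := by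
      simpa [dist_eq_norm] using Metric.dist_le_diam_of_mem hb (show x + h ∈ A from hxhA) hxA
    rw [Set.indicator_of_mem hhR]
    exact (setLIntegral_sq_add_sub_le hf hA hconv h).trans (by gcongr)
  calc ∫⁻ x in A, ∫⁻ y in A, ‖f y - f x‖ₑ ^ 2 ∂μ ∂μ
      = ∫⁻ h, ∫⁻ x in A ∩ (· + h) ⁻¹' A, ‖f (x + h) - f x‖ₑ ^ 2 ∂μ ∂μ :=
        setLIntegral_setLIntegral_eq_lintegral_translate hA
          (k := fun x y => ‖f y - f x‖ₑ ^ 2) (by fun_prop)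
    _ ≤ ∫⁻ h, (Metric.closedBall (0 : F) R).indicator (fun _ => Metric.ediam A ^ 2 * E) h ∂μ :=
        lintegral_mono hslice
    _ = Metric.ediam A ^ 2 * μ (Metric.closedBall 0 R) * E := by
        rw [lintegral_indicator_const Metric.isClosed_closedBall.measurableSet]
        ring

variable (μ D A) in
/-- The Poincaré inequality on `A`, with the energy taken over the whole domain `D`: up to a
constant, the functions that are Lipschitz along the segments of `D` are controlled on `A` by their
gradient. This form can be glued along overlapping sets. -/
def HasPoincare : Prop :=
  ∃ C : ℝ≥0, ∀ f : F → ℝ, SegmentLipschitz D f →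
    ∃ c : ℝ, ∫⁻ x in A, ‖f x - c‖ₑ ^ 2 ∂μ ≤ C * ∫⁻ x in D, ‖fderiv ℝ f x‖ₑ ^ 2 ∂μ

end Poincare

section Poincare

variable {F : Type*} [NormedAddCommGroup F] [NormedSpace ℝ F] [FiniteDimensional ℝ F]
  [MeasurableSpace F] [BorelSpace F] {μ : Measure F} [μ.IsAddHaarMeasure]
  {D A B : Set F} {f : F → ℝ}

theorem SegmentLipschitz.continuousOn {F : Type*} [NormedAddCommGroup F] [NormedSpace ℝ F]
    {A : Set F} {f : F → ℝ} (hf : SegmentLipschitz A f) (hA : IsOpen A) : ContinuousOn f A := by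
  intro x hx
  obtain ⟨r, hr, hball⟩ := Metric.isOpen_iff.1 hA x hx
  obtain ⟨K, hK⟩ := hf.exists_lipschitzOnWith (convex_ball x r) hball
  exact (hK.continuousOn.continuousAt (Metric.ball_mem_nhds x hr)).continuousWithinAt

omit [μ.IsAddHaarMeasure] [FiniteDimensional ℝ F] [BorelSpace F] in
theorem HasPoincare.mono (hB : HasPoincare μ D B) (hAB : A ≤ᵐ[μ] B) : HasPoincare μ D A := by
  obtain ⟨C, hC⟩ := hB
  refine ⟨C, fun f hf => ?_⟩
  obtain ⟨c, hc⟩ := hC f hf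
  exact ⟨c, (lintegral_mono' (Measure.restrict_mono_ae hAB) le_rfl).trans hc⟩

theorem hasPoincare_of_convex (hA : IsOpen A) (hconv : Convex ℝ A) (hb : Bornology.IsBounded A)
    (hAD : A ⊆ D) : HasPoincare μ D A := by
  obtain rfl | hne := A.eq_empty_or_nonempty
  · exact ⟨0, fun f _ => ⟨0, by simp⟩⟩
  have hμ0 : μ A ≠ 0 := (hA.measure_pos μ hne).ne'
  have hμA : μ A ≠ ⊤ := hb.measure_lt_top.ne
  set C := Metric.ediam A ^ 2 * μ (Metric.closedBall 0 (Metric.diam A))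
  have hC : C / μ A ≠ ⊤ := ENNReal.div_ne_top (ENNReal.mul_ne_top
    (ENNReal.pow_ne_top hb.ediam_ne_top) measure_closedBall_lt_top.ne) hμ0
  refine ⟨(C / μ A).toNNReal, fun f hf => ?_⟩
  rw [ENNReal.coe_toNNReal hC]
  obtain ⟨K, hK⟩ := hf.exists_lipschitzOnWith hconv hAD
  obtain ⟨g, hg, hfg⟩ := hK.extend_real
  have hcont := hg.continuous
  obtain ⟨x, -, hle⟩ := exists_le_setLAverage hμ0 hμA
    (f := fun x => ∫⁻ y in A, ‖g y - g x‖ₑ ^ 2 ∂μ)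
    (Measurable.lintegral_prod_right' (f := fun q : F × F => ‖g q.2 - g q.1‖ₑ ^ 2)
      (by fun_prop)).aemeasurable
  have hfderiv : Set.EqOn (fderiv ℝ g) (fderiv ℝ f) A := fun y hy =>
    (hfg.symm.eventuallyEq_of_mem (hA.mem_nhds hy)).fderiv_eq
  refine ⟨g x, ?_⟩
  calc ∫⁻ y in A, ‖f y - g x‖ₑ ^ 2 ∂μ = ∫⁻ y in A, ‖g y - g x‖ₑ ^ 2 ∂μ :=
        setLIntegral_congr_fun hA.measurableSet fun y hy => by rw [hfg hy]
    _ ≤ (∫⁻ x in A, ∫⁻ y in A, ‖g y - g x‖ₑ ^ 2 ∂μ ∂μ) / μ A := by rwa [← setLAverage_eq]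
    _ ≤ (C * ∫⁻ y in A, ‖fderiv ℝ g y‖ₑ ^ 2 ∂μ) / μ A := by
        gcongr
        exact setLIntegral_setLIntegral_sq_sub_le hg hA.measurableSet hconv hb
    _ = C / μ A * ∫⁻ y in A, ‖fderiv ℝ f y‖ₑ ^ 2 ∂μ := by
        rw [setLIntegral_congr_fun hA.measurableSet fun y hy => by rw [hfderiv hy],
          ENNReal.mul_div_right_comm]
    _ ≤ C / μ A * ∫⁻ y in D, ‖fderiv ℝ f y‖ₑ ^ 2 ∂μ := by
        gcongr

theorem enorm_add_sq_le {G : Type*} [SeminormedAddGroup G] (a b : G) :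
    ‖a + b‖ₑ ^ 2 ≤ 2 * ‖a‖ₑ ^ 2 + 2 * ‖b‖ₑ ^ 2 := by
  have hsq : ‖a + b‖₊ ^ 2 ≤ 2 * ‖a‖₊ ^ 2 + 2 * ‖b‖₊ ^ 2 := calc
    ‖a + b‖₊ ^ 2 ≤ (‖a‖₊ + ‖b‖₊) ^ 2 := by gcongr; exact nnnorm_add_le a b
    _ ≤ 2 * (‖a‖₊ ^ 2 + ‖b‖₊ ^ 2) := add_sq_le
    _ = 2 * ‖a‖₊ ^ 2 + 2 * ‖b‖₊ ^ 2 := mul_add _ _ _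
  simp only [enorm_eq_nnnorm]
  exact_mod_cast hsq

theorem enorm_sub_sq_mul_measure_le {α : Type*} [MeasurableSpace α] {ν : Measure α} {f : α → ℝ}
    (hf : AEMeasurable f ν) (c c' : ℝ) :
    ‖c' - c‖ₑ ^ 2 * ν Set.univ ≤ 2 * ∫⁻ x, ‖f x - c‖ₑ ^ 2 ∂ν + 2 * ∫⁻ x, ‖f x - c'‖ₑ ^ 2 ∂ν := by
  calc ‖c' - c‖ₑ ^ 2 * ν Set.univ = ∫⁻ _, ‖c' - c‖ₑ ^ 2 ∂ν := by simp
    _ ≤ ∫⁻ x, (2 * ‖f x - c‖ₑ ^ 2 + 2 * ‖f x - c'‖ₑ ^ 2) ∂ν := lintegral_mono fun x => by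
        have := enorm_add_sq_le (f x - c) (c' - f x)
        rwa [sub_add_sub_cancel', ← enorm_neg (c' - f x), neg_sub] at this
    _ = _ := by
        rw [lintegral_add_left' (((hf.sub_const c).enorm.pow_const 2).const_mul 2),
          lintegral_const_mul' _ _ (by finiteness), lintegral_const_mul' _ _ (by finiteness)]

theorem lintegral_enorm_sub_sq_le {α : Type*} [MeasurableSpace α] {ν : Measure α} {f : α → ℝ}
    (c c' : ℝ) :
    ∫⁻ x, ‖f x - c‖ₑ ^ 2 ∂ν ≤ 2 * ∫⁻ x, ‖f x - c'‖ₑ ^ 2 ∂ν + 2 * (‖c' - c‖ₑ ^ 2 * ν Set.univ) := by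
  calc ∫⁻ x, ‖f x - c‖ₑ ^ 2 ∂ν
      ≤ ∫⁻ x, (2 * ‖f x - c'‖ₑ ^ 2 + 2 * ‖c' - c‖ₑ ^ 2) ∂ν := lintegral_mono fun x => by
        simpa using enorm_add_sq_le (f x - c') (c' - c)
    _ = _ := by
        rw [lintegral_add_right _ measurable_const, lintegral_const_mul' _ _ (by finiteness),
          lintegral_const, mul_assoc]

omit [μ.IsAddHaarMeasure] [FiniteDimensional ℝ F] in
/-- On `A ∩ B` the function is close to the constants of both sets, so these are close to one
another. -/
theorem HasPoincare.union (hA : HasPoincare μ D A) (hB : HasPoincare μ D B)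
    (hD : IsOpen D) (hμD : μ D ≠ ⊤) (hAD : A ⊆ D) (hBD : B ⊆ D) (hAB : μ (A ∩ B) ≠ 0) :
    HasPoincare μ D (A ∪ B) := by
  obtain ⟨C, hC⟩ := hA
  obtain ⟨C', hC'⟩ := hB
  have hratio : μ B / μ (A ∩ B) ≠ ⊤ := ENNReal.div_ne_top (measure_ne_top_of_subset hBD hμD) hAB
  refine ⟨C + (2 * C' + 2 * ((μ B / μ (A ∩ B)).toNNReal * (2 * C + 2 * C'))), fun f hf => ?_⟩
  obtain ⟨c, hc⟩ := hC f hf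
  obtain ⟨c', hc'⟩ := hC' f hf
  set E := ∫⁻ x in D, ‖fderiv ℝ f x‖ₑ ^ 2 ∂μ
  have hconst : ‖c' - c‖ₑ ^ 2 * μ (A ∩ B) ≤ (2 * C + 2 * C') * E := by
    have hmeas : AEMeasurable f (μ.restrict (A ∩ B)) :=
      ((hf.continuousOn hD).aemeasurable hD.measurableSet).mono_measure
        (Measure.restrict_mono (Set.inter_subset_left.trans hAD) le_rfl)
    calc ‖c' - c‖ₑ ^ 2 * μ (A ∩ B)
        ≤ 2 * ∫⁻ x in A ∩ B, ‖f x - c‖ₑ ^ 2 ∂μ + 2 * ∫⁻ x in A ∩ B, ‖f x - c'‖ₑ ^ 2 ∂μ := by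
          simpa using enorm_sub_sq_mul_measure_le hmeas c c'
      _ ≤ 2 * ∫⁻ x in A, ‖f x - c‖ₑ ^ 2 ∂μ + 2 * ∫⁻ x in B, ‖f x - c'‖ₑ ^ 2 ∂μ := by
          gcongr
          exacts [Set.inter_subset_left, Set.inter_subset_right]
      _ ≤ 2 * (C * E) + 2 * (C' * E) := by gcongr
      _ = (2 * C + 2 * C') * E := by ring
  have honB : ∫⁻ x in B, ‖f x - c‖ₑ ^ 2 ∂μ ≤
      2 * (C' * E) + 2 * (μ B / μ (A ∩ B) * ((2 * C + 2 * C') * E)) := by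
    have hfin : μ (A ∩ B) ≠ ⊤ := measure_ne_top_of_subset (Set.inter_subset_left.trans hAD) hμD
    calc ∫⁻ x in B, ‖f x - c‖ₑ ^ 2 ∂μ
        ≤ 2 * ∫⁻ x in B, ‖f x - c'‖ₑ ^ 2 ∂μ + 2 * (‖c' - c‖ₑ ^ 2 * μ B) := by
          simpa using lintegral_enorm_sub_sq_le (ν := μ.restrict B) (f := f) c c'
      _ = 2 * ∫⁻ x in B, ‖f x - c'‖ₑ ^ 2 ∂μ +
            2 * (μ B / μ (A ∩ B) * (‖c' - c‖ₑ ^ 2 * μ (A ∩ B))) := by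
          rw [mul_left_comm (μ B / _), ENNReal.div_mul_cancel hAB hfin]
      _ ≤ _ := by gcongr
  refine ⟨c, (lintegral_union_le _ _ _).trans ((add_le_add hc honB).trans_eq ?_)⟩
  push_cast
  rw [ENNReal.coe_toNNReal hratio]
  ring

theorem exists_hasPoincare_of_isPreconnected (hDc : IsPreconnected D) (hD : IsOpen D)
    (hμD : μ D ≠ ⊤)
    {x y : F} (hx : x ∈ D) (hy : y ∈ D) :
    ∃ U ⊆ D, IsOpen U ∧ HasPoincare μ D U ∧ x ∈ U ∧ y ∈ U := by
  refine hDc.induction₂ (fun x y => ∃ U ⊆ D, IsOpen U ∧ HasPoincare μ D U ∧ x ∈ U ∧ y ∈ U)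
    ?_ ?_ ?_ hx hy
  · intro x hx
    obtain ⟨r, hr, hball⟩ := Metric.isOpen_iff.1 hD x hx
    filter_upwards [mem_nhdsWithin_of_mem_nhds (Metric.ball_mem_nhds x hr)] with y hy
    exact ⟨_, hball, Metric.isOpen_ball, hasPoincare_of_convex Metric.isOpen_ball (convex_ball x r)
      Metric.isBounded_ball hball, Metric.mem_ball_self hr, hy⟩
  · rintro x y z - - - ⟨U, hUD, hUo, hU, hxU, hyU⟩ ⟨V, hVD, hVo, hV, hyV, hzV⟩
    exact ⟨U ∪ V, Set.union_subset hUD hVD, hUo.union hVo, hU.union hV hD hμD hUD hVD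
      ((hUo.inter hVo).measure_pos μ ⟨y, hyU, hyV⟩).ne', Or.inl hxU, Or.inr hzV⟩
  · rintro x y - - ⟨U, hUD, hUo, hU, hxU, hyU⟩
    exact ⟨U, hUD, hUo, hU, hyU, hxU⟩

theorem HasPoincare.union_of_isPreconnected (hA : HasPoincare μ D A) (hB : HasPoincare μ D B)
    (hDc : IsPreconnected D) (hD : IsOpen D) (hμD : μ D ≠ ⊤) (hAo : IsOpen A) (hBo : IsOpen B)
    (hAD : A ⊆ D) (hBD : B ⊆ D) : HasPoincare μ D (A ∪ B) := by
  obtain rfl | ⟨a, ha⟩ := A.eq_empty_or_nonempty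
  · rwa [Set.empty_union]
  obtain rfl | ⟨b, hb⟩ := B.eq_empty_or_nonempty
  · rwa [Set.union_empty]
  obtain ⟨U, hUD, hUo, hU, haU, hbU⟩ :=
    exists_hasPoincare_of_isPreconnected (μ := μ) hDc hD hμD (hAD ha) (hBD hb)
  have hAU := hA.union hU hD hμD hAD hUD ((hAo.inter hUo).measure_pos μ ⟨a, ha, haU⟩).ne'
  have hAUB := hAU.union hB hD hμD (Set.union_subset hAD hUD) hBD
    (((hAo.union hUo).inter hBo).measure_pos μ ⟨b, Or.inr hbU, hb⟩).ne'
  exact hAUB.mono (Set.union_subset_union_left B Set.subset_union_left).eventuallyLE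

theorem hasPoincare_of_finite_convex_cover {ι : Type*} [Finite ι] {K : ι → Set F} (hD : IsOpen D)
    (hDc : IsPreconnected D) (hb : Bornology.IsBounded D) (hK : ∀ i, IsOpen (K i))
    (hconv : ∀ i, Convex ℝ (K i)) (hKD : ∀ i, K i ⊆ D) (hcover : D ≤ᵐ[μ] ⋃ i, K i) :
    HasPoincare μ D D := by
  have hfinite : ∀ s : Set ι, s.Finite → HasPoincare μ D (⋃ i ∈ s, K i) := by
    intro s hs
    induction s, hs using Set.Finite.induction_on with
    | empty => exact ⟨0, fun f _ => ⟨0, by simp⟩⟩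
    | insert _ _ ih =>
      rw [Set.biUnion_insert]
      exact (hasPoincare_of_convex (hK _) (hconv _) (hb.subset (hKD _)) (hKD _))
        |>.union_of_isPreconnected ih hDc hD hb.measure_lt_top.ne (hK _)
          (isOpen_biUnion fun i _ => hK i) (hKD _) (Set.iUnion₂_subset fun i _ => hKD i)
  refine (hfinite _ Set.finite_univ).mono ?_
  simpa using hcover

theorem integral_sq_le_integral_sub_const_sq {α : Type*} [MeasurableSpace α] {ν : Measure α}
    [IsFiniteMeasure ν] {f : α → ℝ} (hf : MemLp f 2 ν) (hmean : ∫ x, f x ∂ν = 0) (c : ℝ) :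
    ∫ x, f x ^ 2 ∂ν ≤ ∫ x, (f x - c) ^ 2 ∂ν := by
  have hf1 : Integrable (fun x => 2 * c * f x) ν := (hf.integrable one_le_two).const_mul _
  have hexpand : ∫ x, (f x - c) ^ 2 ∂ν = ∫ x, f x ^ 2 ∂ν + c ^ 2 * ν.real Set.univ := by
    calc ∫ x, (f x - c) ^ 2 ∂ν = ∫ x, (f x ^ 2 - 2 * c * f x + c ^ 2) ∂ν := by
          congr with x
          ring
      _ = (∫ x, f x ^ 2 ∂ν - 2 * c * ∫ x, f x ∂ν) + ∫ _, c ^ 2 ∂ν := by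
          rw [integral_add (f := fun x => f x ^ 2 - 2 * c * f x) (hf.integrable_sq.sub hf1)
            (integrable_const _), integral_sub hf.integrable_sq hf1, integral_const_mul]
      _ = ∫ x, f x ^ 2 ∂ν + c ^ 2 * ν.real Set.univ := by
          simp [hmean, mul_comm]
  rw [hexpand]
  exact le_add_of_nonneg_right (by positivity)

theorem ofReal_integral_norm_sq {α G : Type*} [MeasurableSpace α] {ν : Measure α}
    [NormedAddCommGroup G] {f : α → G} (hf : MemLp f 2 ν) :
    ENNReal.ofReal (∫ x, ‖f x‖ ^ 2 ∂ν) = ∫⁻ x, ‖f x‖ₑ ^ 2 ∂ν := by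
  rw [ofReal_integral_eq_lintegral_ofReal (hf.integrable_norm_pow two_ne_zero)
    (ae_of_all _ fun x => by positivity)]
  exact lintegral_congr fun x => by rw [ENNReal.ofReal_pow (norm_nonneg _), ofReal_norm]

omit [μ.IsAddHaarMeasure] in
theorem HasPoincare.exists_integral_sq_le (hP : HasPoincare μ D D) (hD : IsOpen D)
    (hμD : μ D ≠ ⊤) : ∃ C : ℝ, 0 ≤ C ∧ ∀ f : F → ℝ, SegmentLipschitz D f →
      MemLp f 2 (μ.restrict D) → ∫ x in D, f x ∂μ = 0 →
      ∫ x in D, f x ^ 2 ∂μ ≤ C * ∫ x in D, ‖fderiv ℝ f x‖ ^ 2 ∂μ := by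
  obtain ⟨C, hC⟩ := hP
  have hfin : IsFiniteMeasure (μ.restrict D) := ⟨by simpa using hμD.lt_top⟩
  refine ⟨C, C.2, fun f hf hf2 hmean => ?_⟩
  obtain ⟨c, hc⟩ := hC f hf
  obtain ⟨K, hK⟩ := hf.norm_fderiv_le hD
  refine (integral_sq_le_integral_sub_const_sq hf2 hmean c).trans ?_
  have hfderiv : MemLp (fderiv ℝ f) 2 (μ.restrict D) :=
    MemLp.of_bound (measurable_fderiv ℝ f).aestronglyMeasurable K
      (ae_restrict_of_forall_mem hD.measurableSet hK)
  have hsq : ∫ x in D, (f x - c) ^ 2 ∂μ = ∫ x in D, ‖f x - c‖ ^ 2 ∂μ := by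
    simp only [Real.norm_eq_abs, sq_abs]
  rw [hsq, ← ENNReal.ofReal_le_ofReal_iff (by positivity), ENNReal.ofReal_mul C.coe_nonneg,
    ofReal_integral_norm_sq hfderiv, ENNReal.ofReal_coe_nnreal]
  exact (ofReal_integral_norm_sq (hf2.sub (memLp_const c))).trans_le hc

end Poincare

/-! ### Piecewise affine functions on a triangulated domain -/

section Triangulation

variable {d : ℕ} {D : Set (E d)} {S : Geometry.SimplicialComplex ℝ (E d)} {K : Set (E d)}
  {v : E d → ℝ}

theorem IsTriangulation.finite_elements (hS : IsTriangulation D S) : (elements S).Finite := by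
  refine (hS.finite.image fun s : Finset (E d) => convexHull ℝ (s : Set (E d))).subset ?_
  rintro K ⟨s, hs, -, rfl⟩
  exact ⟨s, hs, rfl⟩

theorem isCompact_of_mem_elements (hK : K ∈ elements S) : IsCompact K := by
  obtain ⟨s, -, -, rfl⟩ := hK
  exact s.finite_toSet.isCompact_convexHull ℝ

theorem convex_of_mem_elements (hK : K ∈ elements S) : Convex ℝ K := by
  obtain ⟨s, -, -, rfl⟩ := hK
  exact convex_convexHull ℝ _

theorem IsTriangulation.closure_eq (hS : IsTriangulation D S) : closure D = ⋃₀ elements S := by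
  rw [← hS.space_eq]
  ext x
  rw [Geometry.SimplicialComplex.mem_space_iff, Set.mem_sUnion]
  constructor
  · rintro ⟨s, hs, hx⟩
    obtain ⟨t, ht, hst, hcard⟩ := hS.pure s hs
    exact ⟨_, ⟨t, ht, hcard, rfl⟩, convexHull_mono (Finset.coe_subset.2 hst) hx⟩
  · rintro ⟨K, ⟨s, hs, -, rfl⟩, hx⟩
    exact ⟨s, hs, hx⟩

theorem IsTriangulation.subset_closure (hS : IsTriangulation D S) (hK : K ∈ elements S) :
    K ⊆ closure D := by
  rw [hS.closure_eq]
  exact Set.subset_sUnion_of_mem hK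

theorem IsTriangulation.ae_mem_interior (hS : IsTriangulation D S) :
    ∀ᵐ x : E d, x ∈ closure D → ∃ K ∈ elements S, x ∈ interior K := by
  have hfrontier : ∀ᵐ x : E d, ∀ K ∈ elements S, x ∉ frontier K :=
    (ae_ball_iff hS.finite_elements.countable).2 fun K hK =>
      measure_eq_zero_iff_ae_notMem.1 ((convex_of_mem_elements hK).addHaar_frontier _)
  filter_upwards [hfrontier] with x hx hxD
  rw [hS.closure_eq] at hxD
  obtain ⟨K, hK, hxK⟩ := hxD
  by_contra! hint
  exact hx K hK ⟨_root_.subset_closure hxK, hint K hK⟩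

theorem IsTriangulation.segmentLipschitz (hS : IsTriangulation D S) (hv : v ∈ Vh D S) :
    SegmentLipschitz (closure D) v := by
  have := hS.finite_elements.to_subtype
  refine segmentLipschitz_of_finite_closed_cover (K := fun K : elements S => (K : Set (E d)))
    (fun K => (isCompact_of_mem_elements K.2).isClosed) ?_ fun K => ?_
  · rw [hS.closure_eq, Set.sUnion_eq_iUnion]
  · obtain ⟨p, hp⟩ := hv.2.2 K K.2
    obtain ⟨C, hC⟩ := p.lipschitzWith_of_finiteDimensional
    exact ⟨C, fun x hx y hy => by rw [hp hx, hp hy]; exact hC x y⟩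

theorem IsTriangulation.continuousOn (hS : IsTriangulation D S) (hv : v ∈ Vh D S) :
    ContinuousOn v (closure D) := by
  have := hS.finite_elements.to_subtype
  rw [hS.closure_eq, Set.sUnion_eq_iUnion]
  refine (locallyFinite_of_finite _).continuousOn_iUnion
    (fun K => (isCompact_of_mem_elements K.2).isClosed) fun K => ?_
  obtain ⟨p, hp⟩ := hv.2.2 K K.2
  exact p.continuous_of_finiteDimensional.continuousOn.congr hp

theorem IsTriangulation.exists_bound (hS : IsTriangulation D S) (hDb : Bornology.IsBounded D)
    (hv : v ∈ Vh D S) : ∃ M, ∀ x, |v x| ≤ M := by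
  obtain ⟨M, hM⟩ := hDb.isCompact_closure.exists_bound_of_continuousOn (hS.continuousOn hv)
  refine ⟨max M 0, fun x => ?_⟩
  by_cases hx : x ∈ closure D
  · exact (hM x hx).trans (le_max_left _ _)
  · simp [hv.2.1 x hx]

theorem IsTriangulation.measurable (hS : IsTriangulation D S) (hv : v ∈ Vh D S) :
    Measurable v := by
  classical
  have hzero : (closure D).indicator v = v :=
    Set.indicator_eq_self.2 fun x hx => by_contra fun hxD => hx (hv.2.1 x hxD)
  rw [← hzero, ← Set.piecewise_eq_indicator]
  exact (hS.continuousOn hv).measurable_piecewise continuousOn_const isClosed_closure.measurableSet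

theorem IsTriangulation.hasPoincare (hS : IsTriangulation D S) (hDo : IsOpen D)
    (hDc : IsPreconnected D) (hDb : Bornology.IsBounded D) (hDr : interior (closure D) = D) :
    HasPoincare volume D D := by
  have := hS.finite_elements.to_subtype
  refine hasPoincare_of_finite_convex_cover (K := fun K : elements S => interior (K : Set (E d)))
    hDo hDc hDb (fun K => isOpen_interior) (fun K => (convex_of_mem_elements K.2).interior)
    (fun K => (interior_mono (hS.subset_closure K.2)).trans hDr.subset) ?_
  filter_upwards [hS.ae_mem_interior] with x hx hxD
  obtain ⟨K, hK, hxK⟩ := hx (_root_.subset_closure hxD)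
  exact Set.mem_iUnion.2 ⟨⟨K, hK⟩, hxK⟩

theorem norm_gradient (f : E d → ℝ) (x : E d) : ‖gradient f x‖ = ‖fderiv ℝ f x‖ :=
  (InnerProductSpace.toDual ℝ (E d)).symm.norm_map _

theorem exists_poincare_Vh (hDo : IsOpen D) (hDc : IsPreconnected D) (hDb : Bornology.IsBounded D)
    (hDr : interior (closure D) = D) :
    ∃ C : ℝ, 0 ≤ C ∧ ∀ S : Geometry.SimplicialComplex ℝ (E d), IsTriangulation D S → ∀ v ∈ Vh D S,
      ∫ x in D, v x = 0 → ∫ x in D, v x ^ 2 ≤ C * gradNormSq D v := by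
  by_cases hex : ∃ S : Geometry.SimplicialComplex ℝ (E d), IsTriangulation D S
  · obtain ⟨S₀, hS₀⟩ := hex
    obtain ⟨C, hC0, hC⟩ := (hS₀.hasPoincare hDo hDc hDb hDr).exists_integral_sq_le hDo
      hDb.measure_lt_top.ne
    refine ⟨C, hC0, fun S hS v hv hmean => ?_⟩
    simp only [gradNormSq, norm_gradient]
    exact hC v ((hS.segmentLipschitz hv).mono subset_closure) hv.1.1 hmean
  · exact ⟨0, le_rfl, fun S hS => (hex ⟨S, hS⟩).elim⟩

end Triangulation

/-! ### Flat boundary points -/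

section HalfSpace

variable {d : ℕ} {D : Set (E d)} {x : E d}

theorem exists_isOutwardNormal_of_eventually_iff (hDr : interior (closure D) = D)
    {p : E d →ᵃ[ℝ] ℝ} (hp : p.linear ≠ 0) (hx : p x = 0)
    (hD : ∀ᶠ y in 𝓝 x, (y ∈ closure D ↔ 0 ≤ p y)) : ∃ ν, IsOutwardNormal D x ν := by
  have hopen : IsOpenMap p := AffineMap.isOpenMap_linear_iff.1
    (p.linear.isOpenMap_of_finiteDimensional (LinearMap.surjective hp))
  have hpos : interior {y | 0 ≤ p y} = {y | 0 < p y} :=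
    (hopen.preimage_interior_eq_interior_preimage p.continuous_of_finiteDimensional
      (Set.Ici 0)).symm.trans (by rw [interior_Ici]; rfl)
  set G := (InnerProductSpace.toDual ℝ (E d)).symm (LinearMap.toContinuousLinearMap p.linear)
  have hG (y : E d) : inner ℝ G (y - x) = p y := by
    simpa [G, hx] using p.linearMap_vsub y x
  have hG0 : 0 < ‖G‖ := by
    rw [norm_pos_iff, ne_eq, LinearIsometryEquiv.map_eq_zero_iff]
    simpa using hp
  refine ⟨-(‖G‖⁻¹ • G), ?_, ?_⟩
  · rw [norm_neg, norm_smul, norm_inv, norm_norm, inv_mul_cancel₀ hG0.ne']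
  · filter_upwards [hD.eventually_nhds] with y hy
    have hmem : y ∈ D ↔ 0 < p y := by
      have hiff : y ∈ interior (closure D) ↔ y ∈ interior {z | 0 ≤ p z} := by
        simp only [mem_interior_iff_mem_nhds]
        exact eventually_congr hy
      rwa [hDr, hpos] at hiff
    rw [hmem, inner_neg_left, real_inner_smul_left, hG, neg_lt_zero,
      mul_pos_iff_of_pos_left (inv_pos.2 hG0)]

end HalfSpace

section AffineBasis

variable {V : Type*} [NormedAddCommGroup V] [NormedSpace ℝ V] {s t : Finset V}
  {b : AffineBasis s ℝ V} {x : V}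

theorem mem_convexHull_iff_coord (hb : ∀ i, b i = i) :
    x ∈ convexHull ℝ (s : Set V) ↔ ∀ i, 0 ≤ b.coord i x := by
  have hrange : Set.range b = s := by
    rw [funext hb]
    exact Subtype.range_coe
  rw [← hrange, b.convexHull_eq_nonneg_coord, Set.mem_ofPred_eq]

theorem mem_interior_convexHull_iff_coord [FiniteDimensional ℝ V] (hb : ∀ i, b i = i) :
    x ∈ interior (convexHull ℝ (s : Set V)) ↔ ∀ i, 0 < b.coord i x := by
  have hrange : Set.range b = s := by
    rw [funext hb]
    exact Subtype.range_coe
  rw [← hrange, b.interior_convexHull, Set.mem_ofPred_eq]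

theorem mem_convexHull_of_coord_eq_zero (hb : ∀ i, b i = i) (hx : x ∈ convexHull ℝ (s : Set V))
    (h0 : ∀ i : s, (i : V) ∉ t → b.coord i x = 0) : x ∈ convexHull ℝ (t : Set V) := by
  have hx' := (mem_convexHull_iff_coord hb).1 hx
  rw [← b.linear_combination_coord_eq_self x, ← finsum_eq_sum_of_fintype]
  refine (convex_convexHull ℝ _).finsum_mem hx' ?_ fun i hi => ?_
  · rw [finsum_eq_sum_of_fintype, b.sum_coord_apply_eq_one x]
  · rw [hb]
    exact subset_convexHull ℝ _ (not_imp_comm.1 (h0 i) hi)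

theorem coord_eq_zero_of_mem_convexHull (hb : ∀ i, b i = i) (hts : t ⊆ s)
    (hx : x ∈ convexHull ℝ (t : Set V)) (i : s) (hi : (i : V) ∉ t) : b.coord i x = 0 := by
  refine convexHull_min (fun y hy => ?_) ((convex_singleton 0).affine_preimage (b.coord i)) hx
  have hne : i ≠ ⟨y, hts hy⟩ := by
    rintro rfl
    exact hi hy
  simpa [hb] using b.coord_apply_ne hne

theorem eventually_coord_pos [FiniteDimensional ℝ V] {i : s} (h : ∀ j ≠ i, 0 < b.coord j x) :
    ∀ᶠ y in 𝓝 x, ∀ j ≠ i, 0 < b.coord j y := by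
  simp only [eventually_all]
  exact fun j hj => (b.coord j).continuous_of_finiteDimensional.continuousAt.eventually
    (lt_mem_nhds (h j hj))

theorem eventually_mem_convexHull [FiniteDimensional ℝ V] (hb : ∀ i, b i = i) {i : s}
    (h : ∀ j ≠ i, 0 < b.coord j x) :
    ∀ᶠ y in 𝓝 x, 0 ≤ b.coord i y → y ∈ convexHull ℝ (s : Set V) := by
  filter_upwards [eventually_coord_pos h] with y hy hyi
  refine (mem_convexHull_iff_coord hb).2 fun j => ?_
  obtain rfl | hj := eq_or_ne j i
  exacts [hyi, (hy j hj).le]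

theorem affineMap_eq_sum_coord {ι : Type*} [Fintype ι] (b : AffineBasis ι ℝ V) (p : V →ᵃ[ℝ] ℝ)
    (y : V) : p y = ∑ i, b.coord i y * p (b i) := by
  conv_lhs => rw [← b.affineCombination_coord_eq_self y,
    Finset.map_affineCombination _ _ _ (b.sum_coord_apply_eq_one y),
    Finset.affineCombination_eq_linear_combination _ _ _ (b.sum_coord_apply_eq_one y)]
  simp only [Function.comp_apply, smul_eq_mul]

/-- Two simplices with a common facet: the barycentric coordinates of the opposite vertices, which
both vanish on the affine hull of the facet, are proportional. -/
theorem coord_eq_mul_coord [DecidableEq V] (hb : ∀ i, b i = i) {c : AffineBasis t ℝ V}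
    (hc : ∀ i, c i = i) {i : s} {j : t} (hij : s.erase i = t.erase j) (y : V) :
    c.coord j y = c.coord j i * b.coord i y := by
  rw [affineMap_eq_sum_coord b (c.coord j) y, Finset.sum_eq_single i, hb, mul_comm]
  · intro k _ hk
    have hk' : (k : V) ∈ t.erase j := hij ▸ Finset.mem_erase.2 ⟨Subtype.coe_ne_coe.2 hk, k.2⟩
    obtain ⟨hkj, hkt⟩ := Finset.mem_erase.1 hk'
    rw [hb, ← hc ⟨k, hkt⟩, c.coord_apply_ne, mul_zero]
    rintro rfl
    exact hkj rfl
  · simp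

end AffineBasis

section Flat

variable {d : ℕ} {D : Set (E d)} {S : Geometry.SimplicialComplex ℝ (E d)} {s t : Finset (E d)}
  {b : AffineBasis s ℝ (E d)} {c : AffineBasis t ℝ (E d)} {x : E d}

/-- The union of the faces of codimension at least two. -/
def codimTwoSkeleton (S : Geometry.SimplicialComplex ℝ (E d)) : Set (E d) :=
  ⋃ s ∈ {s ∈ S.faces | s.card + 1 ≤ d}, convexHull ℝ (s : Set (E d))

theorem exists_affineBasis (hs : s ∈ S.faces) (hsc : s.card = d + 1) :
    ∃ b : AffineBasis s ℝ (E d), ∀ i, b i = i := by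
  refine ⟨⟨(↑), S.indep hs, ?_⟩, fun _ => rfl⟩
  rw [(S.indep hs).affineSpan_eq_top_iff_card_eq_finrank_add_one]
  simp [hsc]

theorem exists_unique_coord_eq_zero (hs : s ∈ S.faces) (hsc : s.card = d + 1)
    (hb : ∀ i, b i = i) (hx : x ∈ convexHull ℝ (s : Set (E d)))
    (hxi : x ∉ interior (convexHull ℝ (s : Set (E d)))) (hxS : x ∉ codimTwoSkeleton S) :
    ∃ i, b.coord i x = 0 ∧ ∀ j ≠ i, 0 < b.coord j x := by
  classical
  have hx' := (mem_convexHull_iff_coord hb).1 hx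
  rw [mem_interior_convexHull_iff_coord hb] at hxi
  push Not at hxi
  obtain ⟨i, hi⟩ := hxi
  have hi0 : b.coord i x = 0 := le_antisymm hi (hx' i)
  refine ⟨i, hi0, fun j hj => (hx' j).lt_of_ne' fun hj0 => hxS ?_⟩
  have hmem : x ∈ convexHull ℝ (((s.erase i).erase j : Finset (E d)) : Set (E d)) := by
    refine mem_convexHull_of_coord_eq_zero hb hx fun k hk => ?_
    by_cases hkj : k = j
    · rw [hkj, hj0]
    by_cases hki : k = i
    · rw [hki, hi0]
    · simp [Subtype.coe_ne_coe.2 hkj, Subtype.coe_ne_coe.2 hki] at hk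
  have hne : ((s.erase i).erase j).Nonempty := by
    rw [← Finset.coe_nonempty, ← convexHull_nonempty_iff (𝕜 := ℝ)]
    exact ⟨x, hmem⟩
  have hsub : (s.erase i).erase j ⊆ s := (Finset.erase_subset _ _).trans (Finset.erase_subset _ _)
  have hcard := Finset.card_pos.2 hne
  refine Set.mem_biUnion (x := (s.erase i).erase j) ⟨S.down_closed hs hsub hne, ?_⟩ hmem
  rw [Finset.card_erase_of_mem (Finset.mem_erase.2 ⟨Subtype.coe_ne_coe.2 hj, j.2⟩),
    Finset.card_erase_of_mem i.2, hsc] at hcard ⊢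
  omega

theorem inter_eq_erase [DecidableEq (E d)] (hs : s ∈ S.faces) (ht : t ∈ S.faces)
    (hcard : s.card = t.card) (hst : s ≠ t) (hb : ∀ i, b i = i)
    (hxs : x ∈ convexHull ℝ (s : Set (E d))) (hxt : x ∈ convexHull ℝ (t : Set (E d))) {i : s}
    (hi : ∀ j ≠ i, 0 < b.coord j x) : s ∩ t = s.erase i := by
  have hmem : x ∈ convexHull ℝ ((s ∩ t : Finset (E d)) : Set (E d)) := by
    rw [Finset.coe_inter]
    exact S.inter_subset_convexHull hs ht ⟨hxs, hxt⟩
  have hsub : s.erase i ⊆ s ∩ t := by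
    intro y hy
    obtain ⟨hyi, hys⟩ := Finset.mem_erase.1 hy
    by_contra hyt
    exact (hi ⟨y, hys⟩ fun h => hyi (congrArg Subtype.val h)).ne'
      (coord_eq_zero_of_mem_convexHull hb Finset.inter_subset_left hmem ⟨y, hys⟩ hyt)
  refine (Finset.eq_of_subset_of_card_le hsub ?_).symm
  rw [Finset.card_erase_of_mem i.2]
  by_contra! hlt
  have hs' : s ∩ t = s := Finset.eq_of_subset_of_card_le Finset.inter_subset_left (by omega)
  have ht' : s ∩ t = t := Finset.eq_of_subset_of_card_le Finset.inter_subset_right (by omega)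
  exact hst (hs'.symm.trans ht')

/-- If two elements lay on opposite sides of a common facet, then their union would be a
neighbourhood of `x`. -/
theorem IsTriangulation.coord_nonneg_of_mem_convexHull (hS : IsTriangulation D S)
    (hxD : x ∉ interior (closure D)) (hxS : x ∉ codimTwoSkeleton S) (hs : s ∈ S.faces)
    (hsc : s.card = d + 1) (hb : ∀ i, b i = i) {i : s} (hi : ∀ j ≠ i, 0 < b.coord j x)
    (hxs : x ∈ convexHull ℝ (s : Set (E d))) (ht : t ∈ S.faces) (htc : t.card = d + 1)
    (hxt : x ∈ convexHull ℝ (t : Set (E d))) {y : E d} (hy : y ∈ convexHull ℝ (t : Set (E d))) :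
    0 ≤ b.coord i y := by
  classical
  obtain rfl | hst := eq_or_ne s t
  · exact (mem_convexHull_iff_coord hb).1 hy i
  have hts : convexHull ℝ (t : Set (E d)) ⊆ closure D := hS.subset_closure ⟨t, ht, htc, rfl⟩
  obtain ⟨c, hc⟩ := exists_affineBasis ht htc
  obtain ⟨j, -, hj⟩ := exists_unique_coord_eq_zero ht htc hc hxt
    (fun h => hxD (interior_mono hts h)) hxS
  have hfacet : s.erase i = t.erase j := by
    rw [← inter_eq_erase hs ht (hsc.trans htc.symm) hst hb hxs hxt hi, Finset.inter_comm,
      inter_eq_erase ht hs (htc.trans hsc.symm) hst.symm hc hxt hxs hj]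
  have hcoord := coord_eq_mul_coord hb hc hfacet
  have hne : c.coord j i ≠ 0 := fun h0 => by
    simpa [h0, hc] using (hcoord (c j)).symm.trans (c.coord_apply_eq j)
  obtain hneg | hpos := hne.lt_or_gt
  · refine absurd (mem_interior_iff_mem_nhds.2 ?_) hxD
    filter_upwards [eventually_mem_convexHull hb hi, eventually_mem_convexHull hc hj]
      with z hzs hzt
    obtain hz | hz := le_total 0 (b.coord i z)
    · exact hS.subset_closure ⟨s, hs, hsc, rfl⟩ (hzs hz)
    · exact hts (hzt (hcoord z ▸ mul_nonneg_of_nonpos_of_nonpos hneg.le hz))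
  · exact nonneg_of_mul_nonneg_right (hcoord y ▸ (mem_convexHull_iff_coord hc).1 hy j) hpos

theorem IsTriangulation.exists_isOutwardNormal (hS : IsTriangulation D S) (hDo : IsOpen D)
    (hDr : interior (closure D) = D) (hx : x ∈ frontier D) (hxS : x ∉ codimTwoSkeleton S) :
    ∃ ν, IsOutwardNormal D x ν := by
  have hxD : x ∉ interior (closure D) := by
    rw [hDo.frontier_eq] at hx
    exact hDr.symm ▸ hx.2
  obtain ⟨K, hK, hxs⟩ : ∃ K ∈ elements S, x ∈ K := by
    rw [← Set.mem_sUnion, ← hS.closure_eq]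
    exact frontier_subset_closure hx
  have hKD := hS.subset_closure hK
  obtain ⟨s, hs, hsc, rfl⟩ := hK
  obtain ⟨b, hb⟩ := exists_affineBasis hs hsc
  obtain ⟨i, hi0, hi⟩ := exists_unique_coord_eq_zero hs hsc hb hxs
    (fun h => hxD (interior_mono hKD h)) hxS
  have hlinear : (b.coord i).linear ≠ 0 := fun h0 => by
    have hsub := (b.coord i).linearMap_vsub (b i) x
    rw [h0, b.coord_apply_eq, hi0] at hsub
    simp at hsub
  refine exists_isOutwardNormal_of_eventually_iff hDr hlinear hi0 ?_
  have hothers : ∀ᶠ y in 𝓝 x, ∀ L ∈ elements S, y ∈ L → 0 ≤ b.coord i y := by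
    refine (eventually_all_finite hS.finite_elements).2 fun L hL => ?_
    by_cases hxL : x ∈ L
    · obtain ⟨t, ht, htc, rfl⟩ := hL
      exact Eventually.of_forall fun y hy =>
        hS.coord_nonneg_of_mem_convexHull hxD hxS hs hsc hb hi hxs ht htc hxL hy
    · filter_upwards [(isCompact_of_mem_elements hL).isClosed.isOpen_compl.mem_nhds hxL]
        with y hy hyL using absurd hyL hy
  filter_upwards [eventually_mem_convexHull hb hi, hothers] with y hys hyL
  refine ⟨fun hy => ?_, fun h => hKD (hys h)⟩
  obtain ⟨L, hL, hy⟩ := hS.closure_eq ▸ hy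
  exact hyL L hL hy

end Flat

/-! ### The distance to the complement -/

section Cutoff

variable {F : Type*} [PseudoMetricSpace F] {D : Set F} {x : F} {r : ℝ}

theorem infDist_compl_pos (hD : IsOpen D) (hne : Dᶜ.Nonempty) (hx : x ∈ D) :
    0 < Metric.infDist x Dᶜ :=
  (hD.isClosed_compl.notMem_iff_infDist_pos hne).1 (Set.notMem_compl_iff.2 hx)

/-- The cutoff function that vanishes off `D` and rises linearly in the distance to the complement
of `D` until it reaches the value one at distance `r`. -/
noncomputable def cutoff (D : Set F) (r : ℝ) (x : F) : ℝ := min 1 (r⁻¹ * Metric.infDist x Dᶜ)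

theorem lipschitzWith_cutoff (D : Set F) (hr : 0 ≤ r) :
    LipschitzWith (Real.toNNReal r⁻¹) (cutoff D r) := by
  refine LipschitzWith.const_min (LipschitzWith.of_dist_le_mul fun x y => ?_) 1
  rw [Real.coe_toNNReal _ (inv_nonneg.2 hr), Real.dist_eq, ← mul_sub, abs_mul,
    abs_of_nonneg (inv_nonneg.2 hr), ← Real.dist_eq]
  gcongr
  simpa using (Metric.lipschitz_infDist_pt Dᶜ).dist_le_mul x y

theorem abs_cutoff_le_one (hr : 0 ≤ r) (x : F) : |cutoff D r x| ≤ 1 := by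
  rw [cutoff, abs_of_nonneg
    (le_min zero_le_one (mul_nonneg (inv_nonneg.2 hr) Metric.infDist_nonneg))]
  exact min_le_left _ _

theorem cutoff_eq_zero (hx : x ∉ D) : cutoff D r x = 0 := by
  rw [cutoff, Metric.infDist_zero_of_mem hx, mul_zero, min_eq_right zero_le_one]

theorem cutoff_eq_one (hr : 0 < r) (h : r ≤ Metric.infDist x Dᶜ) : cutoff D r x = 1 :=
  min_eq_left ((one_le_inv_mul₀ hr).2 h)

end Cutoff

section Distance

variable {F : Type*} [NormedAddCommGroup F] [NormedSpace ℝ F] {D : Set F} {x p : F} {r : ℝ}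

theorem segment_nearest_subset (hD : IsOpen D) (hx : x ∈ D) (hp : p ∈ Dᶜ)
    (h : Metric.infDist x Dᶜ = dist x p) : segment ℝ x p ⊆ closure D := by
  have hpos := infDist_compl_pos hD ⟨p, hp⟩ hx
  calc segment ℝ x p ⊆ Metric.closedBall x (Metric.infDist x Dᶜ) :=
        (convex_closedBall x _).segment_subset (Metric.mem_closedBall_self hpos.le)
          (by rw [Metric.mem_closedBall, dist_comm, h])
    _ = closure (Metric.ball x (Metric.infDist x Dᶜ)) := (closure_ball x hpos.ne').symm
    _ ⊆ closure D :=
        closure_mono (Set.disjoint_compl_right_iff_subset.1 Metric.disjoint_ball_infDist)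

theorem SegmentLipschitz.exists_lipschitzWith [ProperSpace F] {f : F → ℝ}
    (hf : SegmentLipschitz (closure D) f) (hD : IsOpen D) (h0 : ∀ x ∉ D, f x = 0) :
    ∃ C, LipschitzWith C f := by
  obtain ⟨K, hK⟩ := hf
  have hdecay : ∀ x, ∀ z ∉ D, |f x| ≤ K * dist x z := by
    intro x z hz
    by_cases hx : x ∈ D
    · obtain ⟨p, hp, h⟩ := hD.isClosed_compl.exists_infDist_eq_dist ⟨z, hz⟩ x
      calc |f x| = |f x - f p| := by rw [h0 p hp, sub_zero]
        _ ≤ K * dist x p := dist_eq_norm x p ▸ hK x p (segment_nearest_subset hD hx hp h)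
        _ ≤ K * dist x z := by
            rw [← h]
            gcongr
            exact Metric.infDist_le_dist_of_mem hz
    · rw [h0 x hx, abs_zero]
      positivity
  refine ⟨2 * K, LipschitzWith.of_dist_le_mul fun x y => ?_⟩
  rw [Real.dist_eq, NNReal.coe_mul, NNReal.coe_ofNat]
  by_cases hseg : segment ℝ x y ⊆ D
  · have := hK x y (hseg.trans subset_closure)
    rw [← dist_eq_norm] at this
    linarith [mul_nonneg K.coe_nonneg (dist_nonneg (x := x) (y := y))]
  · obtain ⟨z, hz, hzD⟩ := Set.not_subset.1 hseg
    calc |f x - f y| ≤ |f x| + |f y| := abs_sub _ _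
      _ ≤ K * dist x z + K * dist y z := add_le_add (hdecay x z hzD) (hdecay y z hzD)
      _ = K * dist x y := by
          rw [dist_comm y z, ← mul_add, dist_add_dist_of_mem_segment hz]
      _ ≤ 2 * K * dist x y := by
          linarith [mul_nonneg K.coe_nonneg (dist_nonneg (x := x) (y := y))]

theorem exists_lipschitzOnWith_of_contDiff [ProperSpace F] {G : Type*} [NormedAddCommGroup G]
    [NormedSpace ℝ G] {f : F → G} (hf : ContDiff ℝ 1 f) {A : Set F} (hA : Bornology.IsBounded A) :
    ∃ C : ℝ≥0, LipschitzOnWith C f A := by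
  obtain ⟨R, hR⟩ := hA.subset_closedBall 0
  obtain ⟨C, hC⟩ := (isCompact_closedBall (0 : F) R).exists_bound_of_continuousOn
    (hf.continuous_fderiv one_ne_zero).continuousOn
  refine ⟨C.toNNReal, LipschitzOnWith.mono ?_ hR⟩
  exact (convex_closedBall 0 R).lipschitzOnWith_of_nnnorm_fderiv_le
    (fun x _ => hf.differentiable one_ne_zero x)
    fun x hx => by exact_mod_cast (hC x hx).trans (Real.le_coe_toNNReal C)

theorem abs_fderiv_infDist_le (A : Set F) (x w : F) :
    |fderiv ℝ (fun y => Metric.infDist y A) x w| ≤ ‖w‖ := by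
  refine ((fderiv ℝ (fun y => Metric.infDist y A) x).le_opNorm w).trans
    (mul_le_of_le_one_left (norm_nonneg w) ?_)
  exact_mod_cast norm_fderiv_le_of_lipschitz ℝ (Metric.lipschitz_infDist_pt A)

theorem fderiv_cutoff_of_le (hr : 0 < r) (h : r ≤ Metric.infDist x Dᶜ) :
    fderiv ℝ (cutoff D r) x = 0 :=
  IsLocalMax.fderiv_eq_zero <| Eventually.of_forall fun _ =>
    (min_le_left _ _).trans_eq (cutoff_eq_one hr h).symm

theorem fderiv_cutoff_of_lt (hr : 0 < r) (h : Metric.infDist x Dᶜ < r) :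
    fderiv ℝ (cutoff D r) x = r⁻¹ • fderiv ℝ (fun y => Metric.infDist y Dᶜ) x := by
  have hnear : cutoff D r =ᶠ[𝓝 x] fun y => r⁻¹ • Metric.infDist y Dᶜ := by
    filter_upwards [(Metric.continuous_infDist_pt Dᶜ).continuousAt.eventually (gt_mem_nhds h)]
      with y hy
    rw [cutoff, smul_eq_mul, min_eq_right ((inv_mul_le_one₀ hr).2 hy.le)]
  rw [hnear.fderiv_eq]
  exact congrFun (fderiv_const_smul_field (f := fun y => Metric.infDist y Dᶜ) r⁻¹) x

theorem abs_fderiv_cutoff_le (hr : 0 < r) (x w : F) : |fderiv ℝ (cutoff D r) x w| ≤ r⁻¹ * ‖w‖ := by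
  obtain h | h := le_or_gt r (Metric.infDist x Dᶜ)
  · rw [fderiv_cutoff_of_le hr h, zero_apply, abs_zero]
    positivity
  · rw [fderiv_cutoff_of_lt hr h, smul_apply, smul_eq_mul, abs_mul,
      abs_of_pos (inv_pos.2 hr)]
    gcongr
    exact abs_fderiv_infDist_le _ x w

end Distance

section Tangential

variable {d : ℕ} {D : Set (E d)} {x p w : E d} {r : ℝ}

theorem infDist_mul_fderiv_infDist {A : Set (E d)} (hp : p ∈ A) (h : Metric.infDist x A = dist x p)
    (hd : DifferentiableAt ℝ (fun y => Metric.infDist y A) x) :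
    Metric.infDist x A * fderiv ℝ (fun y => Metric.infDist y A) x w = inner ℝ (x - p) w := by
  have hmin : IsLocalMin (fun y => ‖y - p‖ ^ 2 - Metric.infDist y A ^ 2) x := by
    refine Eventually.of_forall fun y => ?_
    have hy := pow_le_pow_left₀ Metric.infDist_nonneg (Metric.infDist_le_dist_of_mem (x := y) hp) 2
    rw [dist_eq_norm] at h hy
    simpa [h] using hy
  have hsq : HasFDerivAt (fun y : E d => ‖y - p‖ ^ 2) (2 • innerSL ℝ (x - p)) x := by
    simpa using ((hasFDerivAt_id x).sub_const p).norm_sq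
  have hzero := congrArg (fun φ => φ w) (hmin.hasFDerivAt_eq_zero (hsq.sub (hd.hasFDerivAt.pow 2)))
  simp only [Nat.add_one_sub_one, pow_one, nsmul_eq_mul, Nat.cast_ofNat, sub_apply, smul_apply,
    innerSL_apply_apply, smul_eq_mul, zero_apply] at hzero
  linarith

/-- Moving from the nearest point along the flat boundary does not decrease the distance to `x`. -/
theorem inner_eq_zero_of_isOutwardNormal {ν : E d} (h : Metric.infDist x Dᶜ = dist x p)
    (hν : IsOutwardNormal D p ν) (hw : inner ℝ w ν = 0) : inner ℝ (x - p) w = 0 := by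
  have hline : HasDerivAt (fun s : ℝ => (x - p) - s • w) (-w) 0 := by
    simpa using ((hasDerivAt_id (0 : ℝ)).smul_const w).const_sub (x - p)
  have hmin : IsLocalMin (fun s : ℝ => ‖(x - p) - s • w‖ ^ 2) 0 := by
    have htend : Tendsto (fun s : ℝ => p + s • w) (𝓝 0) (𝓝 p) := by
      simpa using (show Continuous fun s : ℝ => p + s • w by fun_prop).tendsto 0
    filter_upwards [htend.eventually hν.2] with s hs
    have hsD : p + s • w ∈ Dᶜ := fun hmem => by
      simpa [real_inner_smul_right, real_inner_comm, hw] using hs.1 hmem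
    have := h ▸ Metric.infDist_le_dist_of_mem (x := x) hsD
    rw [dist_eq_norm, dist_eq_norm, ← sub_sub] at this
    simpa using pow_le_pow_left₀ (norm_nonneg _) this 2
  simpa using hmin.hasDerivAt_eq_zero hline.norm_sq

/-- By the triangle inequality for `X`, which is tangential at the nearest point, the derivative of
the distance along `X` is at most proportional to the distance. -/
theorem abs_fderiv_cutoff_le_of_isOutwardNormal {X : E d → E d} {L : ℝ≥0}
    (hL : LipschitzOnWith L X (closure D)) (hD : IsOpen D) (hXn : IsTangential D X) {ν : E d}
    (hx : x ∈ D) (hp : p ∈ Dᶜ) (h : Metric.infDist x Dᶜ = dist x p)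
    (hν : IsOutwardNormal D p ν) (hd : DifferentiableAt ℝ (fun y => Metric.infDist y Dᶜ) x)
    (hlt : Metric.infDist x Dᶜ < r) : |fderiv ℝ (cutoff D r) x (X x)| ≤ L := by
  have hr : 0 < r := Metric.infDist_nonneg.trans_lt hlt
  have hpos := infDist_compl_pos hD ⟨p, hp⟩ hx
  have hpD : p ∈ closure D := segment_nearest_subset hD hx hp h (right_mem_segment ℝ x p)
  have hdist : Metric.infDist x Dᶜ * |fderiv ℝ (fun y => Metric.infDist y Dᶜ) x (X x)| ≤
      Metric.infDist x Dᶜ * (L * Metric.infDist x Dᶜ) := by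
    calc Metric.infDist x Dᶜ * |fderiv ℝ (fun y => Metric.infDist y Dᶜ) x (X x)|
        = |inner ℝ (x - p) (X x - X p)| := by
          rw [inner_sub_right, inner_eq_zero_of_isOutwardNormal h hν (hXn p ν hν), sub_zero,
            ← infDist_mul_fderiv_infDist hp h hd, abs_mul, abs_of_pos hpos]
      _ ≤ ‖x - p‖ * ‖X x - X p‖ := abs_real_inner_le_norm _ _
      _ ≤ Metric.infDist x Dᶜ * (L * Metric.infDist x Dᶜ) := by
          rw [← dist_eq_norm, ← dist_eq_norm, h]
          gcongr
          exact hL.dist_le_mul x (subset_closure hx) p hpD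
  rw [fderiv_cutoff_of_lt hr hlt, smul_apply, smul_eq_mul, abs_mul,
    abs_of_pos (inv_pos.2 hr), inv_mul_le_iff₀ hr]
  calc _ ≤ L * Metric.infDist x Dᶜ := le_of_mul_le_mul_left hdist hpos
    _ ≤ r * L := by rw [mul_comm]; gcongr

end Tangential

/-! ### Neighbourhoods of sets of codimension two -/

section Codimension

open scoped Pointwise

variable {F : Type*} [NormedAddCommGroup F] [InnerProductSpace ℝ F] [MeasurableSpace F]
  [BorelSpace F] {μ : Measure F} {A : Set F}

/-- The translates of the thickening by multiples of `2 * r` in the direction of `u` are disjoint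
and stay in the thickening of the swept set. -/
theorem natCast_mul_measure_thickening_le [μ.IsAddLeftInvariant] {u : F} {c r : ℝ} (hr : 0 < r)
    {n : ℕ} (hn : 2 * r * n ≤ 1) (hu : ‖u‖ = 1) (hA : ∀ x ∈ A, inner ℝ u x = c) :
    n * μ (Metric.thickening r A) ≤ μ (Metric.thickening r (A + segment ℝ 0 u)) := by
  set T : ℕ → Set F := fun j => (fun y => -((2 * r * j) • u) + y) ⁻¹' Metric.thickening r A with hT
  have hslab (j : ℕ) (y : F) (hy : y ∈ T j) : |inner ℝ u y - 2 * r * j - c| < r := by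
    obtain ⟨z, hz, hyz⟩ := Metric.mem_thickening_iff.1 hy
    calc |inner ℝ u y - 2 * r * j - c| = |inner ℝ u (-((2 * r * j) • u) + y - z)| := by
          rw [inner_sub_right, inner_add_right, inner_neg_right, real_inner_smul_right,
            real_inner_self_eq_norm_sq, hu, hA z hz]
          ring_nf
      _ ≤ ‖u‖ * ‖-((2 * r * j) • u) + y - z‖ := abs_real_inner_le_norm _ _
      _ < r := by rwa [hu, one_mul, ← dist_eq_norm]
  have hdisj : (Finset.range n : Set ℕ).PairwiseDisjoint T := by
    intro i _ j _ hij
    refine Set.disjoint_left.2 fun y hyi hyj => hij ?_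
    have hi := abs_lt.1 (hslab i y hyi)
    have hj := abs_lt.1 (hslab j y hyj)
    have hlt : (i : ℝ) < j + 1 := lt_of_mul_lt_mul_left (by linarith) hr.le
    have hgt : (j : ℝ) < i + 1 := lt_of_mul_lt_mul_left (by linarith) hr.le
    have hlt' : i < j + 1 := by exact_mod_cast hlt
    have hgt' : j < i + 1 := by exact_mod_cast hgt
    omega
  have hmeas (j : ℕ) : MeasurableSet (T j) :=
    (Metric.isOpen_thickening.preimage (continuous_const_add _)).measurableSet
  calc n * μ (Metric.thickening r A) = ∑ j ∈ Finset.range n, μ (T j) := by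
        simp only [hT, measure_preimage_add, Finset.sum_const, Finset.card_range, nsmul_eq_mul]
    _ = μ (⋃ j ∈ Finset.range n, T j) := (measure_biUnion_finset hdisj fun j _ => hmeas j).symm
    _ ≤ μ (Metric.thickening r (A + segment ℝ 0 u)) := by
        refine measure_mono (Set.iUnion₂_subset fun j hj y hy => ?_)
        obtain ⟨z, hz, hyz⟩ := Metric.mem_thickening_iff.1 hy
        have hjn : (j : ℝ) ≤ n := by exact_mod_cast (Finset.mem_range.1 hj).le
        have hseg : (2 * r * j) • u ∈ segment ℝ 0 u := by
          rw [segment_eq_image]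
          exact ⟨2 * r * j, ⟨by positivity, (by gcongr : 2 * r * j ≤ 2 * r * n).trans hn⟩, by simp⟩
        refine Metric.mem_thickening_iff.2 ⟨_, Set.add_mem_add hz hseg, ?_⟩
        rwa [dist_eq_norm, add_comm z, sub_add_eq_sub_sub, sub_eq_neg_add y, ← dist_eq_norm]

theorem tendsto_inv_mul_measureReal_thickening_of_sweep [ProperSpace F] [μ.IsAddLeftInvariant]
    [IsFiniteMeasureOnCompacts μ] {u : F} {c : ℝ} (hu : ‖u‖ = 1) (hAc : IsCompact A)
    (hA : ∀ x ∈ A, inner ℝ u x = c) (hnull : μ (A + segment ℝ 0 u) = 0) :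
    Tendsto (fun r : ℝ => r⁻¹ * μ.real (Metric.thickening r A)) (𝓝[>] 0) (𝓝 0) := by
  have hK : IsCompact (A + segment ℝ 0 u) := hAc.add (by
    rw [segment_eq_image]
    exact isCompact_Icc.image (by fun_prop))
  have hlim : Tendsto (fun r : ℝ => 4 * μ.real (Metric.thickening r (A + segment ℝ 0 u)))
      (𝓝[>] 0) (𝓝 0) := by
    have hfin : ∃ R > 0, μ (Metric.thickening R (A + segment ℝ 0 u)) ≠ ⊤ :=
      ⟨1, one_pos, hK.isBounded.thickening.measure_lt_top.ne⟩
    have h := tendsto_measure_thickening_of_isClosed hfin hK.isClosed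
    rw [hnull] at h
    simpa [Measure.real] using ((ENNReal.tendsto_toReal ENNReal.zero_ne_top).comp h).const_mul 4
  refine squeeze_zero' ?_ ?_ hlim
  · filter_upwards [self_mem_nhdsWithin] with r (hr : 0 < r)
    positivity
  · filter_upwards [Ioc_mem_nhdsGT (by norm_num : (0 : ℝ) < 1 / 2)] with r ⟨hr, hr2⟩
    set n := ⌊(2 * r)⁻¹⌋₊
    have hn : 2 * r * n ≤ 1 := by
      rw [← le_inv_mul_iff₀ (by positivity), mul_one]
      exact Nat.floor_le (by positivity)
    have hn1 : (1 : ℝ) ≤ n := by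
      exact_mod_cast Nat.le_floor (by
        rw [Nat.cast_one]; exact (one_le_inv₀ (by positivity)).2 (by linarith))
    have hinv : r⁻¹ ≤ 4 * n := by
      have hlt : (2 * r)⁻¹ < n + 1 := Nat.lt_floor_add_one _
      rw [mul_inv] at hlt
      linarith
    calc r⁻¹ * μ.real (Metric.thickening r A) ≤ 4 * n * μ.real (Metric.thickening r A) := by
          gcongr
      _ = 4 * (n * μ (Metric.thickening r A)).toReal := by
          rw [ENNReal.toReal_mul, ENNReal.toReal_natCast, mul_assoc, Measure.real]
      _ ≤ 4 * μ.real (Metric.thickening r (A + segment ℝ 0 u)) := by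
          gcongr
          exact ENNReal.toReal_mono hK.isBounded.thickening.measure_lt_top.ne
            (natCast_mul_measure_thickening_le hr hn hu hA)

theorem tendsto_inv_mul_measureReal_thickening [FiniteDimensional ℝ F] [μ.IsAddHaarMeasure]
    (hAc : IsCompact A)
    (hA : Module.finrank ℝ (vectorSpan ℝ A) + 2 ≤ Module.finrank ℝ F) :
    Tendsto (fun r : ℝ => r⁻¹ * μ.real (Metric.thickening r A)) (𝓝[>] 0) (𝓝 0) := by
  obtain rfl | ⟨a, ha⟩ := A.eq_empty_or_nonempty
  · simp
  set V := vectorSpan ℝ A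
  have hV : Vᗮ ≠ ⊥ := by
    rw [ne_eq, Submodule.orthogonal_eq_bot_iff]
    intro h
    rw [h, finrank_top] at hA
    omega
  obtain ⟨v, hv, hv0⟩ := Submodule.exists_mem_ne_zero_of_ne_bot hV
  set u := (‖v‖⁻¹ : ℝ) • v
  have huV : u ∈ Vᗮ := Vᗮ.smul_mem _ hv
  have hconst (x : F) (hx : x ∈ A) : inner ℝ u x = inner ℝ u a := by
    rw [← sub_eq_zero, ← inner_sub_right]
    exact Submodule.inner_left_of_mem_orthogonal (vsub_mem_vectorSpan ℝ hx ha) huV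
  refine tendsto_inv_mul_measureReal_thickening_of_sweep (norm_smul_inv_norm hv0) hAc hconst ?_
  have hproper : AffineSubspace.mk' a (V ⊔ Submodule.span ℝ {u}) ≠ ⊤ := by
    intro h
    have hdir := congrArg AffineSubspace.direction h
    rw [AffineSubspace.direction_mk', AffineSubspace.direction_top] at hdir
    have hle := (Submodule.finrank_add_le_finrank_add_finrank V (Submodule.span ℝ {u})).trans
      (Nat.add_le_add_left (finrank_span_le_card ({u} : Set F)) _)
    rw [hdir, finrank_top, Set.toFinset_singleton, Finset.card_singleton] at hle
    omega
  refine measure_mono_null ?_ (Measure.addHaar_affineSubspace μ _ hproper)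
  rintro _ ⟨x, hx, y, hy, rfl⟩
  rw [SetLike.mem_coe, AffineSubspace.mem_mk', vsub_eq_sub, add_sub_right_comm]
  refine Submodule.add_mem_sup (vsub_mem_vectorSpan ℝ hx ha) ?_
  exact (convex_iff_segment_subset.1 (Submodule.span ℝ {u}).convex (zero_mem _)
    (Submodule.mem_span_singleton_self u)) hy

end Codimension

section Skeleton

variable {d : ℕ} {D : Set (E d)} {S : Geometry.SimplicialComplex ℝ (E d)}

theorem tendsto_inv_mul_volume_thickening_codimTwoSkeleton (hS : S.faces.Finite) :
    Tendsto (fun r : ℝ => r⁻¹ * volume.real (Metric.thickening r (codimTwoSkeleton S)))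
      (𝓝[>] 0) (𝓝 0) := by
  have hfin : {s ∈ S.faces | s.card + 1 ≤ d}.Finite := hS.subset fun s hs => hs.1
  have hface (s) (hs : s ∈ hfin.toFinset) : Tendsto (fun r : ℝ => r⁻¹ *
      volume.real (Metric.thickening r (convexHull ℝ (s : Set (E d))))) (𝓝[>] 0) (𝓝 0) := by
    obtain ⟨hsS, hsd⟩ := hfin.mem_toFinset.1 hs
    refine tendsto_inv_mul_measureReal_thickening (s.finite_toSet.isCompact_convexHull ℝ) ?_
    have hpos := (S.nonempty_of_mem_faces hsS).card_pos
    have hrank := (S.indep hsS).finrank_vectorSpan (n := s.card - 1)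
      (by rw [Fintype.card_coe]; omega)
    have hspan : vectorSpan ℝ (convexHull ℝ (s : Set (E d))) =
        vectorSpan ℝ (Set.range ((↑) : s → E d)) := by
      rw [← direction_affineSpan, affineSpan_convexHull, direction_affineSpan, Subtype.range_coe]
    rw [hspan, hrank, finrank_euclideanSpace_fin]
    omega
  refine squeeze_zero' ?_ ?_ (by simpa using tendsto_finsetSum hfin.toFinset hface)
  · filter_upwards [self_mem_nhdsWithin] with r (hr : 0 < r)
    positivity
  · filter_upwards [self_mem_nhdsWithin] with r (hr : 0 < r)
    rw [← Finset.mul_sum, codimTwoSkeleton, Metric.thickening_biUnion]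
    gcongr
    convert! measureReal_biUnion_finset_le hfin.toFinset _ using 4
    simp

theorem IsTriangulation.volume_frontier (hS : IsTriangulation D S) (hDo : IsOpen D)
    (hDr : interior (closure D) = D) : volume (frontier D) = 0 := by
  rw [hDo.frontier_eq]
  refine measure_mono_null ?_ (ae_iff.1 hS.ae_mem_interior)
  rintro x ⟨hx, hxD⟩ hmem
  obtain ⟨K, hK, hxK⟩ := hmem hx
  exact hxD (hDr ▸ interior_mono (hS.subset_closure hK) hxK)

end Skeleton

/-! ### The divergence theorem for tangential fields -/

section LineDerivative

variable {F : Type*} [NormedAddCommGroup F] [NormedSpace ℝ F] [FiniteDimensional ℝ F]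
  [MeasurableSpace F] [BorelSpace F] {μ : Measure F} [μ.IsAddHaarMeasure] {D : Set F} {f : F → ℝ}
  {C : ℝ≥0}

theorem SegmentLipschitz.ae_differentiableAt (hf : SegmentLipschitz D f) (hD : IsOpen D) :
    ∀ᵐ x ∂μ.restrict D, DifferentiableAt ℝ f x := by
  rw [ae_restrict_iff' hD.measurableSet, ae_iff]
  refine measure_null_of_locally_null _ fun x hx => ?_
  simp only [Set.mem_ofPred_eq, Classical.not_imp] at hx
  obtain ⟨r, hr, hball⟩ := Metric.isOpen_iff.1 hD x hx.1
  obtain ⟨K, hK⟩ := hf.exists_lipschitzOnWith (convex_ball x r) hball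
  refine ⟨_, inter_mem_nhdsWithin _ (Metric.ball_mem_nhds x hr), measure_mono_null ?_
    (ae_iff.1 (hK.ae_differentiableWithinAt_of_mem (μ := μ)))⟩
  rintro y ⟨hy, hyr⟩ hdiff
  exact hy fun _ => (hdiff hyr).differentiableAt (Metric.isOpen_ball.mem_nhds hyr)

theorem integral_lineDeriv_eq_zero (hf : LipschitzWith C f) (hc : HasCompactSupport f) (w : F) :
    ∫ x, lineDeriv ℝ f x w ∂μ = 0 := by
  have h := LipschitzWith.integral_lineDeriv_mul_eq (μ := μ)
    (LipschitzWith.const (1 : ℝ) : LipschitzWith 0 fun _ : F => (1 : ℝ)) hf hc (-w)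
  simp only [neg_neg, mul_one] at h
  rw [← h]
  simp [lineDeriv]

theorem setIntegral_lineDeriv_eq_zero (hD : Bornology.IsBounded D) (hfr : μ (frontier D) = 0)
    (hf : LipschitzWith C f) (h0 : ∀ x ∉ D, f x = 0) (w : F) :
    ∫ x in D, lineDeriv ℝ f x w ∂μ = 0 := by
  have hoff : ∀ x ∉ closure D, f x = 0 := fun x hx => h0 x fun h => hx (subset_closure h)
  rw [setIntegral_eq_integral_of_ae_compl_eq_zero,
    integral_lineDeriv_eq_zero hf (HasCompactSupport.intro hD.isCompact_closure hoff)]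
  filter_upwards [measure_eq_zero_iff_ae_notMem.1 hfr] with x hx hxD
  have hxc : x ∉ closure D := fun h => hx ⟨h, fun hi => hxD (interior_subset hi)⟩
  have hnear : f =ᶠ[𝓝 x] fun _ => 0 := by
    filter_upwards [isClosed_closure.isOpen_compl.mem_nhds hxc] with y hy using hoff y hy
  rw [hnear.lineDeriv_eq]
  simp [lineDeriv]

end LineDerivative

section Divergence

variable {d : ℕ} {D : Set (E d)} {X : E d → E d} {f : E d → ℝ} {x : E d}

theorem sum_lineDeriv_mul_coord (hf : DifferentiableAt ℝ f x) (hX : DifferentiableAt ℝ X x) :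
    ∑ i, lineDeriv ℝ (fun y => f y * X y i) x (EuclideanSpace.single i 1) =
      fderiv ℝ f x (X x) + f x * divergence X x := by
  have hterm (i : Fin d) : lineDeriv ℝ (fun y => f y * X y i) x (EuclideanSpace.single i 1) =
      fderiv ℝ f x (X x i • EuclideanSpace.single i 1) +
        f x * fderiv ℝ X x (EuclideanSpace.single i 1) i := by
    have hcoord : HasFDerivAt (fun y => X y i) ((EuclideanSpace.proj i).comp (fderiv ℝ X x)) x :=
      (EuclideanSpace.proj (𝕜 := ℝ) i).hasFDerivAt.comp x hX.hasFDerivAt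
    rw [((hf.hasFDerivAt.fun_mul hcoord).hasLineDerivAt _).lineDeriv]
    simp only [add_apply, smul_apply, smul_eq_mul, map_smul,
      ContinuousLinearMap.comp_apply, PiLp.proj_apply]
    ring
  have hsum : ∑ i, X x i • EuclideanSpace.single i (1 : ℝ) = X x := by
    ext j
    simp [Pi.single_apply]
  rw [Finset.sum_congr rfl fun i _ => hterm i, Finset.sum_add_distrib, ← Finset.mul_sum,
    ← map_sum, hsum, divergence]

theorem setIntegral_fderiv_add_mul_divergence (hDo : IsOpen D) (hDb : Bornology.IsBounded D)
    (hfr : volume (frontier D) = 0) (hX : ContDiff ℝ 1 X) (hf : SegmentLipschitz (closure D) f)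
    {A : ℝ} (hA : ∀ x ∈ closure D, |f x| ≤ A) (h0 : ∀ x ∉ D, f x = 0) :
    ∫ x in D, (fderiv ℝ f x (X x) + f x * divergence X x) = 0 := by
  have hlip (i : Fin d) : ∃ C, LipschitzWith C fun x => f x * X x i := by
    have hXi : ContDiff ℝ 1 fun x => X x i := (EuclideanSpace.proj (𝕜 := ℝ) i).contDiff.comp hX
    obtain ⟨C, hC⟩ := exists_lipschitzOnWith_of_contDiff hXi hDb.closure
    obtain ⟨M, hM⟩ := hDb.isCompact_closure.exists_bound_of_continuousOn hXi.continuous.continuousOn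
    exact (hf.mul (segmentLipschitz_of_lipschitzOnWith hC) hA hM).exists_lipschitzWith hDo
      fun x hx => by rw [h0 x hx, zero_mul]
  choose C hC using hlip
  calc ∫ x in D, (fderiv ℝ f x (X x) + f x * divergence X x)
      = ∫ x in D, ∑ i, lineDeriv ℝ (fun y => f y * X y i) x (EuclideanSpace.single i 1) := by
        refine integral_congr_ae ?_
        filter_upwards [(hf.mono subset_closure).ae_differentiableAt hDo] with x hx
        exact (sum_lineDeriv_mul_coord hx (hX.differentiable one_ne_zero x)).symm
    _ = ∑ i, ∫ x in D, lineDeriv ℝ (fun y => f y * X y i) x (EuclideanSpace.single i 1) :=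
        integral_finsetSum _ fun i _ => (((hC i).locallyIntegrable_lineDeriv (μ := volume)
          _).integrableOn_isCompact hDb.isCompact_closure).mono_set subset_closure
    _ = 0 := Finset.sum_eq_zero fun i _ =>
        setIntegral_lineDeriv_eq_zero hDb hfr (hC i) (fun x hx => by rw [h0 x hx, zero_mul]) _

theorem measurable_gradient (f : E d → ℝ) : Measurable (gradient f) :=
  (InnerProductSpace.toDual ℝ (E d)).symm.continuous.measurable.comp (measurable_fderiv ℝ f)

theorem inner_gradient_eq_fderiv (f : E d → ℝ) (x w : E d) :
    inner ℝ (gradient f x) w = fderiv ℝ f x w := by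
  rw [gradient, InnerProductSpace.toDual_symm_apply]

theorem measurable_fderiv_apply (f : E d → ℝ) (hX : Measurable X) :
    Measurable fun x => fderiv ℝ f x (X x) := by
  simp_rw [← inner_gradient_eq_fderiv]
  exact (measurable_gradient f).inner hX

end Divergence

section Tangential

variable {d : ℕ} {D Z : Set (E d)} {X : E d → E d} {f : E d → ℝ} {x : E d} {A B M r : ℝ} {L : ℝ≥0}

theorem abs_fderiv_cutoff_le_of_notMem_thickening (hDo : IsOpen D) (hne : Dᶜ.Nonempty)
    (hZ : ∀ x ∈ frontier D, x ∉ Z → ∃ ν, IsOutwardNormal D x ν)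
    (hL : LipschitzOnWith L X (closure D)) (hXn : IsTangential D X) (hx : x ∈ D) (hr : 0 < r)
    (hd : DifferentiableAt ℝ (fun y => Metric.infDist y Dᶜ) x)
    (hxZ : x ∉ Metric.thickening r Z) : |fderiv ℝ (cutoff D r) x (X x)| ≤ L := by
  obtain hle | hlt := le_or_gt r (Metric.infDist x Dᶜ)
  · rw [fderiv_cutoff_of_le hr hle, zero_apply, abs_zero]
    exact L.coe_nonneg
  obtain ⟨p, hp, hxp⟩ := hDo.isClosed_compl.exists_infDist_eq_dist hne x
  have hpD : p ∈ frontier D := hDo.frontier_eq ▸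
    ⟨segment_nearest_subset hDo hx hp hxp (right_mem_segment ℝ x p), hp⟩
  have hpZ : p ∉ Z := fun h => hxZ (Metric.mem_thickening_iff.2 ⟨p, h, hxp ▸ hlt⟩)
  obtain ⟨ν, hν⟩ := hZ p hpD hpZ
  exact abs_fderiv_cutoff_le_of_isOutwardNormal hL hDo hXn hx hp hxp hν hd hlt

theorem tendsto_setIntegral_indicator_thickening (hZb : Bornology.IsBounded Z)
    (hZr : Tendsto (fun r : ℝ => r⁻¹ * volume.real (Metric.thickening r Z)) (𝓝[>] 0) (𝓝 0))
    (hA : ∀ x ∈ D, |f x| ≤ A) (hM : ∀ x ∈ D, ‖X x‖ ≤ M) :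
    Tendsto (fun r => ∫ x in D, (Metric.thickening r Z).indicator
      (fun x => f x * fderiv ℝ (cutoff D r) x (X x)) x) (𝓝[>] 0) (𝓝 0) := by
  refine squeeze_zero_norm' ?_ (by simpa using hZr.const_mul (|A| * |M|))
  filter_upwards [self_mem_nhdsWithin] with r (hr : 0 < r)
  have hZm : MeasurableSet (Metric.thickening r Z) := Metric.isOpen_thickening.measurableSet
  have hfin := (hZb.thickening (δ := r)).measure_lt_top (μ := volume)
  rw [setIntegral_indicator hZm]
  calc ‖∫ x in D ∩ Metric.thickening r Z, f x * fderiv ℝ (cutoff D r) x (X x)‖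
      ≤ |A| * (r⁻¹ * |M|) * volume.real (D ∩ Metric.thickening r Z) := by
        refine norm_setIntegral_le_of_norm_le_const
          ((measure_mono Set.inter_subset_right).trans_lt hfin) fun x hx => ?_
        rw [norm_mul]
        refine mul_le_mul ((hA x hx.1).trans (le_abs_self A)) ?_ (norm_nonneg _) (abs_nonneg A)
        refine (abs_fderiv_cutoff_le hr x (X x)).trans ?_
        gcongr
        exact (hM x hx.1).trans (le_abs_self M)
    _ ≤ |A| * (r⁻¹ * |M|) * volume.real (Metric.thickening r Z) := by
        exact mul_le_mul_of_nonneg_left (measureReal_mono Set.inter_subset_right hfin.ne)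
          (by positivity)
    _ = |A| * |M| * (r⁻¹ * volume.real (Metric.thickening r Z)) := by ring

theorem norm_fderiv_cutoff_mul_sub_indicator_le (hr : 0 ≤ r) (hf : DifferentiableAt ℝ f x)
    (hc : DifferentiableAt ℝ (cutoff D r) x) (hA : |f x| ≤ A) (hB : ‖fderiv ℝ f x‖ ≤ B)
    (hM : ‖X x‖ ≤ M) (hL : x ∉ Metric.thickening r Z → |fderiv ℝ (cutoff D r) x (X x)| ≤ L) :
    ‖fderiv ℝ (fun y => cutoff D r y * f y) x (X x) - (Metric.thickening r Z).indicator
      (fun x => f x * fderiv ℝ (cutoff D r) x (X x)) x‖ ≤ B * M + A * L := by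
  have hprod : fderiv ℝ (fun y => cutoff D r y * f y) x (X x) =
      cutoff D r x * fderiv ℝ f x (X x) + f x * fderiv ℝ (cutoff D r) x (X x) := by
    rw [fderiv_fun_mul hc hf]
    rfl
  have hA0 : 0 ≤ A := (abs_nonneg _).trans hA
  have hderiv : |cutoff D r x * fderiv ℝ f x (X x)| ≤ B * M := by
    rw [abs_mul]
    refine (mul_le_of_le_one_left (abs_nonneg _) (abs_cutoff_le_one hr x)).trans ?_
    exact (fderiv ℝ f x).le_of_opNorm_le_of_le hB hM
  rw [hprod, Real.norm_eq_abs]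
  by_cases hx : x ∈ Metric.thickening r Z
  · rw [Set.indicator_of_mem hx, add_sub_cancel_right]
    exact hderiv.trans (le_add_of_nonneg_right (by positivity))
  · rw [Set.indicator_of_notMem hx, sub_zero]
    refine (abs_add_le _ _).trans (add_le_add hderiv ?_)
    rw [abs_mul]
    exact mul_le_mul hA (hL hx) (abs_nonneg _) hA0

theorem eventually_fderiv_cutoff_mul_sub_indicator_eq (hDo : IsOpen D) (hne : Dᶜ.Nonempty)
    (hx : x ∈ D) : ∀ᶠ r in 𝓝[>] 0, fderiv ℝ (fun y => cutoff D r y * f y) x (X x) -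
      (Metric.thickening r Z).indicator (fun x => f x * fderiv ℝ (cutoff D r) x (X x)) x =
        fderiv ℝ f x (X x) := by
  filter_upwards [Ioo_mem_nhdsGT (infDist_compl_pos hDo hne hx)] with r ⟨hr, hrx⟩
  have hnear : (fun y => cutoff D r y * f y) =ᶠ[𝓝 x] f := by
    filter_upwards [(Metric.continuous_infDist_pt Dᶜ).continuousAt.eventually (lt_mem_nhds hrx)]
      with y hy
    rw [cutoff_eq_one hr hy.le, one_mul]
  rw [hnear.fderiv_eq, sub_eq_self]
  exact Set.indicator_apply_eq_zero.2 fun _ => by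
    rw [fderiv_cutoff_of_le hr hrx.le, zero_apply, mul_zero]

theorem SegmentLipschitz.integrableOn_fderiv_apply (hf : SegmentLipschitz D f) (hDo : IsOpen D)
    (hDb : Bornology.IsBounded D) (hX : Measurable X) (hM : ∀ x ∈ D, ‖X x‖ ≤ M) :
    IntegrableOn (fun x => fderiv ℝ f x (X x)) D := by
  obtain ⟨B, hB⟩ := hf.norm_fderiv_le hDo
  refine Measure.integrableOn_of_bounded (M := B * M) hDb.measure_lt_top.ne
    (measurable_fderiv_apply f hX).aestronglyMeasurable ?_
  filter_upwards [ae_restrict_mem hDo.measurableSet] with x hx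
  exact (fderiv ℝ f x).le_of_opNorm_le_of_le (hB x hx) (hM x hx)

theorem tendsto_setIntegral_fderiv_cutoff_mul_sub_indicator (hDo : IsOpen D)
    (hDb : Bornology.IsBounded D) (hne : Dᶜ.Nonempty)
    (hZ : ∀ x ∈ frontier D, x ∉ Z → ∃ ν, IsOutwardNormal D x ν) (hX : ContDiff ℝ 1 X)
    (hXn : IsTangential D X) (hf : SegmentLipschitz D f) (hA : ∀ x ∈ D, |f x| ≤ A) :
    Tendsto (fun r => ∫ x in D, (fderiv ℝ (fun y => cutoff D r y * f y) x (X x) -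
      (Metric.thickening r Z).indicator (fun x => f x * fderiv ℝ (cutoff D r) x (X x)) x))
      (𝓝[>] 0) (𝓝 (∫ x in D, fderiv ℝ f x (X x))) := by
  obtain ⟨L, hL⟩ := exists_lipschitzOnWith_of_contDiff hX hDb.closure
  obtain ⟨M, hM⟩ := hDb.isCompact_closure.exists_bound_of_continuousOn hX.continuous.continuousOn
  obtain ⟨B, hB⟩ := hf.norm_fderiv_le hDo
  have hmem : ∀ᵐ x ∂volume.restrict D, x ∈ D := ae_restrict_mem hDo.measurableSet
  have hfm := (hf.continuousOn hDo).aestronglyMeasurable (μ := volume) hDo.measurableSet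
  have hderivm (g : E d → ℝ) := (measurable_fderiv_apply g hX.continuous.measurable
    ).aestronglyMeasurable (μ := volume.restrict D)
  refine tendsto_integral_filter_of_dominated_convergence (fun _ => B * M + A * L)
    (Eventually.of_forall fun r => (hderivm _).sub
      ((hfm.mul (hderivm _)).indicator Metric.isOpen_thickening.measurableSet))
    ?_ (integrableOn_const hDb.measure_lt_top.ne) ?_
  · filter_upwards [self_mem_nhdsWithin] with r (hr : 0 < r)
    filter_upwards [hmem, hf.ae_differentiableAt hDo,
      ae_restrict_of_ae (lipschitzWith_cutoff D hr.le).ae_differentiableAt,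
      ae_restrict_of_ae (Metric.lipschitz_infDist_pt Dᶜ).ae_differentiableAt] with x hx hfx hcx hdx
    exact norm_fderiv_cutoff_mul_sub_indicator_le hr.le hfx hcx (hA x hx) (hB x hx)
      (hM x (subset_closure hx))
      (abs_fderiv_cutoff_le_of_notMem_thickening hDo hne hZ hL hXn hx hr hdx)
  · filter_upwards [hmem] with x hx
    exact tendsto_nhds_of_eventually_eq (eventually_fderiv_cutoff_mul_sub_indicator_eq hDo hne hx)

/-- Cutting `f` off near the boundary costs the term `f * ∇(cutoff) · X`, which stays bounded away
from `Z` because `X` is tangential, and whose integral near `Z` tends to zero. -/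
theorem setIntegral_fderiv_eq_zero_of_isTangential (hDo : IsOpen D) (hDb : Bornology.IsBounded D)
    (hfr : volume (frontier D) = 0) (hZ : ∀ x ∈ frontier D, x ∉ Z → ∃ ν, IsOutwardNormal D x ν)
    (hZb : Bornology.IsBounded Z)
    (hZr : Tendsto (fun r : ℝ => r⁻¹ * volume.real (Metric.thickening r Z)) (𝓝[>] 0) (𝓝 0))
    (hX : ContDiff ℝ 1 X) (hXdiv : ∀ x ∈ D, divergence X x = 0) (hXn : IsTangential D X)
    (hf : SegmentLipschitz (closure D) f) (hA : ∀ x ∈ closure D, |f x| ≤ A) :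
    ∫ x in D, fderiv ℝ f x (X x) = 0 := by
  obtain hd | hd := subsingleton_or_nontrivial (E d)
  · simp [Subsingleton.eq_zero (X _)]
  have hne : Dᶜ.Nonempty := Set.nonempty_compl.2 fun h =>
    NormedSpace.unbounded_univ ℝ (E d) (h ▸ hDb)
  obtain ⟨M, hM⟩ := hDb.isCompact_closure.exists_bound_of_continuousOn hX.continuous.continuousOn
  have hMD : ∀ x ∈ D, ‖X x‖ ≤ M := fun x hx => hM x (subset_closure hx)
  have hAD : ∀ x ∈ D, |f x| ≤ A := fun x hx => hA x (subset_closure hx)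
  have hfD := hf.mono (subset_closure (s := D))
  have hXm := hX.continuous.measurable
  refine tendsto_nhds_unique
    (tendsto_setIntegral_fderiv_cutoff_mul_sub_indicator hDo hDb hne hZ hX hXn hfD hAD) ?_
  have hcorr := (tendsto_setIntegral_indicator_thickening hZb hZr hAD hMD).neg
  rw [neg_zero] at hcorr
  refine hcorr.congr' ?_
  filter_upwards [self_mem_nhdsWithin] with r (hr : 0 < r)
  have hcut (A : Set (E d)) : SegmentLipschitz A (cutoff D r) :=
    segmentLipschitz_of_lipschitzOnWith (lipschitzWith_cutoff D hr.le).lipschitzOnWith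
  have hprod := (hcut _).mul hf (fun x _ => abs_cutoff_le_one hr.le x) hA
  have hzero : ∫ x in D, fderiv ℝ (fun y => cutoff D r y * f y) x (X x) = 0 := by
    rw [← setIntegral_fderiv_add_mul_divergence hDo hDb hfr hX hprod (A := A)
      (fun x hx => ?_) (fun x hx => by rw [cutoff_eq_zero hx, zero_mul])]
    · exact setIntegral_congr_fun hDo.measurableSet fun x hx => by
        simp only [hXdiv x hx, mul_zero, add_zero]
    · rw [abs_mul]
      exact (mul_le_of_le_one_left (abs_nonneg _) (abs_cutoff_le_one hr.le x)).trans (hA x hx)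
  rw [integral_sub ((hprod.mono subset_closure).integrableOn_fderiv_apply hDo hDb hXm hMD), hzero,
    zero_sub]
  refine Integrable.indicator ?_ Metric.isOpen_thickening.measurableSet
  exact ((hcut D).integrableOn_fderiv_apply hDo hDb hXm hMD).bdd_mul (c := A)
    ((hfD.continuousOn hDo).aestronglyMeasurable hDo.measurableSet)
    (by filter_upwards [ae_restrict_mem hDo.measurableSet] with x hx using hAD x hx)

end Tangential

section Triangulated

variable {d : ℕ} {D : Set (E d)} {S : Geometry.SimplicialComplex ℝ (E d)} {X : E d → E d}
  {f : E d → ℝ} {A : ℝ}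

theorem IsTriangulation.setIntegral_fderiv_eq_zero (hS : IsTriangulation D S) (hDo : IsOpen D)
    (hDb : Bornology.IsBounded D) (hDr : interior (closure D) = D) (hX : ContDiff ℝ 1 X)
    (hXdiv : ∀ x ∈ D, divergence X x = 0) (hXn : IsTangential D X)
    (hf : SegmentLipschitz (closure D) f) (hA : ∀ x ∈ closure D, |f x| ≤ A) :
    ∫ x in D, fderiv ℝ f x (X x) = 0 := by
  refine setIntegral_fderiv_eq_zero_of_isTangential hDo hDb (hS.volume_frontier hDo hDr)
    (fun x hx hxS => hS.exists_isOutwardNormal hDo hDr hx hxS) (hDb.closure.subset ?_)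
    (tendsto_inv_mul_volume_thickening_codimTwoSkeleton hS.finite) hX hXdiv hXn hf hA
  rw [← hS.space_eq]
  exact Set.iUnion₂_subset fun s hs => S.convexHull_subset_space hs.1

end Triangulated

/-! ### The finite element space -/

section Sobolev

variable {d : ℕ} {D : Set (E d)} {v w φ : E d → ℝ} {G : E d → E d}

theorem continuous_gradient (hφ : ContDiff ℝ 1 φ) : Continuous (gradient φ) :=
  (InnerProductSpace.toDual ℝ (E d)).symm.continuous.comp (hφ.continuous_fderiv one_ne_zero)

theorem hasCompactSupport_gradient (hc : HasCompactSupport φ) : HasCompactSupport (gradient φ) :=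
  (hc.fderiv ℝ).comp_left (map_zero _)

theorem integral_gradient_eq_zero (hφ : ContDiff ℝ 1 φ) (hc : HasCompactSupport φ) :
    ∫ x, gradient φ x = 0 := by
  have hint : Integrable (gradient φ) :=
    (continuous_gradient hφ).integrable_of_hasCompactSupport (hasCompactSupport_gradient hc)
  obtain ⟨C, hC⟩ := hφ.lipschitzWith_of_hasCompactSupport hc one_ne_zero
  refine ext_inner_left ℝ fun w => ?_
  rw [← integral_inner hint, inner_zero_right,
    ← integral_lineDeriv_eq_zero (μ := volume) hC hc w]
  refine integral_congr_ae (ae_of_all _ fun x => ?_)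
  simp only [real_inner_comm (gradient φ x) w, inner_gradient_eq_fderiv,
    (hφ.differentiable one_ne_zero x).lineDeriv_eq_fderiv]

theorem integrable_smul_gradient (hv : MemLp v 2 (volume.restrict D)) (hφ : ContDiff ℝ 1 φ)
    (hc : HasCompactSupport φ) : Integrable (fun x => v x • gradient φ x) (volume.restrict D) := by
  have hgrad : MemLp (gradient φ) 2 (volume.restrict D) :=
    ((continuous_gradient hφ).memLp_of_hasCompactSupport (hasCompactSupport_gradient hc)).restrict D
  exact memLp_one_iff_integrable.1 (hgrad.smul (p := 2) (q := 2) (r := 1) hv)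

theorem integrable_smul_of_hasCompactSupport (hG : MemLp G 2 (volume.restrict D))
    (hφ : Continuous φ) (hc : HasCompactSupport φ) :
    Integrable (fun x => φ x • G x) (volume.restrict D) :=
  memLp_one_iff_integrable.1
    (hG.smul (p := 2) (q := 2) (r := 1) ((hφ.memLp_of_hasCompactSupport hc).restrict D))

theorem MemH1.add (hv : MemH1 D v) (hw : MemH1 D w) : MemH1 D (v + w) := by
  obtain ⟨hv, G, hG, hvG⟩ := hv
  obtain ⟨hw, H, hH, hwH⟩ := hw
  refine ⟨hv.add hw, G + H, hG.add hH, fun φ hφ hc hs => ?_⟩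
  have hφ1 : ContDiff ℝ 1 φ := hφ.of_le (by exact_mod_cast le_top)
  simp only [Pi.add_apply, add_smul, smul_add]
  rw [integral_add (integrable_smul_gradient hv hφ1 hc) (integrable_smul_gradient hw hφ1 hc),
    integral_add (integrable_smul_of_hasCompactSupport hG hφ.continuous hc)
      (integrable_smul_of_hasCompactSupport hH hφ.continuous hc),
    hvG φ hφ hc hs, hwH φ hφ hc hs, neg_add]

theorem MemH1.const_smul (hv : MemH1 D v) (c : ℝ) : MemH1 D (c • v) := by
  obtain ⟨hv, G, hG, hvG⟩ := hv
  refine ⟨hv.const_smul c, c • G, hG.const_smul c, fun φ hφ hc hs => ?_⟩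
  simp only [Pi.smul_apply, smul_eq_mul, mul_smul, smul_comm (φ _) c]
  rw [integral_smul, integral_smul, hvG φ hφ hc hs, smul_neg]

end Sobolev

section FiniteElementSpace

variable {d : ℕ} {D : Set (E d)} {S : Geometry.SimplicialComplex ℝ (E d)} {X : E d → E d}

/-- The finite element space `V_h` as a vector space. -/
def femSpace (D : Set (E d)) (S : Geometry.SimplicialComplex ℝ (E d)) : Submodule ℝ (E d → ℝ) where
  carrier := Vh D S
  zero_mem' := ⟨⟨MemLp.zero, 0, MemLp.zero, fun φ _ _ _ => by simp⟩, fun _ _ => rfl,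
    fun _ _ => ⟨0, fun x _ => by simp⟩⟩
  add_mem' := by
    rintro v w ⟨hv1, hv2, hv3⟩ ⟨hw1, hw2, hw3⟩
    refine ⟨hv1.add hw1, fun x hx => by simp [hv2 x hx, hw2 x hx], fun K hK => ?_⟩
    obtain ⟨p, hp⟩ := hv3 K hK
    obtain ⟨q, hq⟩ := hw3 K hK
    exact ⟨p + q, fun x hx => by simp [hp hx, hq hx]⟩
  smul_mem' := by
    rintro c v ⟨hv1, hv2, hv3⟩
    refine ⟨hv1.const_smul c, fun x hx => by simp [hv2 x hx], fun K hK => ?_⟩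
    obtain ⟨p, hp⟩ := hv3 K hK
    exact ⟨c • p, fun x hx => by simp [hp hx]⟩

/-- The constant function one of `V_h`, extended by zero outside `closure D`. -/
noncomputable def unitFun (D : Set (E d)) : E d → ℝ := (closure D).indicator fun _ => 1

theorem unitFun_apply {x : E d} (hx : x ∈ D) : unitFun D x = 1 :=
  Set.indicator_of_mem (subset_closure hx) _

theorem hasWeakGradient_unitFun (hDo : IsOpen D) : HasWeakGradient D (unitFun D) 0 := by
  intro φ hφ hc hs
  have hone : ∫ x in D, unitFun D x • gradient φ x = ∫ x in D, gradient φ x :=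
    setIntegral_congr_fun hDo.measurableSet fun x hx => by
      simp only [unitFun_apply hx, one_smul]
  rw [hone, setIntegral_eq_integral_of_forall_compl_eq_zero fun x hx => ?_,
    integral_gradient_eq_zero (hφ.of_le (by exact_mod_cast le_top)) hc]
  · simp
  · have hnear : φ =ᶠ[𝓝 x] 0 := notMem_tsupport_iff_eventuallyEq.1 fun h => hx (hs h)
    rw [gradient, hnear.fderiv_eq]
    simp

theorem IsTriangulation.unitFun_mem (hS : IsTriangulation D S) (hDo : IsOpen D)
    (hDb : Bornology.IsBounded D) : unitFun D ∈ Vh D S := by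
  have : IsFiniteMeasure (volume.restrict D) := ⟨by simpa using hDb.measure_lt_top⟩
  refine ⟨⟨(memLp_const 1).indicator isClosed_closure.measurableSet, 0, MemLp.zero,
    hasWeakGradient_unitFun hDo⟩, fun x hx => Set.indicator_of_notMem hx _,
    fun K hK => ⟨AffineMap.const ℝ (E d) 1, fun x hx => ?_⟩⟩
  exact Set.indicator_of_mem (hS.subset_closure hK hx) _

/-- `S` triangulates the bounded open set `D`; such a set is a polyhedral domain up to connectedness
and regularity of the boundary. -/
structure IsPolyhedral (D : Set (E d)) (S : Geometry.SimplicialComplex ℝ (E d)) : Prop where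
  tri : IsTriangulation D S
  isOpen : IsOpen D
  isBounded : Bornology.IsBounded D

theorem memLp_coe (v : femSpace D S) : MemLp (v : E d → ℝ) 2 (volume.restrict D) := v.2.1.1

theorem gradient_smul (c : ℝ) (v : femSpace D S) (x : E d) :
    gradient ((c • v : femSpace D S) : E d → ℝ) x = c • gradient (v : E d → ℝ) x := by
  have hsmul : fderiv ℝ ((c • v : femSpace D S) : E d → ℝ) x = c • fderiv ℝ (v : E d → ℝ) x :=
    congrFun (fderiv_const_smul_field (f := (v : E d → ℝ)) c) x
  rw [gradient, gradient, hsmul, map_smul]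

/-- The embedding of `V_h` into `L²(D)`. -/
noncomputable def toL2 (D : Set (E d)) (S : Geometry.SimplicialComplex ℝ (E d)) :
    femSpace D S →ₗ[ℝ] Lp ℝ 2 (volume.restrict D) where
  toFun v := (memLp_coe v).toLp v
  map_add' _ _ := rfl
  map_smul' _ _ := rfl

namespace IsPolyhedral

theorem isFiniteMeasure (h : IsPolyhedral D S) : IsFiniteMeasure (volume.restrict D) :=
  ⟨by simpa using h.isBounded.measure_lt_top⟩

/-- The constant function one as an element of `V_h`. -/
noncomputable def one (h : IsPolyhedral D S) : femSpace D S :=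
  ⟨unitFun D, h.tri.unitFun_mem h.isOpen h.isBounded⟩

theorem one_apply (h : IsPolyhedral D S) {x : E d} (hx : x ∈ D) : (h.one : E d → ℝ) x = 1 :=
  unitFun_apply hx

theorem segmentLipschitz (h : IsPolyhedral D S) (v : femSpace D S) : SegmentLipschitz D v :=
  (h.tri.segmentLipschitz v.2).mono subset_closure

theorem memLp_gradient (h : IsPolyhedral D S) (v : femSpace D S) :
    MemLp (gradient (v : E d → ℝ)) 2 (volume.restrict D) := by
  have := h.isFiniteMeasure
  obtain ⟨K, hK⟩ := (h.segmentLipschitz v).norm_fderiv_le h.isOpen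
  refine MemLp.of_bound (measurable_gradient _).aestronglyMeasurable K ?_
  filter_upwards [ae_restrict_mem h.isOpen.measurableSet] with x hx
  exact (norm_gradient _ x).trans_le (hK x hx)

theorem memLp_gradDot (h : IsPolyhedral D S) (hX : Continuous X) (v : femSpace D S) :
    MemLp (gradDot X (v : E d → ℝ)) 2 (volume.restrict D) := by
  obtain ⟨M, hM⟩ := h.isBounded.isCompact_closure.exists_bound_of_continuousOn hX.continuousOn
  refine (h.memLp_gradient v).of_le_mul (c := M)
    ((measurable_gradient _).inner hX.measurable).aestronglyMeasurable ?_
  filter_upwards [ae_restrict_mem h.isOpen.measurableSet] with x hx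
  rw [mul_comm]
  exact (norm_inner_le_norm _ _).trans (by gcongr; exact hM x (subset_closure hx))

theorem gradient_add_ae (h : IsPolyhedral D S) (v w : femSpace D S) :
    ∀ᵐ x ∂volume.restrict D, gradient ((v + w : femSpace D S) : E d → ℝ) x =
      gradient (v : E d → ℝ) x + gradient (w : E d → ℝ) x := by
  filter_upwards [(h.segmentLipschitz v).ae_differentiableAt h.isOpen,
    (h.segmentLipschitz w).ae_differentiableAt h.isOpen] with x hv hw
  rw [gradient, gradient, gradient, ← map_add, ← fderiv_add hv hw]
  rfl

/-- The gradient as a map from `V_h` into `L²(D)`. -/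
noncomputable def gradL2 (h : IsPolyhedral D S) :
    femSpace D S →ₗ[ℝ] Lp (E d) 2 (volume.restrict D) where
  toFun v := (h.memLp_gradient v).toLp _
  map_add' v w := by
    rw [← MemLp.toLp_add, MemLp.toLp_eq_toLp_iff]
    exact h.gradient_add_ae v w
  map_smul' c v := by
    rw [RingHom.id_apply, ← MemLp.toLp_const_smul, MemLp.toLp_eq_toLp_iff]
    exact ae_of_all _ fun x => gradient_smul c v x

/-- The derivative `∇ · X` along a vector field as a map from `V_h` into `L²(D)`. -/
noncomputable def gradDotL2 (h : IsPolyhedral D S) (hX : Continuous X) :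
    femSpace D S →ₗ[ℝ] Lp ℝ 2 (volume.restrict D) where
  toFun v := (h.memLp_gradDot hX v).toLp _
  map_add' v w := by
    rw [← MemLp.toLp_add, MemLp.toLp_eq_toLp_iff]
    filter_upwards [h.gradient_add_ae v w] with x hx
    rw [Pi.add_apply, gradDot, gradDot, gradDot, hx, inner_add_left]
  map_smul' c v := by
    rw [RingHom.id_apply, ← MemLp.toLp_const_smul, MemLp.toLp_eq_toLp_iff]
    refine ae_of_all _ fun x => ?_
    rw [Pi.smul_apply, gradDot, gradDot, gradient_smul, inner_smul_left, smul_eq_mul]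
    rfl

end IsPolyhedral

end FiniteElementSpace

section InnerProducts

variable {d : ℕ} {D : Set (E d)} {S : Geometry.SimplicialComplex ℝ (E d)} {X : E d → E d}

theorem inner_toLp {α F : Type*} [MeasurableSpace α] {μ : Measure α} [NormedAddCommGroup F]
    [InnerProductSpace ℝ F] {f g : α → F} (hf : MemLp f 2 μ) (hg : MemLp g 2 μ) :
    inner ℝ (hf.toLp f) (hg.toLp g) = ∫ x, inner ℝ (f x) (g x) ∂μ := by
  rw [L2.inner_def]
  refine integral_congr_ae ?_
  filter_upwards [hf.coeFn_toLp, hg.coeFn_toLp] with x hfx hgx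
  rw [hfx, hgx]

theorem inner_toLp_real {f g : E d → ℝ}
    (hf : MemLp f 2 (volume.restrict D)) (hg : MemLp g 2 (volume.restrict D)) :
    inner ℝ (hf.toLp f) (hg.toLp g) = ip D f g := by
  rw [inner_toLp, ip]
  simp only [RCLike.inner_apply, conj_trivial, mul_comm]

theorem ip_eq (v w : femSpace D S) : ip D v w = inner ℝ (toL2 D S v) (toL2 D S w) :=
  (inner_toLp_real (memLp_coe v) (memLp_coe w)).symm

theorem norm_toL2_sq (v : femSpace D S) :
    ‖toL2 D S v‖ ^ 2 = ∫ x in D, (v : E d → ℝ) x ^ 2 := by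
  rw [← real_inner_self_eq_norm_sq, ← ip_eq, ip]
  simp only [sq]

theorem ip_mul_const (f g : E d → ℝ) (c : ℝ) : ip D (fun x => f x * c) g = c * ip D f g := by
  rw [ip, ip, ← integral_const_mul]
  exact integral_congr_ae (ae_of_all _ fun x => by ring)

namespace IsPolyhedral

theorem gradIp_eq (h : IsPolyhedral D S) (v w : femSpace D S) :
    gradIp D v w = inner ℝ (h.gradL2 v) (h.gradL2 w) :=
  (inner_toLp (h.memLp_gradient v) (h.memLp_gradient w)).symm

theorem gradNormSq_eq (h : IsPolyhedral D S) (v : femSpace D S) :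
    gradNormSq D v = ‖h.gradL2 v‖ ^ 2 := by
  rw [← real_inner_self_eq_norm_sq, ← gradIp_eq, gradNormSq, gradIp]
  simp only [real_inner_self_eq_norm_sq]

theorem ip_gradDot_gradDot_eq (h : IsPolyhedral D S) (hX : Continuous X) (v w : femSpace D S) :
    ip D (gradDot X v) (gradDot X w) = inner ℝ (h.gradDotL2 hX v) (h.gradDotL2 hX w) :=
  (inner_toLp_real (h.memLp_gradDot hX v) (h.memLp_gradDot hX w)).symm

theorem ip_gradDot_eq (h : IsPolyhedral D S) (hX : Continuous X) (v w : femSpace D S) :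
    ip D (gradDot X v) w = inner ℝ (h.gradDotL2 hX v) (toL2 D S w) :=
  (inner_toLp_real (h.memLp_gradDot hX v) (memLp_coe w)).symm

theorem ip_one (h : IsPolyhedral D S) (f : E d → ℝ) : ip D f h.one = ∫ x in D, f x :=
  setIntegral_congr_fun h.isOpen.measurableSet fun x hx => by
    simp only [h.one_apply hx, mul_one]

theorem inner_toL2_one (h : IsPolyhedral D S) (v : femSpace D S) :
    inner ℝ (toL2 D S v) (toL2 D S h.one) = ∫ x in D, (v : E d → ℝ) x := by
  rw [← ip_eq, h.ip_one]

theorem norm_toL2_one_sq (h : IsPolyhedral D S) : ‖toL2 D S h.one‖ ^ 2 = volume.real D := by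
  have hone : ∫ x in D, (h.one : E d → ℝ) x = ∫ _ in D, (1 : ℝ) :=
    setIntegral_congr_fun h.isOpen.measurableSet fun x hx => h.one_apply hx
  rw [← real_inner_self_eq_norm_sq, inner_toL2_one, hone]
  simp

theorem gradient_one (h : IsPolyhedral D S) {x : E d} (hx : x ∈ D) :
    gradient (h.one : E d → ℝ) x = 0 := by
  have hnear : (h.one : E d → ℝ) =ᶠ[𝓝 x] fun _ => 1 := by
    filter_upwards [h.isOpen.mem_nhds hx] with y hy using h.one_apply hy
  rw [gradient, hnear.fderiv_eq]
  simp

theorem gradL2_one (h : IsPolyhedral D S) : h.gradL2 h.one = 0 := by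
  refine (MemLp.toLp_eq_toLp_iff (h.memLp_gradient h.one) MemLp.zero).2 ?_
  filter_upwards [ae_restrict_mem h.isOpen.measurableSet] with x hx
  exact h.gradient_one hx

theorem norm_gradDotL2_le (h : IsPolyhedral D S) (hX : Continuous X) {C : ℝ}
    (hC : ∀ x ∈ D, ‖X x‖ ≤ C) (v : femSpace D S) : ‖h.gradDotL2 hX v‖ ≤ C * ‖h.gradL2 v‖ := by
  refine Lp.norm_le_mul_norm_of_ae_le_mul ?_
  filter_upwards [(h.memLp_gradDot hX v).coeFn_toLp, (h.memLp_gradient v).coeFn_toLp,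
    ae_restrict_mem h.isOpen.measurableSet] with x hdot hgrad hx
  change ‖(h.memLp_gradDot hX v).toLp _ x‖ ≤ C * ‖(h.memLp_gradient v).toLp _ x‖
  rw [hdot, hgrad, mul_comm]
  exact (norm_inner_le_norm _ _).trans (by gcongr; exact hC x hx)

theorem toL2_injective (h : IsPolyhedral D S) : Function.Injective (toL2 D S) := by
  rw [injective_iff_map_eq_zero]
  intro v hv
  have hae : (v : E d → ℝ) =ᵐ[volume.restrict D] 0 :=
    (MemLp.toLp_eq_toLp_iff (memLp_coe v) MemLp.zero).1 hv
  have hcont := h.tri.continuousOn v.2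
  have hD : Set.EqOn (v : E d → ℝ) 0 D :=
    Measure.eqOn_open_of_ae_eq hae h.isOpen (hcont.mono subset_closure) continuousOn_const
  have hcl : Set.EqOn (v : E d → ℝ) 0 (closure D) :=
    hD.of_subset_closure hcont continuousOn_const subset_closure subset_rfl
  ext x
  by_cases hx : x ∈ closure D
  · exact hcl hx
  · exact v.2.2.1 x hx

theorem inner_gradDotL2_toL2 (h : IsPolyhedral D S) (hDr : interior (closure D) = D)
    (hX : ContDiff ℝ 1 X) (hXdiv : ∀ x ∈ D, divergence X x = 0) (hXn : IsTangential D X)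
    (v w : femSpace D S) :
    inner ℝ (h.gradDotL2 hX.continuous v) (toL2 D S w) =
      - inner ℝ (toL2 D S v) (h.gradDotL2 hX.continuous w) := by
  obtain ⟨M, hM⟩ := h.tri.exists_bound h.isBounded v.2
  obtain ⟨N, hN⟩ := h.tri.exists_bound h.isBounded w.2
  have hprod : ∫ x in D, fderiv ℝ (fun y => (v : E d → ℝ) y * (w : E d → ℝ) y) x (X x) = 0 :=
    h.tri.setIntegral_fderiv_eq_zero h.isOpen h.isBounded hDr hX hXdiv hXn
      ((h.tri.segmentLipschitz v.2).mul (h.tri.segmentLipschitz w.2) (fun x _ => hM x)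
        fun x _ => hN x)
      (A := M * N) fun x _ => by
        rw [abs_mul]
        exact mul_le_mul (hM x) (hN x) (abs_nonneg _) ((abs_nonneg _).trans (hM x))
  have hvw : Integrable (fun x => gradDot X v x * (w : E d → ℝ) x) (volume.restrict D) :=
    (h.memLp_gradDot hX.continuous v).integrable_mul (memLp_coe w)
  have hwv : Integrable (fun x => gradDot X w x * (v : E d → ℝ) x) (volume.restrict D) :=
    (h.memLp_gradDot hX.continuous w).integrable_mul (memLp_coe v)
  rw [real_inner_comm (h.gradDotL2 hX.continuous w), ← h.ip_gradDot_eq, ← h.ip_gradDot_eq,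
    eq_neg_iff_add_eq_zero, ip, ip, ← integral_add hvw hwv, ← hprod]
  refine integral_congr_ae ?_
  filter_upwards [(h.segmentLipschitz v).ae_differentiableAt h.isOpen,
    (h.segmentLipschitz w).ae_differentiableAt h.isOpen] with x hv hw
  rw [fderiv_fun_mul hv hw]
  simp only [gradDot, inner_gradient_eq_fderiv, add_apply, smul_apply, smul_eq_mul]
  ring

end IsPolyhedral

end InnerProducts

section Vertices

variable {d : ℕ} {D : Set (E d)} {S : Geometry.SimplicialComplex ℝ (E d)}

/-- The degrees of freedom of `V_h`: the values at the vertices of the triangulation. -/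
def vertexEval (D : Set (E d)) (S : Geometry.SimplicialComplex ℝ (E d)) :
    femSpace D S →ₗ[ℝ] (S.vertices → ℝ) where
  toFun v a := (v : E d → ℝ) a
  map_add' _ _ := rfl
  map_smul' _ _ := rfl

theorem finite_vertices (hS : S.faces.Finite) : Finite S.vertices := by
  rw [Set.finite_coe_iff, Geometry.SimplicialComplex.vertices_eq]
  exact hS.biUnion fun s _ => s.finite_toSet

theorem IsTriangulation.vertexEval_injective (hS : IsTriangulation D S) :
    Function.Injective (vertexEval D S) := by
  rw [injective_iff_map_eq_zero]
  intro v hv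
  ext x
  by_cases hx : x ∈ closure D
  · rw [hS.closure_eq] at hx
    obtain ⟨_, ⟨s, hs, hcard, rfl⟩, hxs⟩ := hx
    obtain ⟨p, hp⟩ := v.2.2.2 _ ⟨s, hs, hcard, rfl⟩
    have hzero : convexHull ℝ (s : Set (E d)) ⊆ p ⁻¹' {0} := by
      refine convexHull_min (fun a ha => ?_) ((convex_singleton 0).affine_preimage p)
      have hvertex : a ∈ S.vertices := by
        rw [Geometry.SimplicialComplex.vertices_eq]
        exact Set.mem_biUnion hs ha
      rw [Set.mem_preimage, Set.mem_singleton_iff, ← hp (subset_convexHull ℝ _ ha)]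
      exact congrFun hv ⟨a, hvertex⟩
    exact (hp hxs).trans (hzero hxs)
  · exact v.2.2.1 x hx

theorem IsTriangulation.finiteDimensional (hS : IsTriangulation D S) :
    FiniteDimensional ℝ (femSpace D S) := by
  have := finite_vertices hS.finite
  exact FiniteDimensional.of_injective _ hS.vertexEval_injective

theorem IsTriangulation.stronglyMeasurable_linearMap (hS : IsTriangulation D S) {Ω F : Type*}
    {m : MeasurableSpace Ω} [NormedAddCommGroup F] [NormedSpace ℝ F] {u : Ω → femSpace D S}
    (hu : ∀ x, Measurable fun ω => (u ω : E d → ℝ) x) (f : femSpace D S →ₗ[ℝ] F) :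
    StronglyMeasurable fun ω => f (u ω) := by
  have := finite_vertices hS.finite
  obtain ⟨ψ, hψ⟩ := LinearMap.exists_leftInverse_of_injective (vertexEval D S)
    (LinearMap.ker_eq_bot.2 hS.vertexEval_injective)
  have hcont : Continuous (f.comp ψ) := (f.comp ψ).continuous_of_finiteDimensional
  have hvertex : Measurable fun ω => vertexEval D S (u ω) := measurable_pi_lambda _ fun a => hu a
  have hinv : ∀ ω, ψ (vertexEval D S (u ω)) = u ω := fun ω => LinearMap.congr_fun hψ _
  simpa only [Function.comp_def, LinearMap.comp_apply, hinv] using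
    hcont.comp_stronglyMeasurable hvertex.stronglyMeasurable

end Vertices

/-! ### The energy estimate for one time step -/

section Energy

variable {V H G : Type*} [AddCommGroup V] [Module ℝ V] [NormedAddCommGroup H]
  [InnerProductSpace ℝ H] [NormedAddCommGroup G] [InnerProductSpace ℝ G]
  {val gradX : V →ₗ[ℝ] H} {grad : V →ₗ[ℝ] G} {one : V} {T : V →ₗ[ℝ] V}

/-- `T` is an inverse of the discrete negative Laplace operator: for `ζ` of zero mean, `T ζ` has
zero mean and solves the discrete Poisson equation `(∇ T ζ, ∇ v) = (ζ, v)`. The finite element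
space is an abstract `V`, with the embedding `val` into `L²`, the gradient `grad` and the constant
function `one`. -/
def IsInverseLaplacian (val : V →ₗ[ℝ] H) (grad : V →ₗ[ℝ] G) (one : V) (T : V →ₗ[ℝ] V) : Prop :=
  ∀ ζ, inner ℝ (val ζ) (val one) = 0 → inner ℝ (val (T ζ)) (val one) = 0 ∧
    ∀ v, inner ℝ (grad (T ζ)) (grad v) = inner ℝ (val ζ) (val v)

/-- The bilinear form `(∇ v, ∇ w) + (v, 1) (w, 1)`, which is definite on functions of arbitrary mean
and agrees with the Dirichlet form on those of zero mean. -/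
noncomputable def meanDirichletForm (val : V →ₗ[ℝ] H) (grad : V →ₗ[ℝ] G) (one : V) :
    V →ₗ[ℝ] V →ₗ[ℝ] ℝ :=
  (innerₗ G).compl₁₂ grad grad + (LinearMap.mul ℝ ℝ).compl₁₂ ((innerₗ H (val one)).comp val)
    ((innerₗ H (val one)).comp val)

theorem meanDirichletForm_apply (v w : V) : meanDirichletForm val grad one v w =
    inner ℝ (grad v) (grad w) + inner ℝ (val v) (val one) * inner ℝ (val w) (val one) := by
  simp [meanDirichletForm, real_inner_comm]

theorem meanDirichletForm_injective (hval : Function.Injective val) {K : ℝ}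
    (hP : ∀ v, inner ℝ (val v) (val one) = 0 → ‖val v‖ ^ 2 ≤ K * ‖grad v‖ ^ 2) :
    Function.Injective (meanDirichletForm val grad one) := by
  rw [injective_iff_map_eq_zero]
  intro v hv
  have hzero : ‖grad v‖ ^ 2 + inner ℝ (val v) (val one) ^ 2 = 0 := by
    rw [← real_inner_self_eq_norm_sq, sq, ← meanDirichletForm_apply, hv, LinearMap.zero_apply]
  obtain ⟨hgrad, hmean⟩ := (add_eq_zero_iff_of_nonneg (sq_nonneg _) (sq_nonneg _)).1 hzero
  have hle := hP v (pow_eq_zero_iff two_ne_zero |>.1 hmean)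
  rw [hgrad, mul_zero] at hle
  have hnorm : ‖val v‖ = 0 := pow_eq_zero_iff two_ne_zero |>.1 (hle.antisymm (sq_nonneg _))
  exact hval ((norm_eq_zero.1 hnorm).trans (map_zero val).symm)

theorem exists_isInverseLaplacian [FiniteDimensional ℝ V] (hval : Function.Injective val)
    (hone : grad one = 0) (hone0 : one ≠ 0) {K : ℝ}
    (hP : ∀ v, inner ℝ (val v) (val one) = 0 → ‖val v‖ ^ 2 ≤ K * ‖grad v‖ ^ 2) :
    ∃ T, IsInverseLaplacian val grad one T := by
  let e : V ≃ₗ[ℝ] (V →ₗ[ℝ] ℝ) := LinearEquiv.ofInjectiveOfFinrankEq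
    (meanDirichletForm val grad one) (meanDirichletForm_injective hval hP)
    Subspace.dual_finrank_eq.symm
  refine ⟨e.symm.toLinearMap.comp ((innerₗ H).compl₁₂ val val), fun ζ hζ => ?_⟩
  set z : V := (e.symm.toLinearMap.comp ((innerₗ H).compl₁₂ val val)) ζ
  have hsolves : ∀ v, inner ℝ (grad z) (grad v) + inner ℝ (val z) (val one) *
      inner ℝ (val v) (val one) = inner ℝ (val ζ) (val v) := fun v => by
    rw [← meanDirichletForm_apply]
    exact LinearMap.congr_fun (e.apply_symm_apply _) v
  have hmean : inner ℝ (val z) (val one) = 0 := by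
    have htest := hsolves one
    rw [hone, inner_zero_right, zero_add, hζ] at htest
    refine (mul_eq_zero.1 htest).resolve_right (inner_self_ne_zero.2 fun h => hone0 ?_)
    exact hval (h.trans (map_zero val).symm)
  refine ⟨hmean, fun v => ?_⟩
  rw [← hsolves v, hmean, zero_mul, add_zero]

theorem IsInverseLaplacian.norm_val_sq_le (hT : IsInverseLaplacian val grad one T) {ζ : V}
    (hζ : inner ℝ (val ζ) (val one) = 0) : ‖val ζ‖ ^ 2 ≤ ‖grad (T ζ)‖ * ‖grad ζ‖ := by
  rw [← real_inner_self_eq_norm_sq, ← (hT ζ hζ).2 ζ]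
  exact real_inner_le_norm _ _

theorem IsInverseLaplacian.norm_grad_sq_le (hT : IsInverseLaplacian val grad one T) {K : ℝ}
    (hP : ∀ v, inner ℝ (val v) (val one) = 0 → ‖val v‖ ^ 2 ≤ K * ‖grad v‖ ^ 2) {ζ : V}
    (hζ : inner ℝ (val ζ) (val one) = 0) : ‖grad (T ζ)‖ ^ 2 ≤ K * ‖val ζ‖ ^ 2 := by
  have htest : ‖grad (T ζ)‖ ^ 2 ≤ ‖val ζ‖ * ‖val (T ζ)‖ := by
    rw [← real_inner_self_eq_norm_sq, (hT ζ hζ).2 (T ζ)]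
    exact real_inner_le_norm _ _
  rcases (sq_nonneg ‖grad (T ζ)‖).eq_or_lt with hzero | hpos
  · have hgrad : ‖grad (T ζ)‖ = 0 := pow_eq_zero_iff two_ne_zero |>.1 hzero.symm
    have hval := hT.norm_val_sq_le hζ
    rw [hgrad, zero_mul] at hval
    rw [← hzero, hval.antisymm (sq_nonneg _), mul_zero]
  · refine le_of_mul_le_mul_right ?_ hpos
    calc ‖grad (T ζ)‖ ^ 2 * ‖grad (T ζ)‖ ^ 2
        ≤ (‖val ζ‖ * ‖val (T ζ)‖) * (‖val ζ‖ * ‖val (T ζ)‖) := by gcongr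
      _ = ‖val ζ‖ ^ 2 * ‖val (T ζ)‖ ^ 2 := by ring
      _ ≤ ‖val ζ‖ ^ 2 * (K * ‖grad (T ζ)‖ ^ 2) := by gcongr; exact hP _ (hT ζ hζ).1
      _ = _ := by ring

/-- `gradX` behaves like the derivative along a divergence-free, tangential vector field of norm at
most `C`: it is antisymmetric and dominated by the gradient. -/
structure IsAdvection (val : V →ₗ[ℝ] H) (grad : V →ₗ[ℝ] G) (gradX : V →ₗ[ℝ] H) (C : ℝ) :
    Prop where
  inner_eq_neg : ∀ v w, inner ℝ (gradX v) (val w) = -inner ℝ (val v) (gradX w)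
  norm_le : ∀ v, ‖gradX v‖ ≤ C * ‖grad v‖

theorem mul_mul_le_add_mul_sq {ε : ℝ} (hε : 0 < ε) (k a b : ℝ) :
    k * (a * b) ≤ ε * b ^ 2 + k ^ 2 * ε⁻¹ / 4 * a ^ 2 := by
  have := two_mul_le_add_mul_sq (a := b) (b := k * a / 2) hε
  linarith

namespace IsAdvection

variable {C : ℝ}

theorem eq_zero (h : IsAdvection val grad gradX C) {v : V} (hv : grad v = 0) : gradX v = 0 := by
  simpa only [hv, norm_zero, mul_zero, norm_le_zero_iff] using h.norm_le v

theorem abs_inner_val_le (h : IsAdvection val grad gradX C) (v w : V) :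
    |inner ℝ (gradX v) (val w)| ≤ C * ‖val v‖ * ‖grad w‖ := by
  rw [h.inner_eq_neg, abs_neg, mul_right_comm, mul_comm]
  exact (abs_real_inner_le_norm _ _).trans (by gcongr; exact h.norm_le w)

theorem mul_inner_val_le (h : IsAdvection val grad gradX C) (k : ℝ) (v w : V) :
    k * inner ℝ (gradX v) (val w) ≤
      1 / 2 * ‖grad w‖ ^ 2 + 1 / 2 * C ^ 2 * (k ^ 2 * ‖val v‖ ^ 2) := by
  have hyoung := mul_mul_le_add_mul_sq one_half_pos (|k| * C) ‖val v‖ ‖grad w‖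
  rw [mul_pow, sq_abs] at hyoung
  calc k * inner ℝ (gradX v) (val w) ≤ |k| * |inner ℝ (gradX v) (val w)| :=
        (le_abs_self _).trans_eq (abs_mul _ _)
    _ ≤ |k| * (C * ‖val v‖ * ‖grad w‖) := by gcongr; exact h.abs_inner_val_le v w
    _ ≤ _ := by linarith

theorem neg_mul_inner_le (h : IsAdvection val grad gradX C) {ε k : ℝ} (hε : 0 < ε) (hk : 0 ≤ k)
    (v w : V) : -(k * inner ℝ (gradX v) (gradX w)) ≤
      ε * ‖grad v‖ ^ 2 + (k * C ^ 2) ^ 2 * ε⁻¹ / 4 * ‖grad w‖ ^ 2 := by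
  have hinner : -inner ℝ (gradX v) (gradX w) ≤ (C * ‖grad v‖) * (C * ‖grad w‖) :=
    (neg_le_abs _).trans ((abs_real_inner_le_norm _ _).trans (mul_le_mul (h.norm_le v) (h.norm_le w)
      (norm_nonneg _) ((norm_nonneg _).trans (h.norm_le v))))
  have hyoung := mul_mul_le_add_mul_sq hε (k * C ^ 2) ‖grad w‖ ‖grad v‖
  linarith [mul_le_mul_of_nonneg_left hinner hk]

end IsAdvection

/-- The rate at which the discrete energy may grow, as a function of a bound `C` of the vector
field, the noise strength `δ` and the inverse interface width `s = ε⁻¹`. -/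
noncomputable def growthRate (C δ s : ℝ) : ℝ := s ^ 3 + C ^ 4 * δ ^ 4 * s / 2

theorem growthRate_nonneg {s : ℝ} (hs : 0 ≤ s) (C δ : ℝ) : 0 ≤ growthRate C δ s := by
  unfold growthRate
  positivity

theorem growthRate_le {s : ℝ} (hs : 0 ≤ s) (C δ : ℝ) :
    growthRate C δ s ≤ (1 + C ^ 4) * (s ^ 3 + s * δ ^ 4) := by
  have h : 0 ≤ C ^ 4 * s ^ 3 + s * δ ^ 4 + C ^ 4 * δ ^ 4 * s / 2 := by positivity
  unfold growthRate
  linarith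

namespace IsInverseLaplacian

theorem energy_identity (hT : IsInverseLaplacian val grad one T) {ζ ζ' w : V}
    (hζ : inner ℝ (val ζ) (val one) = 0) (hζ' : inner ℝ (val ζ') (val one) = 0) {τ r : ℝ}
    (hstep : inner ℝ (val ζ) (val (T ζ)) =
      inner ℝ (val ζ') (val (T ζ)) - τ * inner ℝ (grad w) (grad (T ζ)) + r) :
    1 / 2 * ‖grad (T ζ)‖ ^ 2 + 1 / 2 * ‖grad (T ζ - T ζ')‖ ^ 2 + τ * inner ℝ (val w) (val ζ) =
      1 / 2 * ‖grad (T ζ')‖ ^ 2 + r := by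
  rw [← (hT ζ hζ).2, ← (hT ζ' hζ').2, real_inner_self_eq_norm_sq,
    real_inner_comm (grad (T ζ)) (grad w), (hT ζ hζ).2 w, real_inner_comm (val w)] at hstep
  rw [map_sub, norm_sub_sq_real, real_inner_comm]
  linarith

theorem energy_step (hT : IsInverseLaplacian val grad one T) {C : ℝ}
    (hadv : IsAdvection val grad gradX C) {ζ ζ' w : V}
    (hζ : inner ℝ (val ζ) (val one) = 0) (hζ' : inner ℝ (val ζ') (val one) = 0)
    {τ δ ε ξ F : ℝ} (hτ : 0 ≤ τ) (hε : 0 < ε)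
    (hstep : ∀ η, inner ℝ (val ζ) (val η) = inner ℝ (val ζ') (val η)
      - τ * inner ℝ (grad w) (grad η) - τ * (δ ^ 2 / 2) * inner ℝ (gradX ζ) (gradX η)
      + δ * (ξ * inner ℝ (gradX ζ') (val η)))
    (hw : inner ℝ (val w) (val ζ) = ε * ‖grad ζ‖ ^ 2 + ε⁻¹ * F) (hF : -‖val ζ‖ ^ 2 ≤ F) :
    1 / 2 * ‖grad (T ζ)‖ ^ 2 + 5 / 8 * τ * ε * ‖grad ζ‖ ^ 2 ≤
      1 / 2 * ‖grad (T ζ')‖ ^ 2 + τ * growthRate C δ ε⁻¹ * ‖grad (T ζ)‖ ^ 2 +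
        δ * (ξ * inner ℝ (gradX ζ') (val (T ζ'))) +
        1 / 2 * δ ^ 2 * C ^ 2 * (ξ ^ 2 * ‖val ζ'‖ ^ 2) := by
  have hidentity := hT.energy_identity hζ hζ' (w := w) (τ := τ)
    (r := -(τ * (δ ^ 2 / 2) * inner ℝ (gradX ζ) (gradX (T ζ))) +
      δ * (ξ * inner ℝ (gradX ζ') (val (T ζ)))) (by linarith [hstep (T ζ)])
  have hnoise := hadv.mul_inner_val_le (δ * ξ) ζ' (T ζ - T ζ')
  have hdiffusion := hadv.neg_mul_inner_le (ε := ε / 8) (k := δ ^ 2 / 2) (by positivity)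
    (by positivity) ζ (T ζ)
  have hreaction : -(ε⁻¹ * F) ≤ ε / 4 * ‖grad ζ‖ ^ 2 + ε⁻¹ ^ 3 * ‖grad (T ζ)‖ ^ 2 :=
    calc -(ε⁻¹ * F) = ε⁻¹ * -F := by ring
      _ ≤ ε⁻¹ * (‖grad (T ζ)‖ * ‖grad ζ‖) := by gcongr; linarith [hT.norm_val_sq_le hζ]
      _ ≤ _ := mul_mul_le_add_mul_sq (by positivity : 0 < ε / 4) _ _ _
      _ = _ := by rw [inv_div]; ring
  rw [inv_div] at hdiffusion
  have hdissipation := mul_le_mul_of_nonneg_left (add_le_add hdiffusion hreaction) hτ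
  rw [hw] at hidentity
  rw [map_sub val, inner_sub_right] at hnoise
  simp only [growthRate]
  ring_nf at hidentity hdissipation hnoise ⊢
  linarith

end IsInverseLaplacian

end Energy

/-! ### The energy estimate in expectation -/

section Gronwall

variable {N : ℕ} {e b : ℕ → ℝ} {θ β : ℝ}

theorem one_le_one_sub_mul_exp (hθ0 : 0 ≤ θ) (hθ : θ ≤ 1 / 2) :
    1 ≤ (1 - θ) * Real.exp (2 * θ) :=
  calc 1 ≤ (1 - θ) * (2 * θ + 1) := by nlinarith
    _ ≤ _ := by
      gcongr
      · linarith
      · exact Real.add_one_le_exp _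

theorem le_exp_mul_of_dissipative (hθ0 : 0 ≤ θ) (hθ : θ ≤ 1 / 2) (hβ : 0 ≤ β) (he : ∀ n, 0 ≤ e n)
    (hb : ∀ n, 0 ≤ b n) (h : ∀ n < N, (1 - θ) * e (n + 1) + β * b (n + 1) ≤ e n) {n : ℕ}
    (hn : n ≤ N) : e n ≤ Real.exp (2 * (θ * N)) * e 0 := by
  have hfactor : e n ≤ Real.exp (2 * θ) ^ n * e 0 := by
    refine le_geom (Real.exp_nonneg _) n fun k hk => ?_
    calc e (k + 1) ≤ (1 - θ) * Real.exp (2 * θ) * e (k + 1) :=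
          le_mul_of_one_le_left (he _) (one_le_one_sub_mul_exp hθ0 hθ)
      _ = Real.exp (2 * θ) * ((1 - θ) * e (k + 1)) := by ring
      _ ≤ Real.exp (2 * θ) * e k := by
          gcongr
          exact (le_add_of_nonneg_right (mul_nonneg hβ (hb _))).trans (h k (hk.trans_le hn))
  refine hfactor.trans ?_
  rw [← Real.exp_nat_mul, mul_left_comm, mul_comm θ]
  gcongr
  exact he 0

theorem mul_sum_le_of_dissipative (hθ0 : 0 ≤ θ) (hθ : θ ≤ 1 / 2) (hβ : 0 ≤ β)
    (he : ∀ n, 0 ≤ e n) (hb : ∀ n, 0 ≤ b n)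
    (h : ∀ n < N, (1 - θ) * e (n + 1) + β * b (n + 1) ≤ e n) :
    β * ∑ n ∈ Finset.Icc 1 N, b n ≤ e 0 * (1 + θ * N * Real.exp (2 * (θ * N))) := by
  have hpartial : ∀ k ≤ N, e k + β * ∑ n ∈ Finset.Icc 1 k, b n ≤
      e 0 + k * (θ * (Real.exp (2 * (θ * N)) * e 0)) := by
    intro k
    induction k with
    | zero => intro _; simp
    | succ k ih =>
      intro hk
      have hbound := mul_le_mul_of_nonneg_left (le_exp_mul_of_dissipative hθ0 hθ hβ he hb h hk) hθ0
      rw [Finset.sum_Icc_succ_top (by omega)]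
      push_cast
      linarith [h k (by omega), ih (by omega)]
  linarith [hpartial N le_rfl, he N]

end Gronwall

section Noise

variable {Ω : Type*} {m : MeasurableSpace Ω} {P : Measure Ω} {𝒢 : ℕ → MeasurableSpace Ω}
  {ξ : ℕ → Ω → ℝ} {τ : ℝ}

/-- `ξ n` are centered random variables of variance `τ`, independent of the past `𝒢 n`, like the
increments of a Wiener process on a grid of step `τ`. -/
structure IsDiscreteNoise (P : Measure Ω) (𝒢 : ℕ → MeasurableSpace Ω) (τ : ℝ) (ξ : ℕ → Ω → ℝ) :
    Prop where
  le : ∀ n, 𝒢 n ≤ m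
  memLp : ∀ n, MemLp (ξ n) 2 P
  integral_eq_zero : ∀ n, ∫ ω, ξ n ω ∂P = 0
  integral_sq : ∀ n, ∫ ω, ξ n ω ^ 2 ∂P = τ
  indep : ∀ n, Indep (MeasurableSpace.comap (ξ n) inferInstance) (𝒢 n) P

namespace IsDiscreteNoise

variable {n : ℕ} {f : Ω → ℝ}

theorem indepFun (h : IsDiscreteNoise P 𝒢 τ ξ) (hf : StronglyMeasurable[𝒢 n] f) :
    IndepFun (ξ n) f P := by
  rw [IndepFun_iff_Indep]
  exact indep_of_indep_of_le_right (h.indep n) hf.measurable.comap_le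

theorem indepFun_sq (h : IsDiscreteNoise P 𝒢 τ ξ) (hf : StronglyMeasurable[𝒢 n] f) :
    IndepFun (fun ω => ξ n ω ^ 2) f P :=
  (h.indepFun hf).comp (measurable_id.pow_const 2) measurable_id

theorem integrable_mul [IsFiniteMeasure P] (h : IsDiscreteNoise P 𝒢 τ ξ)
    (hf : StronglyMeasurable[𝒢 n] f) (hfi : Integrable f P) :
    Integrable (fun ω => ξ n ω * f ω) P :=
  (h.indepFun hf).integrable_mul ((h.memLp n).integrable one_le_two) hfi

theorem integral_mul (h : IsDiscreteNoise P 𝒢 τ ξ) (hf : StronglyMeasurable[𝒢 n] f) :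
    ∫ ω, ξ n ω * f ω ∂P = 0 := by
  rw [(h.indepFun hf).integral_fun_mul_eq_mul_integral (h.memLp n).aestronglyMeasurable
    (hf.mono (h.le n)).aestronglyMeasurable, h.integral_eq_zero, zero_mul]

theorem integrable_sq_mul (h : IsDiscreteNoise P 𝒢 τ ξ) (hf : StronglyMeasurable[𝒢 n] f)
    (hfi : Integrable f P) : Integrable (fun ω => ξ n ω ^ 2 * f ω) P :=
  (h.indepFun_sq hf).integrable_mul (h.memLp n).integrable_sq hfi

theorem integral_sq_mul (h : IsDiscreteNoise P 𝒢 τ ξ) (hf : StronglyMeasurable[𝒢 n] f) :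
    ∫ ω, ξ n ω ^ 2 * f ω ∂P = τ * ∫ ω, f ω ∂P := by
  rw [(h.indepFun_sq hf).integral_fun_mul_eq_mul_integral
    (h.memLp n).integrable_sq.aestronglyMeasurable (hf.mono (h.le n)).aestronglyMeasurable,
    h.integral_sq]

end IsDiscreteNoise

end Noise

section EnergyProcess

variable {Ω : Type*} {m : MeasurableSpace Ω} {P : Measure Ω} {𝒢 : ℕ → MeasurableSpace Ω}
  {ξ : ℕ → Ω → ℝ} {N : ℕ} {τ δ ε C : ℝ} {a b l M : ℕ → Ω → ℝ}

/-- Adapted processes satisfying the energy inequality of the scheme. The processes `a`, `b` and `l`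
stand for the norms `‖ζ‖_{-1,h}`, `‖∇ ζ‖` and `‖ζ‖` of the solution `ζ` at time `n`, and `M` for the
coefficient of the noise, which only enters through martingale increments `ξ n * M n`. -/
structure IsEnergyProcess (P : Measure Ω) (𝒢 : ℕ → MeasurableSpace Ω) (ξ : ℕ → Ω → ℝ) (N : ℕ)
    (τ δ ε C : ℝ) (a b l M : ℕ → Ω → ℝ) : Prop where
  noise : IsDiscreteNoise P 𝒢 τ ξ
  adapted_a : ∀ n ≤ N, StronglyMeasurable[𝒢 n] (a n)
  adapted_b : ∀ n ≤ N, StronglyMeasurable[𝒢 n] (b n)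
  adapted_l : ∀ n ≤ N, StronglyMeasurable[𝒢 n] (l n)
  adapted_M : ∀ n ≤ N, StronglyMeasurable[𝒢 n] (M n)
  integrable_a_zero : Integrable (fun ω => a 0 ω ^ 2) P
  integrable_l_zero : Integrable (fun ω => l 0 ω ^ 2) P
  l_sq_le : ∀ n ≤ N, ∀ᵐ ω ∂P, l n ω ^ 2 ≤ a n ω * b n ω
  abs_M_le : ∀ n ω, |M n ω| ≤ C * l n ω * a n ω
  step : ∀ n < N, ∀ᵐ ω ∂P, 1 / 2 * a (n + 1) ω ^ 2 + 5 / 8 * τ * ε * b (n + 1) ω ^ 2 ≤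
    1 / 2 * a n ω ^ 2 + τ * growthRate C δ ε⁻¹ * a (n + 1) ω ^ 2 + δ * (ξ n ω * M n ω) +
      1 / 2 * δ ^ 2 * C ^ 2 * (ξ n ω ^ 2 * l n ω ^ 2)

/-- The mean discrete energy at time `n`, augmented by the variance of the next noise increment. -/
noncomputable def meanEnergy (P : Measure Ω) (τ δ C : ℝ) (a l : ℕ → Ω → ℝ) (n : ℕ) : ℝ :=
  1 / 2 * ∫ ω, a n ω ^ 2 ∂P + 1 / 2 * δ ^ 2 * C ^ 2 * (τ * ∫ ω, l n ω ^ 2 ∂P)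

theorem meanEnergy_nonneg (hτ : 0 ≤ τ) (n : ℕ) : 0 ≤ meanEnergy P τ δ C a l n := by
  unfold meanEnergy
  positivity

namespace IsEnergyProcess

variable {n : ℕ}

theorem integrable_M (h : IsEnergyProcess P 𝒢 ξ N τ δ ε C a b l M) (hn : n ≤ N)
    (ha : Integrable (fun ω => a n ω ^ 2) P) (hl : Integrable (fun ω => l n ω ^ 2) P) :
    Integrable (M n) P := by
  refine ((hl.const_mul (C ^ 2)).add ha).mono'
    ((h.adapted_M n hn).mono (h.noise.le n)).aestronglyMeasurable (ae_of_all _ fun ω => ?_)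
  refine (h.abs_M_le n ω).trans ?_
  simp only [Pi.add_apply]
  linarith [two_mul_le_add_sq (C * l n ω) (a n ω), mul_pow C (l n ω) 2,
    mul_nonneg (sq_nonneg C) (sq_nonneg (l n ω)), sq_nonneg (a n ω)]

theorem integrable_noise [IsFiniteMeasure P] (h : IsEnergyProcess P 𝒢 ξ N τ δ ε C a b l M)
    (hn : n ≤ N) (ha : Integrable (fun ω => a n ω ^ 2) P)
    (hl : Integrable (fun ω => l n ω ^ 2) P) :
    Integrable (fun ω => δ * (ξ n ω * M n ω) +
      1 / 2 * δ ^ 2 * C ^ 2 * (ξ n ω ^ 2 * l n ω ^ 2)) P :=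
  ((h.noise.integrable_mul (h.adapted_M n hn) (h.integrable_M hn ha hl)).const_mul _).add
    ((h.noise.integrable_sq_mul ((h.adapted_l n hn).pow 2) hl).const_mul _)

theorem integral_noise [IsFiniteMeasure P] (h : IsEnergyProcess P 𝒢 ξ N τ δ ε C a b l M)
    (hn : n ≤ N) (ha : Integrable (fun ω => a n ω ^ 2) P)
    (hl : Integrable (fun ω => l n ω ^ 2) P) :
    ∫ ω, (δ * (ξ n ω * M n ω) + 1 / 2 * δ ^ 2 * C ^ 2 * (ξ n ω ^ 2 * l n ω ^ 2)) ∂P =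
      1 / 2 * δ ^ 2 * C ^ 2 * (τ * ∫ ω, l n ω ^ 2 ∂P) := by
  have hM : Integrable (fun ω => ξ n ω * M n ω) P :=
    h.noise.integrable_mul (h.adapted_M n hn) (h.integrable_M hn ha hl)
  have hL : Integrable (fun ω => ξ n ω ^ 2 * l n ω ^ 2) P :=
    h.noise.integrable_sq_mul ((h.adapted_l n hn).pow 2) hl
  have hvar : ∫ ω, ξ n ω ^ 2 * l n ω ^ 2 ∂P = τ * ∫ ω, l n ω ^ 2 ∂P :=
    h.noise.integral_sq_mul ((h.adapted_l n hn).pow 2)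
  rw [integral_add (hM.const_mul _) (hL.const_mul _), integral_const_mul, integral_const_mul,
    h.noise.integral_mul (h.adapted_M n hn), hvar, mul_zero, zero_add]

theorem coercive_step (h : IsEnergyProcess P 𝒢 ξ N τ δ ε C a b l M)
    (hτK : τ * growthRate C δ ε⁻¹ ≤ 1 / 8) (hn : n < N) :
    ∀ᵐ ω ∂P, 3 / 8 * a (n + 1) ω ^ 2 + 5 / 8 * τ * ε * b (n + 1) ω ^ 2 ≤
      1 / 2 * a n ω ^ 2 + (δ * (ξ n ω * M n ω) +
        1 / 2 * δ ^ 2 * C ^ 2 * (ξ n ω ^ 2 * l n ω ^ 2)) := by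
  filter_upwards [h.step n hn] with ω hω
  linarith [mul_le_mul_of_nonneg_right hτK (sq_nonneg (a (n + 1) ω))]

theorem integrable_a_succ [IsFiniteMeasure P] (h : IsEnergyProcess P 𝒢 ξ N τ δ ε C a b l M)
    (hτ : 0 < τ) (hε : 0 < ε) (hτK : τ * growthRate C δ ε⁻¹ ≤ 1 / 8) (hn : n < N)
    (ha : Integrable (fun ω => a n ω ^ 2) P) (hl : Integrable (fun ω => l n ω ^ 2) P) :
    Integrable (fun ω => a (n + 1) ω ^ 2) P := by
  refine (((ha.const_mul (1 / 2)).add (h.integrable_noise hn.le ha hl)).const_mul (8 / 3)).mono'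
    (((h.adapted_a _ hn).pow 2).mono (h.noise.le _)).aestronglyMeasurable ?_
  filter_upwards [h.coercive_step hτK hn] with ω hω
  have hb : 0 ≤ 5 / 8 * τ * ε * b (n + 1) ω ^ 2 := by positivity
  rw [Real.norm_of_nonneg (sq_nonneg _), Pi.add_apply]
  linarith

theorem integrable_b_succ [IsFiniteMeasure P] (h : IsEnergyProcess P 𝒢 ξ N τ δ ε C a b l M)
    (hτ : 0 < τ) (hε : 0 < ε) (hτK : τ * growthRate C δ ε⁻¹ ≤ 1 / 8) (hn : n < N)
    (ha : Integrable (fun ω => a n ω ^ 2) P) (hl : Integrable (fun ω => l n ω ^ 2) P) :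
    Integrable (fun ω => b (n + 1) ω ^ 2) P := by
  have hcoef : 0 < 5 / 8 * τ * ε := by positivity
  refine (((ha.const_mul (1 / 2)).add (h.integrable_noise hn.le ha hl)).const_mul
    (5 / 8 * τ * ε)⁻¹).mono'
    (((h.adapted_b _ hn).pow 2).mono (h.noise.le _)).aestronglyMeasurable ?_
  filter_upwards [h.coercive_step hτK hn] with ω hω
  rw [Real.norm_of_nonneg (sq_nonneg _), Pi.add_apply, inv_mul_eq_div, le_div_iff₀ hcoef]
  linarith [sq_nonneg (a (n + 1) ω)]

theorem integrable_l (h : IsEnergyProcess P 𝒢 ξ N τ δ ε C a b l M) (hn : n ≤ N)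
    (ha : Integrable (fun ω => a n ω ^ 2) P) (hb : Integrable (fun ω => b n ω ^ 2) P) :
    Integrable (fun ω => l n ω ^ 2) P := by
  refine (ha.add hb).mono'
    (((h.adapted_l n hn).pow 2).mono (h.noise.le n)).aestronglyMeasurable ?_
  filter_upwards [h.l_sq_le n hn] with ω hω
  rw [Real.norm_of_nonneg (sq_nonneg _), Pi.add_apply]
  linarith [two_mul_le_add_sq (a n ω) (b n ω), sq_nonneg (a n ω), sq_nonneg (b n ω)]

theorem integrable_a_and_l [IsFiniteMeasure P] (h : IsEnergyProcess P 𝒢 ξ N τ δ ε C a b l M)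
    (hτ : 0 < τ) (hε : 0 < ε) (hτK : τ * growthRate C δ ε⁻¹ ≤ 1 / 8) (hn : n ≤ N) :
    Integrable (fun ω => a n ω ^ 2) P ∧ Integrable (fun ω => l n ω ^ 2) P := by
  induction n with
  | zero => exact ⟨h.integrable_a_zero, h.integrable_l_zero⟩
  | succ n ih =>
    obtain ⟨ha, hl⟩ := ih (by omega)
    have ha' := h.integrable_a_succ hτ hε hτK hn ha hl
    exact ⟨ha', h.integrable_l hn ha' (h.integrable_b_succ hτ hε hτK hn ha hl)⟩

theorem integrable_a [IsFiniteMeasure P] (h : IsEnergyProcess P 𝒢 ξ N τ δ ε C a b l M)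
    (hτ : 0 < τ) (hε : 0 < ε) (hτK : τ * growthRate C δ ε⁻¹ ≤ 1 / 8) (hn : n ≤ N) :
    Integrable (fun ω => a n ω ^ 2) P :=
  (h.integrable_a_and_l hτ hε hτK hn).1

theorem integrable_b [IsFiniteMeasure P] (h : IsEnergyProcess P 𝒢 ξ N τ δ ε C a b l M)
    (hτ : 0 < τ) (hε : 0 < ε) (hτK : τ * growthRate C δ ε⁻¹ ≤ 1 / 8)
    (hn : n ∈ Finset.Icc 1 N) : Integrable (fun ω => b n ω ^ 2) P := by
  obtain ⟨hn1, hnN⟩ := Finset.mem_Icc.1 hn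
  obtain ⟨k, rfl⟩ := Nat.exists_eq_add_of_le' hn1
  obtain ⟨ha, hl⟩ := h.integrable_a_and_l hτ hε hτK (k.le_succ.trans hnN)
  exact h.integrable_b_succ hτ hε hτK hnN ha hl

theorem integral_step [IsFiniteMeasure P] (h : IsEnergyProcess P 𝒢 ξ N τ δ ε C a b l M)
    (hτ : 0 < τ) (hε : 0 < ε) (hτK : τ * growthRate C δ ε⁻¹ ≤ 1 / 8) (hn : n < N) :
    1 / 2 * ∫ ω, a (n + 1) ω ^ 2 ∂P + 5 / 8 * τ * ε * ∫ ω, b (n + 1) ω ^ 2 ∂P ≤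
      1 / 2 * ∫ ω, a n ω ^ 2 ∂P + τ * growthRate C δ ε⁻¹ * ∫ ω, a (n + 1) ω ^ 2 ∂P +
        1 / 2 * δ ^ 2 * C ^ 2 * (τ * ∫ ω, l n ω ^ 2 ∂P) := by
  obtain ⟨ha, hl⟩ := h.integrable_a_and_l hτ hε hτK hn.le
  have ha' := h.integrable_a hτ hε hτK hn
  have hb' := h.integrable_b_succ hτ hε hτK hn ha hl
  have hdrift : Integrable (fun ω => 1 / 2 * a n ω ^ 2 +
      τ * growthRate C δ ε⁻¹ * a (n + 1) ω ^ 2) P := (ha.const_mul _).add (ha'.const_mul _)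
  rw [← h.integral_noise hn.le ha hl, ← integral_const_mul, ← integral_const_mul,
    ← integral_const_mul, ← integral_const_mul, ← integral_add (ha'.const_mul _) (hb'.const_mul _),
    ← integral_add (ha.const_mul _) (ha'.const_mul _),
    ← integral_add hdrift (h.integrable_noise hn.le ha hl)]
  refine integral_mono_ae ((ha'.const_mul _).add (hb'.const_mul _))
    (hdrift.add (h.integrable_noise hn.le ha hl)) ?_
  filter_upwards [h.step n hn] with ω hω
  linarith

theorem integral_l_le [IsFiniteMeasure P] (h : IsEnergyProcess P 𝒢 ξ N τ δ ε C a b l M)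
    (hε : 0 < ε) (hn : n ≤ N) (ha : Integrable (fun ω => a n ω ^ 2) P)
    (hb : Integrable (fun ω => b n ω ^ 2) P) :
    1 / 2 * δ ^ 2 * C ^ 2 * ∫ ω, l n ω ^ 2 ∂P ≤
      ε / 8 * ∫ ω, b n ω ^ 2 ∂P + growthRate C δ ε⁻¹ * ∫ ω, a n ω ^ 2 ∂P := by
  rw [← integral_const_mul, ← integral_const_mul, ← integral_const_mul,
    ← integral_add (hb.const_mul _) (ha.const_mul _)]
  refine integral_mono_ae ((h.integrable_l hn ha hb).const_mul _)
    ((hb.const_mul _).add (ha.const_mul _)) ?_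
  filter_upwards [h.l_sq_le n hn] with ω hω
  have hyoung := mul_mul_le_add_mul_sq (by positivity : 0 < ε / 8) (1 / 2 * δ ^ 2 * C ^ 2)
    (a n ω) (b n ω)
  have hcube : 0 ≤ ε⁻¹ ^ 3 * a n ω ^ 2 := by positivity
  rw [inv_div] at hyoung
  calc 1 / 2 * δ ^ 2 * C ^ 2 * l n ω ^ 2 ≤ 1 / 2 * δ ^ 2 * C ^ 2 * (a n ω * b n ω) := by gcongr
    _ ≤ ε / 8 * b n ω ^ 2 + growthRate C δ ε⁻¹ * a n ω ^ 2 := by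
      unfold growthRate
      ring_nf at hyoung hcube ⊢
      linarith

theorem dissipative_step [IsFiniteMeasure P] (h : IsEnergyProcess P 𝒢 ξ N τ δ ε C a b l M)
    (hτ : 0 < τ) (hε : 0 < ε) (hτK : τ * growthRate C δ ε⁻¹ ≤ 1 / 8) (hn : n < N) :
    (1 - 4 * (τ * growthRate C δ ε⁻¹)) * meanEnergy P τ δ C a l (n + 1) +
      τ * ε / 2 * ∫ ω, b (n + 1) ω ^ 2 ∂P ≤ meanEnergy P τ δ C a l n := by
  have hstep := h.integral_step hτ hε hτK hn
  have hyoung := mul_le_mul_of_nonneg_left (h.integral_l_le hε hn (h.integrable_a hτ hε hτK hn)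
    (h.integrable_b hτ hε hτK (Finset.mem_Icc.2 ⟨by omega, hn⟩))) hτ.le
  have hK := growthRate_nonneg (inv_nonneg.2 hε.le) C δ
  have hl : 0 ≤ 4 * (τ * growthRate C δ ε⁻¹) *
      (1 / 2 * δ ^ 2 * C ^ 2 * (τ * ∫ ω, l (n + 1) ω ^ 2 ∂P)) := by positivity
  unfold meanEnergy
  linarith

theorem integral_a_le [IsFiniteMeasure P] (h : IsEnergyProcess P 𝒢 ξ N τ δ ε C a b l M)
    (hτ : 0 < τ) (hε : 0 < ε) (hτK : τ * growthRate C δ ε⁻¹ ≤ 1 / 8) (hn : n ≤ N) :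
    ∫ ω, a n ω ^ 2 ∂P ≤ 2 * (Real.exp (2 * (4 * (τ * growthRate C δ ε⁻¹) * N)) *
      meanEnergy P τ δ C a l 0) := by
  have hK := growthRate_nonneg (inv_nonneg.2 hε.le) C δ
  have hgrowth := le_exp_mul_of_dissipative (by positivity) (by linarith)
    (by positivity : 0 ≤ τ * ε / 2) (meanEnergy_nonneg hτ.le)
    (fun _ => integral_nonneg fun _ => sq_nonneg _)
    (fun _ hk => h.dissipative_step hτ hε hτK hk) hn
  have hl : 0 ≤ 1 / 2 * δ ^ 2 * C ^ 2 * (τ * ∫ ω, l n ω ^ 2 ∂P) := by positivity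
  rw [meanEnergy] at hgrowth
  linarith

theorem sum_integral_b_le [IsFiniteMeasure P] (h : IsEnergyProcess P 𝒢 ξ N τ δ ε C a b l M)
    (hτ : 0 < τ) (hε : 0 < ε) (hτK : τ * growthRate C δ ε⁻¹ ≤ 1 / 8) :
    ∑ n ∈ Finset.Icc 1 N, τ * ∫ ω, b n ω ^ 2 ∂P ≤ 2 * ε⁻¹ * (meanEnergy P τ δ C a l 0 *
      (1 + 4 * (τ * growthRate C δ ε⁻¹) * N *
        Real.exp (2 * (4 * (τ * growthRate C δ ε⁻¹) * N)))) := by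
  have hK := growthRate_nonneg (inv_nonneg.2 hε.le) C δ
  have hsum := mul_sum_le_of_dissipative (by positivity) (by linarith)
    (by positivity : 0 ≤ τ * ε / 2) (meanEnergy_nonneg hτ.le)
    (fun _ => integral_nonneg fun _ => sq_nonneg _)
    (fun _ hk => h.dissipative_step hτ hε hτK hk)
  refine le_of_eq_of_le ?_ (mul_le_mul_of_nonneg_left hsum (by positivity : 0 ≤ 2 * ε⁻¹))
  rw [← Finset.mul_sum]
  field_simp

end IsEnergyProcess

end EnergyProcess

/-! ### Solutions of the scheme -/

section WienerIncrements

variable {Ω : Type*} [m : MeasurableSpace Ω] {P : Measure Ω} {ℱ : Filtration ℝ≥0 m}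
  {W : ℝ≥0 → Ω → ℝ}

/-- The increments `W_{t_{n+1}} - W_{t_n}` on the grid `t_n = n τ`. -/
def wienerIncrement (W : ℝ≥0 → Ω → ℝ) (τ : ℝ≥0) (n : ℕ) (ω : Ω) : ℝ :=
  W ((n + 1 : ℕ) * τ) ω - W (n * τ) ω

namespace IsWiener

theorem hasLaw_increment (hW : IsWiener P ℱ W) (τ : ℝ≥0) (n : ℕ) :
    HasLaw (wienerIncrement W τ n) (gaussianReal 0 τ) P := by
  have hlaw : HasLaw (wienerIncrement W τ n)
      (gaussianReal 0 (nndist (((n + 1 : ℕ) * τ : ℝ≥0) : ℝ) ((n * τ : ℝ≥0) : ℝ))) P :=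
    hW.brownian.hasLaw_sub ((n + 1 : ℕ) * τ) (n * τ)
  have hstep : nndist (((n + 1 : ℕ) * τ : ℝ≥0) : ℝ) ((n * τ : ℝ≥0) : ℝ) = τ := by
    ext
    push_cast
    rw [Real.dist_eq, ← sub_mul, add_sub_cancel_left, one_mul, abs_of_nonneg τ.coe_nonneg]
  rwa [hstep] at hlaw

theorem integral_increment (hW : IsWiener P ℱ W) (τ : ℝ≥0) (n : ℕ) :
    ∫ ω, wienerIncrement W τ n ω ∂P = 0 := by
  rw [(hW.hasLaw_increment τ n).integral_eq, integral_id_gaussianReal]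

theorem memLp_increment (hW : IsWiener P ℱ W) (τ : ℝ≥0) (n : ℕ) :
    MemLp (wienerIncrement W τ n) 2 P := by
  have hlaw := hW.hasLaw_increment τ n
  refine (memLp_map_measure_iff (g := id) aestronglyMeasurable_id hlaw.aemeasurable).1 ?_
  rw [hlaw.map_eq]
  exact memLp_id_gaussianReal 2

theorem integral_increment_sq (hW : IsWiener P ℱ W) (τ : ℝ≥0) (n : ℕ) :
    ∫ ω, wienerIncrement W τ n ω ^ 2 ∂P = τ := by
  have hlaw := hW.hasLaw_increment τ n
  rw [← variance_of_integral_eq_zero hlaw.aemeasurable (hW.integral_increment τ n),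
    hlaw.variance_eq, variance_id_gaussianReal]

theorem isDiscreteNoise (hW : IsWiener P ℱ W) (τ : ℝ≥0) :
    IsDiscreteNoise P (fun n => ℱ (n * τ)) τ (wienerIncrement W τ) where
  le n := ℱ.le _
  memLp := hW.memLp_increment τ
  integral_eq_zero := hW.integral_increment τ
  integral_sq := hW.integral_increment_sq τ
  indep n := hW.indep _ _ (by gcongr; exact n.le_succ)

end IsWiener

end WienerIncrements

section FiniteElementFunctions

variable {d : ℕ} {D : Set (E d)} {S : Geometry.SimplicialComplex ℝ (E d)} {X : E d → E d}

open Classical in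
/-- A function of `V_h` as an element of the vector space `femSpace D S`; other functions are sent
to `0`. -/
noncomputable def toFem (D : Set (E d)) (S : Geometry.SimplicialComplex ℝ (E d)) (v : E d → ℝ) :
    femSpace D S :=
  if hv : v ∈ Vh D S then ⟨v, hv⟩ else 0

theorem coe_toFem {v : E d → ℝ} (hv : v ∈ Vh D S) : (toFem D S v : E d → ℝ) = v := by
  rw [toFem, dif_pos hv]

theorem neg_sq_add_mul_le_cube_sub_mul (y c : ℝ) :
    -(y - c) ^ 2 + (c ^ 3 - c) * (y - c) ≤ (y ^ 3 - y) * (y - c) := by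
  have hconvex : 0 ≤ (y - c) ^ 2 * ((y + c) ^ 2 + y ^ 2 + c ^ 2) := by positivity
  linarith

namespace IsPolyhedral

theorem subConst_eq (h : IsPolyhedral D S) (v : femSpace D S) (c : ℝ) :
    subConst D v c = (v - c • h.one : femSpace D S) := by
  ext x
  by_cases hx : x ∈ closure D <;> simp [subConst, one, unitFun, hx]

theorem subConst_mem (h : IsPolyhedral D S) {v : E d → ℝ} (hv : v ∈ Vh D S) (c : ℝ) :
    subConst D v c ∈ Vh D S := by
  have hmem := (toFem D S v - c • h.one).2
  rwa [← h.subConst_eq, coe_toFem hv] at hmem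

theorem toFem_subConst (h : IsPolyhedral D S) {v : E d → ℝ} (hv : v ∈ Vh D S) (c : ℝ) :
    toFem D S (subConst D v c) = toFem D S v - c • h.one := by
  refine Subtype.ext ?_
  rw [coe_toFem (h.subConst_mem hv c), ← h.subConst_eq, coe_toFem hv]

theorem integrable_fNl_mul (h : IsPolyhedral D S) (v w : femSpace D S) :
    Integrable (fun x => fNl (v : E d → ℝ) x * (w : E d → ℝ) x) (volume.restrict D) := by
  have := h.isFiniteMeasure
  obtain ⟨M, hM⟩ := h.tri.exists_bound h.isBounded v.2
  have hv := h.tri.measurable v.2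
  refine ((memLp_coe w).integrable one_le_two).bdd_mul (c := M ^ 3 + M)
    ((hv.pow_const 3).sub hv).aestronglyMeasurable (ae_of_all _ fun x => ?_)
  refine (norm_sub_le _ _).trans (add_le_add ?_ (hM x))
  rw [norm_pow]
  exact pow_le_pow_left₀ (norm_nonneg _) (hM x) 3

theorem neg_norm_sq_le_ip_fNl (h : IsPolyhedral D S) (v : femSpace D S) {c : ℝ}
    (hc : inner ℝ (toL2 D S (v - c • h.one)) (toL2 D S h.one) = 0) :
    -‖toL2 D S (v - c • h.one)‖ ^ 2 ≤ ip D (fNl v) (v - c • h.one : femSpace D S) := by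
  have := h.isFiniteMeasure
  set ζ : femSpace D S := v - c • h.one with hζ
  have hlin : Integrable (fun x => (c ^ 3 - c) * (ζ : E d → ℝ) x) (volume.restrict D) :=
    ((memLp_coe ζ).integrable one_le_two).const_mul _
  have hsq : Integrable (fun x => -(ζ : E d → ℝ) x ^ 2) (volume.restrict D) :=
    (memLp_coe ζ).integrable_sq.neg
  rw [h.inner_toL2_one] at hc
  calc -‖toL2 D S ζ‖ ^ 2 = ∫ x in D, (-(ζ : E d → ℝ) x ^ 2 + (c ^ 3 - c) * (ζ : E d → ℝ) x) := by
        rw [integral_add hsq hlin, integral_neg, integral_const_mul, hc, mul_zero, add_zero,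
          norm_toL2_sq]
    _ ≤ ip D (fNl v) ζ := by
        refine setIntegral_mono_on (hsq.add hlin) (h.integrable_fNl_mul v ζ)
          h.isOpen.measurableSet fun x hx => ?_
        have hx' : (ζ : E d → ℝ) x = (v : E d → ℝ) x - c := by
          rw [hζ, ← h.subConst_eq, subConst, Set.indicator_of_mem (subset_closure hx)]
        rw [hx', fNl]
        exact neg_sq_add_mul_le_cube_sub_mul _ _

theorem isAdvection (h : IsPolyhedral D S) (hDr : interior (closure D) = D)
    (hX : ContDiff ℝ 1 X) (hXdiv : ∀ x ∈ D, divergence X x = 0) (hXn : IsTangential D X) {C : ℝ}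
    (hC : ∀ x ∈ D, ‖X x‖ ≤ C) :
    IsAdvection (toL2 D S) h.gradL2 (h.gradDotL2 hX.continuous) C :=
  ⟨h.inner_gradDotL2_toL2 hDr hX hXdiv hXn, h.norm_gradDotL2_le hX.continuous hC⟩

theorem exists_isInverseLaplacian (h : IsPolyhedral D S) (hD : 0 < volume.real D) {K : ℝ}
    (hP : ∀ v, inner ℝ (toL2 D S v) (toL2 D S h.one) = 0 →
      ‖toL2 D S v‖ ^ 2 ≤ K * ‖h.gradL2 v‖ ^ 2) :
    ∃ T, IsInverseLaplacian (toL2 D S) h.gradL2 h.one T := by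
  have := h.tri.finiteDimensional
  refine SCH.exists_isInverseLaplacian h.toL2_injective h.gradL2_one (fun hzero => hD.ne ?_) hP
  rw [← h.norm_toL2_one_sq, hzero, map_zero, norm_zero, zero_pow two_ne_zero]

variable {T : femSpace D S →ₗ[ℝ] femSpace D S}

theorem isDiscInvLap_neg (h : IsPolyhedral D S)
    (hT : IsInverseLaplacian (toL2 D S) h.gradL2 h.one T) {ζ : femSpace D S}
    (hζ : inner ℝ (toL2 D S ζ) (toL2 D S h.one) = 0) :
    IsDiscInvLap D S ζ (-T ζ : femSpace D S) := by
  refine ⟨⟨(-T ζ).2, ?_⟩, fun v hv => ?_⟩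
  · rw [← h.inner_toL2_one, map_neg, inner_neg_left, (hT ζ hζ).1, neg_zero]
  · rw [Submodule.coe_neg, neg_neg]
    exact (h.gradIp_eq (T ζ) ⟨v, hv⟩).trans (((hT ζ hζ).2 ⟨v, hv⟩).trans (ip_eq ζ ⟨v, hv⟩).symm)

theorem gradIp_neg_self_of_isDiscInvLap (h : IsPolyhedral D S)
    (hT : IsInverseLaplacian (toL2 D S) h.gradL2 h.one T) {ζ : femSpace D S}
    (hζ : inner ℝ (toL2 D S ζ) (toL2 D S h.one) = 0) {z : E d → ℝ} (hz : IsDiscInvLap D S ζ z) :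
    gradIp D (-z) (-z) = ‖h.gradL2 (T ζ)‖ ^ 2 := by
  let y : femSpace D S := -⟨z, hz.1.1⟩
  have hy : ∀ v, inner ℝ (h.gradL2 y) (h.gradL2 v) = inner ℝ (h.gradL2 (T ζ)) (h.gradL2 v) :=
    fun v => by
      rw [(hT ζ hζ).2, ← h.gradIp_eq, ← ip_eq]
      exact hz.2 v v.2
  calc gradIp D (-z) (-z) = inner ℝ (h.gradL2 y) (h.gradL2 y) := h.gradIp_eq y y
    _ = ‖h.gradL2 (T ζ)‖ ^ 2 := by
      rw [hy, real_inner_comm, hy, real_inner_self_eq_norm_sq]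

theorem negNorm_sq (h : IsPolyhedral D S) (hT : IsInverseLaplacian (toL2 D S) h.gradL2 h.one T)
    {ζ : femSpace D S} (hζ : inner ℝ (toL2 D S ζ) (toL2 D S h.one) = 0) :
    negNorm D S ζ ^ 2 = ‖h.gradL2 (T ζ)‖ ^ 2 := by
  have hex : ∃ z, IsDiscInvLap D S ζ z := ⟨_, h.isDiscInvLap_neg hT hζ⟩
  have hspec : IsDiscInvLap D S ζ (discInvLap D S ζ) := by
    rw [discInvLap, dif_pos hex]
    exact hex.choose_spec
  rw [negNorm, negIp, h.gradIp_neg_self_of_isDiscInvLap hT hζ hspec, Real.sq_sqrt (sq_nonneg _)]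

theorem norm_projection_le (h : IsPolyhedral D S) {f : E d → ℝ}
    (hf : MemLp f 2 (volume.restrict D)) {U : femSpace D S} {c : ℝ}
    (hU : ∀ v ∈ Vh D S, ip D U v = ip D f v)
    (hc : inner ℝ (toL2 D S (U - c • h.one)) (toL2 D S h.one) = 0) :
    ‖toL2 D S (U - c • h.one)‖ ≤ ‖hf.toLp f‖ := by
  set ζ := U - c • h.one with hζ
  have hproj : inner ℝ (toL2 D S U) (toL2 D S ζ) = inner ℝ (hf.toLp f) (toL2 D S ζ) := by
    rw [← ip_eq, hU ζ ζ.2]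
    exact (inner_toLp_real hf (memLp_coe ζ)).symm
  have hle : ‖toL2 D S ζ‖ * ‖toL2 D S ζ‖ ≤ ‖hf.toLp f‖ * ‖toL2 D S ζ‖ :=
    calc ‖toL2 D S ζ‖ * ‖toL2 D S ζ‖
        = inner ℝ (toL2 D S U - c • toL2 D S h.one) (toL2 D S ζ) := by
          rw [← map_smul, ← map_sub, ← hζ, real_inner_self_eq_norm_mul_norm]
      _ = inner ℝ (hf.toLp f) (toL2 D S ζ) := by
          rw [inner_sub_left, inner_smul_left,
            real_inner_comm (toL2 D S ζ) (toL2 D S h.one), hc, mul_zero, sub_zero, hproj]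
      _ ≤ ‖hf.toLp f‖ * ‖toL2 D S ζ‖ := real_inner_le_norm _ _
  rcases (norm_nonneg (toL2 D S ζ)).eq_or_lt with hzero | hpos
  · exact hzero ▸ norm_nonneg _
  · exact le_of_mul_le_mul_right hle hpos

end IsPolyhedral

end FiniteElementFunctions

section Fluctuation

variable {d : ℕ} {D : Set (E d)} {S : Geometry.SimplicialComplex ℝ (E d)} {X : E d → E d}
  {u0 : E d → ℝ} {δ ε C K : ℝ} {N n : ℕ} {τ : ℝ≥0} {Ω : Type*} [m : MeasurableSpace Ω]
  {P : Measure Ω} {ℱ : Filtration ℝ≥0 m} {W : ℝ≥0 → Ω → ℝ} {u w : ℕ → Ω → E d → ℝ}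
  {T : femSpace D S →ₗ[ℝ] femSpace D S}

/-- The process `u_h^n - ū_0` as a process with values in the vector space `femSpace D S`. -/
noncomputable def fluctuation (D : Set (E d)) (S : Geometry.SimplicialComplex ℝ (E d))
    (u0 : E d → ℝ) (u : ℕ → Ω → E d → ℝ) (n : ℕ) (ω : Ω) : femSpace D S :=
  toFem D S (subConst D (u n ω) (mean D u0))

namespace IsDiscreteSolution

theorem coe_fluctuation (hsol : IsDiscreteSolution D X u0 δ ε S N τ P ℱ W u w)
    (h : IsPolyhedral D S) (hn : n ≤ N) (ω : Ω) :
    (fluctuation D S u0 u n ω : E d → ℝ) = subConst D (u n ω) (mean D u0) :=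
  coe_toFem (h.subConst_mem (hsol.mem_u n hn ω) _)

theorem fluctuation_eq (hsol : IsDiscreteSolution D X u0 δ ε S N τ P ℱ W u w)
    (h : IsPolyhedral D S) (hn : n ≤ N) (ω : Ω) :
    fluctuation D S u0 u n ω = toFem D S (u n ω) - mean D u0 • h.one :=
  h.toFem_subConst (hsol.mem_u n hn ω) _

theorem gradL2_fluctuation (hsol : IsDiscreteSolution D X u0 δ ε S N τ P ℱ W u w)
    (h : IsPolyhedral D S) (hn : n ≤ N) (ω : Ω) :
    h.gradL2 (fluctuation D S u0 u n ω) = h.gradL2 (toFem D S (u n ω)) := by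
  rw [hsol.fluctuation_eq h hn, map_sub, map_smul, h.gradL2_one, smul_zero, sub_zero]

theorem gradNormSq_eq (hsol : IsDiscreteSolution D X u0 δ ε S N τ P ℱ W u w)
    (h : IsPolyhedral D S) (hn : n ≤ N) (ω : Ω) :
    gradNormSq D (u n ω) = ‖h.gradL2 (fluctuation D S u0 u n ω)‖ ^ 2 := by
  rw [hsol.gradL2_fluctuation h hn, ← h.gradNormSq_eq, coe_toFem (hsol.mem_u n hn ω)]

theorem inner_fluctuation_succ (hsol : IsDiscreteSolution D X u0 δ ε S N τ P ℱ W u w)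
    (h : IsPolyhedral D S) {hX : Continuous X}
    (hadv : IsAdvection (toL2 D S) h.gradL2 (h.gradDotL2 hX) C) :
    ∀ᵐ ω ∂P, ∀ n < N, ∀ η : femSpace D S,
      inner ℝ (toL2 D S (fluctuation D S u0 u (n + 1) ω)) (toL2 D S η) =
        inner ℝ (toL2 D S (fluctuation D S u0 u n ω)) (toL2 D S η)
          - τ * inner ℝ (h.gradL2 (toFem D S (w (n + 1) ω))) (h.gradL2 η)
          - τ * (δ ^ 2 / 2) * inner ℝ (h.gradDotL2 hX (fluctuation D S u0 u (n + 1) ω))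
            (h.gradDotL2 hX η)
          + δ * (wienerIncrement W τ n ω *
            inner ℝ (h.gradDotL2 hX (fluctuation D S u0 u n ω)) (toL2 D S η)) := by
  filter_upwards [hsol.step_u] with ω hω n hn η
  have hgradDot : ∀ k ≤ N, h.gradDotL2 hX (fluctuation D S u0 u k ω) =
      h.gradDotL2 hX (toFem D S (u k ω)) := fun k hk => by
    rw [hsol.fluctuation_eq h hk, map_sub, map_smul, hadv.eq_zero h.gradL2_one, smul_zero, sub_zero]
  have hstep := hω n hn η η.2
  rw [← coe_toFem (hsol.mem_u (n + 1) hn ω), ← coe_toFem (hsol.mem_u n hn.le ω),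
    ← coe_toFem (hsol.mem_w (n + 1) hn ω), ip_mul_const, ip_eq, ip_eq, h.gradIp_eq,
    h.ip_gradDot_gradDot_eq hX, h.ip_gradDot_eq hX] at hstep
  rw [hgradDot (n + 1) hn, hgradDot n hn.le, hsol.fluctuation_eq h hn,
    hsol.fluctuation_eq h hn.le, map_sub, map_sub, inner_sub_left, inner_sub_left, hstep,
    wienerIncrement]
  ring

theorem inner_fluctuation_zero_one (hsol : IsDiscreteSolution D X u0 δ ε S N τ P ℱ W u w)
    (h : IsPolyhedral D S) (hD : 0 < volume.real D) :
    ∀ᵐ ω ∂P, inner ℝ (toL2 D S (fluctuation D S u0 u 0 ω)) (toL2 D S h.one) = 0 := by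
  filter_upwards [hsol.init_u] with ω hω
  have hint := hω h.one h.one.2
  rw [← coe_toFem (hsol.mem_u 0 N.zero_le ω), ip_eq, h.ip_one] at hint
  rw [hsol.fluctuation_eq h N.zero_le, map_sub, map_smul, inner_sub_left, inner_smul_left,
    real_inner_self_eq_norm_sq, h.norm_toL2_one_sq, hint, mean, conj_trivial, mul_right_comm,
    inv_mul_cancel₀ hD.ne', one_mul, sub_self]

theorem inner_fluctuation_one (hsol : IsDiscreteSolution D X u0 δ ε S N τ P ℱ W u w)
    (h : IsPolyhedral D S) {hX : Continuous X}
    (hadv : IsAdvection (toL2 D S) h.gradL2 (h.gradDotL2 hX) C) (hD : 0 < volume.real D) :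
    ∀ᵐ ω ∂P, ∀ n ≤ N, inner ℝ (toL2 D S (fluctuation D S u0 u n ω)) (toL2 D S h.one) = 0 := by
  filter_upwards [hsol.inner_fluctuation_zero_one h hD, hsol.inner_fluctuation_succ h hadv]
    with ω hzero hstep n hn
  induction n with
  | zero => exact hzero
  | succ n ih =>
    rw [hstep n hn, ih (by omega), h.gradL2_one, hadv.inner_eq_neg, hadv.eq_zero h.gradL2_one]
    simp only [inner_zero_right, mul_zero, neg_zero, sub_zero, add_zero]

theorem stronglyMeasurable_fluctuation (hsol : IsDiscreteSolution D X u0 δ ε S N τ P ℱ W u w)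
    (h : IsPolyhedral D S) (hn : n ≤ N) {F : Type*} [NormedAddCommGroup F] [NormedSpace ℝ F]
    (f : femSpace D S →ₗ[ℝ] F) :
    StronglyMeasurable[ℱ (n * τ)] fun ω => f (fluctuation D S u0 u n ω) := by
  refine h.tri.stronglyMeasurable_linearMap (fun x => ?_) f
  simp only [hsol.coe_fluctuation h hn, subConst]
  exact (hsol.adapted_u n hn x).sub measurable_const

theorem norm_fluctuation_zero_le (hsol : IsDiscreteSolution D X u0 δ ε S N τ P ℱ W u w)
    (h : IsPolyhedral D S) (hD : 0 < volume.real D) (hu0 : MemLp u0 2 (volume.restrict D)) :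
    ∀ᵐ ω ∂P, ‖toL2 D S (fluctuation D S u0 u 0 ω)‖ ≤ ‖hu0.toLp u0‖ := by
  filter_upwards [hsol.inner_fluctuation_zero_one h hD, hsol.init_u] with ω hmean hinit
  rw [hsol.fluctuation_eq h N.zero_le] at hmean ⊢
  refine h.norm_projection_le hu0 (fun v hv => ?_) hmean
  rw [coe_toFem (hsol.mem_u 0 N.zero_le ω)]
  exact hinit v hv

theorem norm_gradL2_fluctuation_zero_le
    (hsol : IsDiscreteSolution D X u0 δ ε S N τ P ℱ W u w) (h : IsPolyhedral D S)
    (hD : 0 < volume.real D) (hu0 : MemLp u0 2 (volume.restrict D))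
    (hT : IsInverseLaplacian (toL2 D S) h.gradL2 h.one T) (hK : 0 ≤ K)
    (hP : ∀ v, inner ℝ (toL2 D S v) (toL2 D S h.one) = 0 →
      ‖toL2 D S v‖ ^ 2 ≤ K * ‖h.gradL2 v‖ ^ 2) :
    ∀ᵐ ω ∂P, ‖h.gradL2 (T (fluctuation D S u0 u 0 ω))‖ ^ 2 ≤ K * ‖hu0.toLp u0‖ ^ 2 := by
  filter_upwards [hsol.inner_fluctuation_zero_one h hD, hsol.norm_fluctuation_zero_le h hD hu0]
    with ω hmean hle
  exact (hT.norm_grad_sq_le hP hmean).trans (by gcongr)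

theorem energy_step (hsol : IsDiscreteSolution D X u0 δ ε S N τ P ℱ W u w)
    (h : IsPolyhedral D S) {hX : Continuous X}
    (hadv : IsAdvection (toL2 D S) h.gradL2 (h.gradDotL2 hX) C) (hD : 0 < volume.real D)
    (hT : IsInverseLaplacian (toL2 D S) h.gradL2 h.one T) (hε : 0 < ε) (hn : n < N) :
    ∀ᵐ ω ∂P, 1 / 2 * ‖h.gradL2 (T (fluctuation D S u0 u (n + 1) ω))‖ ^ 2 +
        5 / 8 * τ * ε * ‖h.gradL2 (fluctuation D S u0 u (n + 1) ω)‖ ^ 2 ≤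
      1 / 2 * ‖h.gradL2 (T (fluctuation D S u0 u n ω))‖ ^ 2 +
        τ * growthRate C δ ε⁻¹ * ‖h.gradL2 (T (fluctuation D S u0 u (n + 1) ω))‖ ^ 2 +
        δ * (wienerIncrement W τ n ω * inner ℝ (h.gradDotL2 hX (fluctuation D S u0 u n ω))
          (toL2 D S (T (fluctuation D S u0 u n ω)))) +
        1 / 2 * δ ^ 2 * C ^ 2 * (wienerIncrement W τ n ω ^ 2 *
          ‖toL2 D S (fluctuation D S u0 u n ω)‖ ^ 2) := by
  filter_upwards [hsol.inner_fluctuation_one h hadv hD, hsol.inner_fluctuation_succ h hadv,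
    hsol.step_w] with ω hmean hstep hw
  have hpotential := hw n hn _ (fluctuation D S u0 u (n + 1) ω).2
  have hmonotone := h.neg_norm_sq_le_ip_fNl (toFem D S (u (n + 1) ω))
    (hsol.fluctuation_eq h hn ω ▸ hmean (n + 1) hn)
  rw [← coe_toFem (hsol.mem_u (n + 1) hn ω), ← coe_toFem (hsol.mem_w (n + 1) hn ω), ip_eq,
    h.gradIp_eq, ← hsol.gradL2_fluctuation h hn, real_inner_self_eq_norm_sq] at hpotential
  rw [← hsol.fluctuation_eq h hn] at hmonotone
  exact hT.energy_step hadv (hmean (n + 1) hn) (hmean n hn.le) τ.coe_nonneg hε (hstep n hn)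
    hpotential hmonotone

theorem isEnergyProcess [IsProbabilityMeasure P]
    (hsol : IsDiscreteSolution D X u0 δ ε S N τ P ℱ W u w) (h : IsPolyhedral D S)
    {hX : Continuous X} (hadv : IsAdvection (toL2 D S) h.gradL2 (h.gradDotL2 hX) C)
    (hD : 0 < volume.real D) (hu0 : MemLp u0 2 (volume.restrict D))
    (hT : IsInverseLaplacian (toL2 D S) h.gradL2 h.one T) (hK : 0 ≤ K)
    (hP : ∀ v, inner ℝ (toL2 D S v) (toL2 D S h.one) = 0 →
      ‖toL2 D S v‖ ^ 2 ≤ K * ‖h.gradL2 v‖ ^ 2) (hε : 0 < ε) (hW : IsWiener P ℱ W) :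
    IsEnergyProcess P (fun n => ℱ (n * τ)) (wienerIncrement W τ) N τ δ ε C
      (fun n ω => ‖h.gradL2 (T (fluctuation D S u0 u n ω))‖)
      (fun n ω => ‖h.gradL2 (fluctuation D S u0 u n ω)‖)
      (fun n ω => ‖toL2 D S (fluctuation D S u0 u n ω)‖)
      (fun n ω => inner ℝ (h.gradDotL2 hX (fluctuation D S u0 u n ω))
        (toL2 D S (T (fluctuation D S u0 u n ω)))) where
  noise := hW.isDiscreteNoise τ
  adapted_a _ hn := (hsol.stronglyMeasurable_fluctuation h hn (h.gradL2.comp T)).norm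
  adapted_b _ hn := (hsol.stronglyMeasurable_fluctuation h hn h.gradL2).norm
  adapted_l _ hn := (hsol.stronglyMeasurable_fluctuation h hn (toL2 D S)).norm
  adapted_M _ hn := (hsol.stronglyMeasurable_fluctuation h hn (h.gradDotL2 hX)).inner
    (hsol.stronglyMeasurable_fluctuation h hn ((toL2 D S).comp T))
  integrable_a_zero := by
    refine Integrable.of_bound (((hsol.stronglyMeasurable_fluctuation h N.zero_le
      (h.gradL2.comp T)).norm.pow 2).mono (ℱ.le _)).aestronglyMeasurable
      (K * ‖hu0.toLp u0‖ ^ 2) ?_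
    filter_upwards [hsol.norm_gradL2_fluctuation_zero_le h hD hu0 hT hK hP] with ω hω
    rwa [Real.norm_of_nonneg (sq_nonneg _)]
  integrable_l_zero := by
    refine Integrable.of_bound (((hsol.stronglyMeasurable_fluctuation h N.zero_le
      (toL2 D S)).norm.pow 2).mono (ℱ.le _)).aestronglyMeasurable (‖hu0.toLp u0‖ ^ 2) ?_
    filter_upwards [hsol.norm_fluctuation_zero_le h hD hu0] with ω hω
    rw [Real.norm_of_nonneg (sq_nonneg _)]
    gcongr
  l_sq_le n hn := by
    filter_upwards [hsol.inner_fluctuation_one h hadv hD] with ω hω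
      using hT.norm_val_sq_le (hω n hn)
  abs_M_le _ _ := hadv.abs_inner_val_le _ _
  step _ hn := hsol.energy_step h hadv hD hT hε hn

theorem mem_Vh0 (hsol : IsDiscreteSolution D X u0 δ ε S N τ P ℱ W u w)
    (h : IsPolyhedral D S) {hX : Continuous X}
    (hadv : IsAdvection (toL2 D S) h.gradL2 (h.gradDotL2 hX) C) (hD : 0 < volume.real D)
    (hn : n ≤ N) : ∀ᵐ ω ∂P, subConst D (u n ω) (mean D u0) ∈ Vh0 D S := by
  filter_upwards [hsol.inner_fluctuation_one h hadv hD] with ω hω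
  rw [← hsol.coe_fluctuation h hn]
  exact ⟨(fluctuation D S u0 u n ω).2, (h.inner_toL2_one _).symm.trans (hω n hn)⟩

theorem negNorm_sq_ae_eq (hsol : IsDiscreteSolution D X u0 δ ε S N τ P ℱ W u w)
    (h : IsPolyhedral D S) {hX : Continuous X}
    (hadv : IsAdvection (toL2 D S) h.gradL2 (h.gradDotL2 hX) C) (hD : 0 < volume.real D)
    (hT : IsInverseLaplacian (toL2 D S) h.gradL2 h.one T) (hn : n ≤ N) :
    (fun ω => negNorm D S (subConst D (u n ω) (mean D u0)) ^ 2) =ᵐ[P]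
      fun ω => ‖h.gradL2 (T (fluctuation D S u0 u n ω))‖ ^ 2 := by
  filter_upwards [hsol.inner_fluctuation_one h hadv hD] with ω hω
  rw [← hsol.coe_fluctuation h hn, h.negNorm_sq hT (hω n hn)]

theorem sum_gradNormSq_eq (hsol : IsDiscreteSolution D X u0 δ ε S N τ P ℱ W u w)
    (h : IsPolyhedral D S) :
    (fun ω => ∑ n ∈ Finset.Icc 1 N, (τ : ℝ) * gradNormSq D (u n ω)) =
      fun ω => ∑ n ∈ Finset.Icc 1 N, (τ : ℝ) * ‖h.gradL2 (fluctuation D S u0 u n ω)‖ ^ 2 :=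
  funext fun ω => Finset.sum_congr rfl fun n hn => by
    rw [hsol.gradNormSq_eq h (Finset.mem_Icc.1 hn).2]

end IsDiscreteSolution

end Fluctuation

/-! ### Stability of the scheme -/

/-- The Gronwall bound for the energy of a process with initial energy at most `e`, where `θ` is the
growth exponent accumulated over the whole time interval and `s = ε⁻¹`. -/
noncomputable def stabilityBound (θ s e : ℝ) : ℝ :=
  2 * (Real.exp (2 * θ) * e) + 2 * s * (e * (1 + θ * Real.exp (2 * θ)))

theorem stabilityBound_mono {θ s e e' : ℝ} (hθ : 0 ≤ θ) (hs : 0 ≤ s) (he : e ≤ e') :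
    stabilityBound θ s e ≤ stabilityBound θ s e' := by
  unfold stabilityBound
  gcongr

theorem mul_growthRate_le {M τ s δ : ℝ} (hs : 0 < s) (hτ : 0 ≤ τ)
    (h : τ ≤ 1 / (8 * (1 + M ^ 4)) * (s ^ 3 + s * δ ^ 4)⁻¹) : τ * growthRate M δ s ≤ 1 / 8 := by
  have hQ : 0 < s ^ 3 + s * δ ^ 4 := by positivity
  rw [← div_eq_mul_inv, le_div_iff₀ hQ] at h
  calc τ * growthRate M δ s ≤ τ * ((1 + M ^ 4) * (s ^ 3 + s * δ ^ 4)) := by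
        gcongr
        exact growthRate_le hs.le M δ
    _ = (1 + M ^ 4) * (τ * (s ^ 3 + s * δ ^ 4)) := by ring
    _ ≤ (1 + M ^ 4) * (1 / (8 * (1 + M ^ 4))) := by gcongr
    _ = 1 / 8 := by field_simp

section EnergyProcess

variable {Ω : Type*} {m : MeasurableSpace Ω} {P : Measure Ω} {𝒢 : ℕ → MeasurableSpace Ω}
  {ξ : ℕ → Ω → ℝ} {N n : ℕ} {τ δ ε C : ℝ} {a b l M : ℕ → Ω → ℝ}

theorem IsEnergyProcess.integral_add_sum_le [IsFiniteMeasure P]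
    (h : IsEnergyProcess P 𝒢 ξ N τ δ ε C a b l M) (hτ : 0 < τ) (hε : 0 < ε)
    (hτK : τ * growthRate C δ ε⁻¹ ≤ 1 / 8) (hn : n ≤ N) :
    ∫ ω, a n ω ^ 2 ∂P + ∑ k ∈ Finset.Icc 1 N, τ * ∫ ω, b k ω ^ 2 ∂P ≤
      stabilityBound (4 * (τ * growthRate C δ ε⁻¹) * N) ε⁻¹ (meanEnergy P τ δ C a l 0) :=
  add_le_add (h.integral_a_le hτ hε hτK hn) (h.sum_integral_b_le hτ hε hτK)

theorem IsEnergyProcess.meanEnergy_zero_le [IsProbabilityMeasure P]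
    (h : IsEnergyProcess P 𝒢 ξ N τ δ ε C a b l M) (hτ : 0 ≤ τ) {A L : ℝ}
    (hA : ∀ᵐ ω ∂P, a 0 ω ^ 2 ≤ A) (hL : ∀ᵐ ω ∂P, l 0 ω ^ 2 ≤ L) :
    meanEnergy P τ δ C a l 0 ≤ 1 / 2 * A + 1 / 2 * δ ^ 2 * C ^ 2 * (τ * L) := by
  have hA' : ∫ ω, a 0 ω ^ 2 ∂P ≤ A := by
    simpa using integral_mono_ae h.integrable_a_zero (integrable_const A) hA
  have hL' : ∫ ω, l 0 ω ^ 2 ∂P ≤ L := by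
    simpa using integral_mono_ae h.integrable_l_zero (integrable_const L) hL
  unfold meanEnergy
  gcongr

end EnergyProcess

section Stability

variable {d : ℕ} {D : Set (E d)} {S : Geometry.SimplicialComplex ℝ (E d)} {X : E d → E d}
  {u0 : E d → ℝ} {δ ε C K : ℝ} {N : ℕ} {τ : ℝ≥0} {Ω : Type*} [m : MeasurableSpace Ω]
  {P : Measure Ω} [IsProbabilityMeasure P] {ℱ : Filtration ℝ≥0 m} {W : ℝ≥0 → Ω → ℝ}
  {u w : ℕ → Ω → E d → ℝ}

theorem IsDiscreteSolution.stability
    (hsol : IsDiscreteSolution D X u0 δ ε S N τ P ℱ W u w) (h : IsPolyhedral D S)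
    {hX : Continuous X} (hadv : IsAdvection (toL2 D S) h.gradL2 (h.gradDotL2 hX) C)
    (hD : 0 < volume.real D) (hu0 : MemLp u0 2 (volume.restrict D)) (hK : 0 ≤ K)
    (hP : ∀ v, inner ℝ (toL2 D S v) (toL2 D S h.one) = 0 →
      ‖toL2 D S v‖ ^ 2 ≤ K * ‖h.gradL2 v‖ ^ 2) (hε : 0 < ε) (hW : IsWiener P ℱ W) (hτ : 0 < τ)
    (hτK : τ * growthRate C δ ε⁻¹ ≤ 1 / 8) :
    (∀ n ≤ N, Integrable (fun ω => negNorm D S (subConst D (u n ω) (mean D u0)) ^ 2) P) ∧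
      Integrable (fun ω => ∑ n ∈ Finset.Icc 1 N, (τ : ℝ) * gradNormSq D (u n ω)) P ∧
      ∀ n ≤ N, ∫ ω, negNorm D S (subConst D (u n ω) (mean D u0)) ^ 2 ∂P +
          ∫ ω, (∑ k ∈ Finset.Icc 1 N, (τ : ℝ) * gradNormSq D (u k ω)) ∂P ≤
        stabilityBound (4 * (τ * growthRate C δ ε⁻¹) * N) ε⁻¹
          (1 / 2 * (K * ‖hu0.toLp u0‖ ^ 2) +
            1 / 2 * δ ^ 2 * C ^ 2 * (τ * ‖hu0.toLp u0‖ ^ 2)) := by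
  obtain ⟨T, hT⟩ := h.exists_isInverseLaplacian hD hP
  have hproc := hsol.isEnergyProcess h hadv hD hu0 hT hK hP hε hW
  have hτ' : (0 : ℝ) < τ := hτ
  have hrate := growthRate_nonneg (inv_nonneg.2 hε.le) C δ
  have hint : ∀ k ∈ Finset.Icc 1 N, Integrable
      (fun ω => (τ : ℝ) * ‖h.gradL2 (fluctuation D S u0 u k ω)‖ ^ 2) P :=
    fun k hk => (hproc.integrable_b hτ' hε hτK hk).const_mul _
  have hzero : ∀ᵐ ω ∂P, ‖toL2 D S (fluctuation D S u0 u 0 ω)‖ ^ 2 ≤ ‖hu0.toLp u0‖ ^ 2 := by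
    filter_upwards [hsol.norm_fluctuation_zero_le h hD hu0] with ω hω
    gcongr
  have henergy := hproc.meanEnergy_zero_le τ.coe_nonneg
    (hsol.norm_gradL2_fluctuation_zero_le h hD hu0 hT hK hP) hzero
  have hnegNorm : ∀ n ≤ N, Integrable
      (fun ω => negNorm D S (subConst D (u n ω) (mean D u0)) ^ 2) P := fun n hn => by
    rw [integrable_congr (hsol.negNorm_sq_ae_eq h hadv hD hT hn)]
    exact hproc.integrable_a hτ' hε hτK hn
  rw [hsol.sum_gradNormSq_eq h, integral_finsetSum _ hint]
  refine ⟨hnegNorm, integrable_finsetSum _ hint, fun n hn => ?_⟩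
  simp only [integral_const_mul]
  rw [integral_congr_ae (hsol.negNorm_sq_ae_eq h hadv hD hT hn)]
  exact (hproc.integral_add_sum_le hτ' hε hτK hn).trans
    (stabilityBound_mono (by positivity) (inv_nonneg.2 hε.le) henergy)

theorem IsPolyhedral.norm_toL2_sq_le (h : IsPolyhedral D S)
    (hP : ∀ v ∈ Vh D S, ∫ x in D, v x = 0 → ∫ x in D, v x ^ 2 ≤ K * gradNormSq D v)
    (v : femSpace D S) (hv : inner ℝ (toL2 D S v) (toL2 D S h.one) = 0) :
    ‖toL2 D S v‖ ^ 2 ≤ K * ‖h.gradL2 v‖ ^ 2 := by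
  rw [h.inner_toL2_one] at hv
  rw [norm_toL2_sq, ← h.gradNormSq_eq]
  exact hP v v.2 hv

end Stability

end SCH

theorem mainTheorem5_general
    (d : ℕ) (D : Set (SCH.E d)) (hDo : IsOpen D) (hDc : IsConnected D)
    (hDb : Bornology.IsBounded D) (hDr : interior (closure D) = D)
    (X : SCH.E d → SCH.E d) (hX : ContDiff ℝ 1 X)
    (hXdiv : ∀ x ∈ D, SCH.divergence X x = 0) (hXn : SCH.IsTangential D X)
    (T : ℝ≥0) (hT : 0 < T)
    (u0 : SCH.E d → ℝ) (hu0 : MemLp u0 2 (volume.restrict D)) :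
    ∃ C₀ : ℝ, 0 < C₀ ∧ ∃ C : ℝ → ℝ → ℝ,
      ∀ δ ε : ℝ, 0 < ε →
      ∀ S : Geometry.SimplicialComplex ℝ (SCH.E d), SCH.IsTriangulation D S →
      ∀ (N : ℕ) (τ : ℝ≥0), 0 < N → τ = T / N →
        (τ : ℝ) ≤ C₀ * ((ε⁻¹) ^ 3 + ε⁻¹ * δ ^ 4)⁻¹ →
      ∀ (Ω : Type*) [m : MeasurableSpace Ω] (P : Measure Ω) [IsProbabilityMeasure P]
        (ℱ : Filtration ℝ≥0 m) (W : ℝ≥0 → Ω → ℝ), SCH.IsWiener P ℱ W →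
      ∀ u w : ℕ → Ω → SCH.E d → ℝ,
        SCH.IsDiscreteSolution D X u0 δ ε S N τ P ℱ W u w →
        (∀ n ≤ N, ∀ᵐ ω ∂P, SCH.subConst D (u n ω) (SCH.mean D u0) ∈ SCH.Vh0 D S) ∧
        (∀ n ≤ N, Integrable
          (fun ω => SCH.negNorm D S (SCH.subConst D (u n ω) (SCH.mean D u0)) ^ 2) P) ∧
        Integrable (fun ω => ∑ n ∈ Finset.Icc 1 N, (τ : ℝ) * SCH.gradNormSq D (u n ω)) P ∧
        (⨆ n : Fin (N + 1),
            ∫ ω, SCH.negNorm D S (SCH.subConst D (u n ω) (SCH.mean D u0)) ^ 2 ∂P)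
          + ∫ ω, (∑ n ∈ Finset.Icc 1 N, (τ : ℝ) * SCH.gradNormSq D (u n ω)) ∂P
          ≤ C δ ε⁻¹ := by
  obtain ⟨M, hM⟩ := hDb.isCompact_closure.exists_bound_of_continuousOn hX.continuous.continuousOn
  obtain ⟨K, hK, hP⟩ := SCH.exists_poincare_Vh hDo hDc.isPreconnected hDb hDr
  have hD : 0 < volume.real D :=
    ENNReal.toReal_pos (hDo.measure_pos volume hDc.nonempty).ne' hDb.measure_lt_top.ne
  refine ⟨1 / (8 * (1 + M ^ 4)), by positivity, fun δ s =>
    SCH.stabilityBound (4 * (T * SCH.growthRate M δ s)) s (1 / 2 * (K * ‖hu0.toLp u0‖ ^ 2) +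
      1 / 2 * δ ^ 2 * M ^ 2 * (T * ‖hu0.toLp u0‖ ^ 2)), ?_⟩
  intro δ ε hε S hS N τ hN hτ hτC Ω m P _ ℱ W hW u w hsol
  have h : SCH.IsPolyhedral D S := ⟨hS, hDo, hDb⟩
  have hN' : (1 : ℝ≥0) ≤ N := by exact_mod_cast hN
  have hτ0 : 0 < τ := hτ ▸ div_pos hT (zero_lt_one.trans_le hN')
  have hτT : τ ≤ T := hτ ▸ div_le_self T.2 hN'
  have hτN : (τ * N : ℝ) = T := by
    rw [hτ, NNReal.coe_div, NNReal.coe_natCast, div_mul_cancel₀ _ (by exact_mod_cast hN.ne')]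
  have hrate := SCH.growthRate_nonneg (inv_nonneg.2 hε.le) M δ
  have hadv := h.isAdvection hDr hX hXdiv hXn fun x hx => hM x (subset_closure hx)
  obtain ⟨hneg, hsum, hbound⟩ := hsol.stability h hadv hD hu0 hK (h.norm_toL2_sq_le (hP S hS)) hε hW
    hτ0 (SCH.mul_growthRate_le (inv_pos.2 hε) τ.2 hτC)
  refine ⟨fun n hn => hsol.mem_Vh0 h hadv hD hn, hneg, hsum, le_sub_iff_add_le.1 <|
    ciSup_le fun n => le_sub_iff_add_le.2 <| (hbound n n.is_le).trans ?_⟩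
  rw [mul_assoc, mul_right_comm, hτN]
  exact SCH.stabilityBound_mono (by positivity) (inv_nonneg.2 hε.le) (by gcongr)

theorem mainTheorem5
    (d : ℕ) (hd : d = 2 ∨ d = 3)
    (D : Set (SCH.E d)) (hDo : IsOpen D) (hDc : IsConnected D)
    (hDb : Bornology.IsBounded D) (hDr : interior (closure D) = D)
    (X : SCH.E d → SCH.E d) (hX : ContDiff ℝ (⊤ : ℕ∞) X)
    (hXdiv : ∀ x ∈ D, SCH.divergence X x = 0) (hXn : SCH.IsTangential D X)
    (T : ℝ≥0) (hT : 0 < T)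
    (u0 : SCH.E d → ℝ) (hu0 : MemLp u0 2 (volume.restrict D))
    (κ : ℝ) (hκ : 0 < κ) :
    ∃ C₀ : ℝ, 0 < C₀ ∧ ∃ C : ℝ → ℝ → ℝ,
      ∀ δ ε : ℝ, 0 < δ → 0 < ε →
      ∀ S : Geometry.SimplicialComplex ℝ (SCH.E d),
        SCH.IsTriangulation D S → SCH.IsQuasiUniform κ S →
      ∀ (N : ℕ) (τ : ℝ≥0), 0 < N → τ = T / N →
        (τ : ℝ) ≤ C₀ * ((ε⁻¹) ^ 3 + ε⁻¹ * δ ^ 4)⁻¹ →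
      ∀ (Ω : Type*) [m : MeasurableSpace Ω] (P : Measure Ω) [IsProbabilityMeasure P]
        (ℱ : Filtration ℝ≥0 m) (W : ℝ≥0 → Ω → ℝ), SCH.IsWiener P ℱ W →
      ∀ u w : ℕ → Ω → SCH.E d → ℝ,
        SCH.IsDiscreteSolution D X u0 δ ε S N τ P ℱ W u w →
        (∀ n ≤ N, ∀ᵐ ω ∂P, SCH.subConst D (u n ω) (SCH.mean D u0) ∈ SCH.Vh0 D S) ∧
        (∀ n ≤ N, Integrable
          (fun ω => SCH.negNorm D S (SCH.subConst D (u n ω) (SCH.mean D u0)) ^ 2) P) ∧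
        Integrable (fun ω => ∑ n ∈ Finset.Icc 1 N, (τ : ℝ) * SCH.gradNormSq D (u n ω)) P ∧
        (⨆ n : Fin (N + 1),
            ∫ ω, SCH.negNorm D S (SCH.subConst D (u n ω) (SCH.mean D u0)) ^ 2 ∂P)
          + ∫ ω, (∑ n ∈ Finset.Icc 1 N, (τ : ℝ) * SCH.gradNormSq D (u n ω)) ∂P
          ≤ C δ ε⁻¹ := by
  obtain ⟨C₀, hC₀, C, hC⟩ := mainTheorem5_general d D hDo hDc hDb hDr X
    (hX.of_le (by exact_mod_cast le_top)) hXdiv hXn T hT u0 hu0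
  exact ⟨C₀, hC₀, C, fun δ ε _ hε S hS _ => hC δ ε hε S hS⟩
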